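/- **Model.** Time is slotted and there are $n\ge 1$ FIFO single-server queues with lengths $Q(t)\in\mathbb N^n$. The arrivals $A(t)\in\mathbb N$ are i.i.d. over slots, and so are the potential service vectors $S(t)\in\mathbb N^n$; the two sequences are independent. All arrivals of a slot join one queue $I^*(t)$, and $Q_l(t+1)=[Q_l(t)+A(t)\mathbf 1\{I^*(t)=l\}-S_l(t)]^+$. The law of $S(1)$ is fixed, with $S_l(1)\le S_{\max}$ a.s. and $\mu_l=\mathbb E[S_l(1)]>0$. The arrivals form a family indexed by $\epsilon\in(0,\epsilon_0)$, with $\mathbb E[A^{(\epsilon)}(1)]=\sum_l\mu_l-\epsilon$, $A^{(\epsilon)}(1)\le nA_{\max}$ a.s. ($A_{\max}$ independent of $\epsilon$) and $\mathrm{Var}(A^{(\epsilon)}(1))\to n\sigma_\lambda^2$ as $\epsilon\downarrow0$. **Policies.** A policy in $\Pi$ is given by a cycle length $T\ge1$, a vector $\gamma\in(0,\infty)^n$, a measurably randomized sorting function $L$ and a measurably randomized decision function $Y$. At time $kT$ it forms a permutation $\eta_k=L((Q_l(kT)/\gamma_l)_l,V_k)$ that arranges the scaled queue lengths in decreasing order,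 and then a sequence of servers $\phi(k)=Y(\eta_k,\mu,W_k)\in[n]^T$, where $V_k,W_k$ are i.i.d. uniform on $[0,1]$ and independent of arrivals and services; the arrivals of slot $kT+j$ ($0\le j<T$) join the queue of the $(j+1)$-st entry of $\phi(k)$. The process $X(t)=(Q(t),\phi(\lfloor t/T\rfloor),t \bmod T)$ is a Markov chain. For $\eta\in\mathcal S_n$ let $f_{l,\eta}$ be the expected fraction of entries of $Y(\eta,\mu,W)$ equal to $\eta(l)$. **Pooled queue.** The resource-pooled single-server queue is $q(t+1)=[q(t)+A(t)-\sum_lS_l(t)]^+$. **Delay.** The delay of a job is the number of slot ends (from its arrival slot on) at which it is still in the system. The mean delay under a stationary law of $X$ is the expected sum of the delays of the jobs arriving in a slot, divided by $\mathbb E[A(1)]$. **Theorem.** Suppose that a policy $\pi\in\Pi$ satisfies $$\sum_{l=1}^m f_{l,\eta}<\frac{\sum_{l=1}^m\mu_{\eta(l)}}{\sum_{l=1}^n\mu_{\eta(l)}}\qquad\text{for all } 1\le m<n,\ \eta\in\mathcal S_n .$$ Then $\pi$ is asymptotically delay-optimal in heavy traffic, and its scaled expected total queue length matches the resource-pooled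 lower bound. Precisely: 1. For all small $\epsilon>0$, the chain $X$ of $\pi$ has a stationary distribution, and the mean delay of $\pi$ is finite under each of them. For every $\delta>0$ and all small enough $\epsilon>0$, $\epsilon$ times the mean delay of $\pi$ is at most $\epsilon$ times the mean delay of $\pi'$ plus $\delta$, for every policy $\pi'\in\Pi$ and all stationary distributions of $\pi$ and of $\pi'$. 2. For every $\epsilon\in(0,\epsilon_0)$ the pooled queue has a stationary distribution, and its stationary mean $\mathbb E[q]$ is at most $\mathbb E[\sum_lQ_l]$ under any stationary distribution of any policy in $\Pi$. 3. As $\epsilon\downarrow0$, for any choice of stationary distributions of $\pi$ and of the pooled queue, $$\lim_{\epsilon\downarrow0}\epsilon\,\mathbb E\Big[\sum_{l=1}^nQ_l\Big]=\lim_{\epsilon\downarrow0}\epsilon\,\mathbb E[q]=\frac{n\sigma_\lambda^2+\mathrm{Var}\big(\sum_{l}S_l(1)\big)}2 ,$$ and if the services are uncorrelated across servers, then $\mathrm{Var}(\sum_lS_l(1))=\sum_l\sigma_l^2$ with $\sigma_l^2=\mathrm{Var}(S_l(1))$. -/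

import Mathlib

open MeasureTheory ProbabilityTheory Filter Topology
open scoped ENNReal NNReal

namespace LoadBalancing

/-- A dispatching policy of the framework `Π` for `n` servers: a cycle length `T`, a scaling vector
`γ` with positive entries, a randomized sorting function `L` that orders the scaled queue lengths
decreasingly, and a randomized decision function `Y` that maps the order and the vector of service
rates to the servers receiving the arrivals of the `T` slots of the cycle. (The unit vector `e_l` is
encoded by its index `l`; `L o v i` is the server with the `i`-th largest scaled queue.) -/
structure Policy (n : ℕ) where
  T : ℕ
  T_pos : 0 < T
  γ : Fin n → ℝ≥0
  γ_pos : ∀ l, 0 < γ l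
  L : (Fin n → ℝ≥0) → unitInterval → Equiv.Perm (Fin n)
  L_measurable : ∀ (o : Fin n → ℝ≥0) (η : Equiv.Perm (Fin n)), MeasurableSet {v | L o v = η}
  L_sorted : ∀ (o : Fin n → ℝ≥0) (v : unitInterval), Antitone fun i => o (L o v i)
  Y : Equiv.Perm (Fin n) → (Fin n → ℝ) → unitInterval → (Fin T → Fin n)
  Y_measurable : ∀ η μ d, MeasurableSet {w | Y η μ w = d}

/-- The vector `μ` of service rates, where `svc` is the law of the vector of potential services of
one time slot. -/
noncomputable def serviceRate {n : ℕ} (svc : Measure (Fin n → ℕ)) (l : Fin n) : ℝ :=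
  ∫ s, (s l : ℝ) ∂svc

namespace Policy

variable {n : ℕ} (P : Policy n)

/-- `f_{l,η}`: the expected fraction of the slots of a cycle whose arrivals are sent to the server
`η l` (the one with the `l`-th longest scaled queue), when the order at the sampling time is `η`. -/
noncomputable def f (μ : Fin n → ℝ) (η : Equiv.Perm (Fin n)) (l : Fin n) : ℝ :=
  ∫ w : unitInterval, ((Finset.univ.filter fun j => P.Y η μ w j = η l).card : ℝ) / P.T

/-- The strict majorization condition. -/
def StrictMajorization (μ : Fin n → ℝ) : Prop :=
  ∀ (η : Equiv.Perm (Fin n)) (m : ℕ), 1 ≤ m → m < n →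
    ∑ l : Fin n with l.val < m, P.f μ η l
      < (∑ l : Fin n with l.val < m, μ (η l)) / ∑ l, μ (η l)

/-- States `(Q(t), φ(⌊t/T⌋), t mod T)` of the Markov chain of the policy. -/
abbrev State : Type := (Fin n → ℕ) × (Fin P.T → Fin n) × Fin P.T

/-- The decision vector of a cycle sampled at queue lengths `q` with randomization variables
`v`, `w`. -/
noncomputable def decision (μ : Fin n → ℝ) (q : Fin n → ℕ) (v w : unitInterval) : Fin P.T → Fin n :=
  P.Y (P.L (fun l => (q l : ℝ≥0) / P.γ l) v) μ w

/-- Queue lengths after a slot with `a` arrivals, all sent to the server that the current decision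
vector prescribes, and potential services `s`; the subtraction is truncated, i.e. `[·]⁺`. -/
def nextQueue (x : P.State) (a : ℕ) (s : Fin n → ℕ) : Fin n → ℕ :=
  fun l => x.1 l + (if x.2.1 x.2.2 = l then a else 0) - s l

/-- One step of the chain, as a function of the state and of the independent inputs of the slot
`(a, s, v, w)`; at the end of a cycle the queues are sampled and a new decision vector is drawn. -/
noncomputable def step (μ : Fin n → ℝ) (x : P.State)
    (i : ℕ × (Fin n → ℕ) × unitInterval × unitInterval) : P.State :=
  if h : (x.2.2 : ℕ) + 1 < P.T then
    (P.nextQueue x i.1 i.2.1, x.2.1, ⟨x.2.2 + 1, h⟩)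
  else
    (P.nextQueue x i.1 i.2.1, P.decision μ (P.nextQueue x i.1 i.2.1) i.2.2.1 i.2.2.2, ⟨0, P.T_pos⟩)

/-- The transition kernel of the Markov chain of the policy. -/
noncomputable def kernel (svc : Measure (Fin n → ℕ)) (arr : Measure ℕ) : Kernel P.State P.State :=
  Kernel.ofFunOfCountable fun x =>
    (arr.prod (svc.prod ((volume : Measure unitInterval).prod (volume : Measure unitInterval)))).map
      (P.step (serviceRate svc) x)

theorem measurable_step (μ : Fin n → ℝ) (x : P.State) : Measurable (P.step μ x) := by
  have hq : Measurable fun i : ℕ × (Fin n → ℕ) × unitInterval × unitInterval =>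
      P.nextQueue x i.1 i.2.1 :=
    (measurable_of_countable fun p : ℕ × (Fin n → ℕ) => P.nextQueue x p.1 p.2).comp
      (measurable_fst.prodMk (measurable_fst.comp measurable_snd))
  have hd : ∀ q, Measurable fun p : unitInterval × unitInterval => P.decision μ q p.1 p.2 := by
    intro q
    refine measurable_to_countable' fun d => ?_
    have : (fun p : unitInterval × unitInterval => P.decision μ q p.1 p.2) ⁻¹' {d}
        = ⋃ η, {v | P.L (fun l => (q l : ℝ≥0) / P.γ l) v = η} ×ˢ {w | P.Y η μ w = d} := by
      ext p
      simp [decision]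
    rw [this]
    exact MeasurableSet.iUnion fun η => (P.L_measurable _ η).prod (P.Y_measurable η μ d)
  have hd' : Measurable fun p : (Fin n → ℕ) × unitInterval × unitInterval =>
      P.decision μ p.1 p.2.1 p.2.2 :=
    measurable_from_prod_countable_right hd
  unfold step
  split_ifs with h
  · exact hq.prodMk measurable_const
  · exact hq.prodMk ((hd'.comp (hq.prodMk (measurable_snd.comp measurable_snd))).prodMk
      measurable_const)

instance (svc : Measure (Fin n → ℕ)) (arr : Measure ℕ) [IsProbabilityMeasure svc]
    [IsProbabilityMeasure arr] : IsMarkovKernel (P.kernel svc arr) :=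
  ⟨fun x => Measure.isProbabilityMeasure_map (P.measurable_step _ x).aemeasurable⟩

/-- `ρ` is a steady-state distribution of the Markov chain of the policy. -/
def IsSteadyState (svc : Measure (Fin n → ℕ)) (arr : Measure ℕ) (ρ : Measure P.State) : Prop :=
  IsProbabilityMeasure ρ ∧ (P.kernel svc arr).Invariant ρ

/-- The expected total queue length `E[∑ l, Q_l]` under a law of the state. -/
noncomputable def meanTotalQueue (ρ : Measure P.State) : ℝ≥0∞ :=
  ∫⁻ x, ∑ l, (x.1 l : ℝ≥0∞) ∂ρ

end Policy

/-- The delay of a job that joins the FIFO queue of server `l` behind `p` other jobs, in terms of the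
potential services `s r` of the `r`-th slot from its arrival slot on: the number of slot ends at which
the job is still in the system (at the end of slot `u` it is present iff at most `p` services have
been offered). -/
noncomputable def delay {n : ℕ} (l : Fin n) (p : ℕ) (s : ℕ → Fin n → ℕ) : ℝ≥0∞ :=
  ∑' u : ℕ, if ∑ r ∈ Finset.range (u + 1), s r l ≤ p then 1 else 0

/-- The mean delay per job in steady state: the expected sum of the delays of the jobs arriving in a
slot, divided by the expected number of these jobs. The `k`-th job of a batch has the jobs already
queued and the `k` previous jobs of the batch ahead of it. -/
noncomputable def Policy.meanDelay {n : ℕ} (P : Policy n) (svc : Measure (Fin n → ℕ))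
    [IsProbabilityMeasure svc] (arr : Measure ℕ) (ρ : Measure P.State) : ℝ≥0∞ :=
  (∫⁻ x, ∫⁻ a : ℕ, ∑ k ∈ Finset.range a,
      ∫⁻ s, delay (x.2.1 x.2.2) (x.1 (x.2.1 x.2.2) + k) s ∂(Measure.infinitePi fun _ : ℕ => svc)
    ∂arr ∂ρ) / ∫⁻ a : ℕ, (a : ℝ≥0∞) ∂arr

/-- The transition kernel of the resource-pooled single-server queue, with the same arrivals and with
`∑ l, S_l` potential services per slot. -/
noncomputable def pooledKernel {n : ℕ} (svc : Measure (Fin n → ℕ)) (arr : Measure ℕ) : Kernel ℕ ℕ :=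
  Kernel.ofFunOfCountable fun q =>
    (arr.prod svc).map fun i => q + i.1 - ∑ l, i.2 l

/-- `ν` is a steady-state distribution of the resource-pooled single-server queue. -/
def IsPooledSteadyState {n : ℕ} (svc : Measure (Fin n → ℕ)) (arr : Measure ℕ) (ν : Measure ℕ) :
    Prop :=
  IsProbabilityMeasure ν ∧ (pooledKernel svc arr).Invariant ν

/-- The expected queue length of the resource-pooled single-server queue. -/
noncomputable def pooledMeanQueue (ν : Measure ℕ) : ℝ≥0∞ :=
  ∫⁻ q : ℕ, (q : ℝ≥0∞) ∂ν

/-- Asymptotic delay optimality of `P` in heavy traffic, for a family of arrival laws `arr ε`: as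
`ε ↓ 0` the policy is stable, its mean delay is finite, and its scaled mean delay exceeds that of any
policy of the framework by at most `o(1)`. -/
def Policy.IsHeavyTrafficDelayOptimal {n : ℕ} (P : Policy n) (svc : Measure (Fin n → ℕ))
    [IsProbabilityMeasure svc] (arr : ℝ → Measure ℕ) : Prop :=
  (∀ᶠ ε in 𝓝[>] (0 : ℝ), ∃ ρ, P.IsSteadyState svc (arr ε) ρ) ∧
  (∀ᶠ ε in 𝓝[>] (0 : ℝ), ∀ ρ, P.IsSteadyState svc (arr ε) ρ → P.meanDelay svc (arr ε) ρ < ∞) ∧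
  ∀ δ : ℝ≥0∞, 0 < δ → ∀ᶠ ε in 𝓝[>] (0 : ℝ), ∀ ρ, P.IsSteadyState svc (arr ε) ρ →
    ∀ (P' : Policy n) (ρ' : Measure P'.State), P'.IsSteadyState svc (arr ε) ρ' →
      ENNReal.ofReal ε * P.meanDelay svc (arr ε) ρ
        ≤ ENNReal.ofReal ε * P'.meanDelay svc (arr ε) ρ' + δ

end LoadBalancing

/-! By Little's law (`meanDelay_eq`) the mean delay is the stationary mean total queue length
divided by the arrival rate. It therefore suffices to squeeze `ε E[∑ Q_l]` between two bounds with a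
common limit, half the limiting second moment of the net input `A - ∑ S_l`
(`exists_heavyTraffic_bounds`).

The lower bound holds for every policy. Driven by the same arrivals and services, separate queues
can waste service at one server while work waits at another, and the pooled queue cannot. A coupling
shows that its stationary mean is the smaller one (`pooledMeanQueue_le_meanTotalQueue`), and a
quadratic test function bounds that mean from below up to an error that vanishes after scaling
(`le_two_mul_pooledMeanQueue`).

The upper bound rests on state space collapse. In the drift of `(∑ Q_l)²` the dangerous term is the
product of the next total queue length and the unused service. Service is unused only at a server
whose queue is then empty; if the queue vector is nearly proportional to `γ`, an empty queue forces
a small total. The product is thus controlled by the unused service, whose stationary mean is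
exactly `ε`, and by the form `pairing 1`, which measures the deviation of the queues from the ray
spanned by `γ` and has a stationary mean bounded uniformly in `ε` (`exists_collapse_bound`).

The majorization condition enters through summation by parts: scaled queue lengths in decreasing
order, weighted by net input rates whose partial sums are at most `-δ`, yield a drift of order `-δ`
times the spread of the scaled queues. Since a decision is frozen for a cycle of `T` slots, this
drift is invisible slot by slot. The Lyapunov functions are therefore evaluated at `forecast`, the
queue lengths plus the expected net input of the rest of the cycle. Within a cycle the forecast
changes only by centered noise and unused service, and the whole drift appears when a new decision
is drawn. An extra term proportional to the number of slots left spreads this gain over the cycle.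

The upper bounds on stationary means come from one comparison principle, `lintegral_le_of_drift`,
which does not ask the Lyapunov function to be integrable. -/

namespace LoadBalancing

set_option linter.unusedSectionVars false

/-! ### Foster–Lyapunov criteria for Markov chains on countable spaces. -/

section CountableMarkov

variable {X : Type*} [MeasurableSpace X]

/-- The Markov operator `f ↦ ∫ f dκ(x, ·)` of a kernel. -/
noncomputable def markovOp (κ : Kernel X X) (f : X → ℝ≥0∞) (x : X) : ℝ≥0∞ := ∫⁻ y, f y ∂κ x

theorem markovOp_mono (κ : Kernel X X) : Monotone (markovOp κ) :=
  fun _ _ hfg _ => lintegral_mono hfg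

theorem iterate_markovOp_const (κ : Kernel X X) [IsMarkovKernel κ] (t : ℕ) (c : ℝ≥0∞) :
    (markovOp κ)^[t] (fun _ => c) = fun _ => c := by
  induction t with
  | zero => rfl
  | succ t ih =>
    rw [Function.iterate_succ_apply', ih]
    funext x
    simp [markovOp]

theorem iterate_markovOp_le (κ : Kernel X X) [IsMarkovKernel κ] (t : ℕ) {f : X → ℝ≥0∞} {c : ℝ≥0∞}
    (h : ∀ x, f x ≤ c) (x : X) : (markovOp κ)^[t] f x ≤ c := by
  have := (markovOp_mono κ).iterate t (show f ≤ fun _ => c from h) x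
  rwa [iterate_markovOp_const] at this

variable [Countable X] [MeasurableSingletonClass X]

theorem lintegral_markovOp {κ : Kernel X X} {ρ : Measure X} (h : κ.Invariant ρ) (f : X → ℝ≥0∞) :
    ∫⁻ x, markovOp κ f x ∂ρ = ∫⁻ x, f x ∂ρ := by
  conv_rhs => rw [← h.def]
  rw [Measure.lintegral_bind κ.measurable.aemeasurable (measurable_of_countable f).aemeasurable]
  rfl

theorem lintegral_iterate_markovOp {κ : Kernel X X} {ρ : Measure X} (h : κ.Invariant ρ)
    (f : X → ℝ≥0∞) (t : ℕ) : ∫⁻ x, (markovOp κ)^[t] f x ∂ρ = ∫⁻ x, f x ∂ρ := by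
  induction t with
  | zero => rfl
  | succ t ih => rw [Function.iterate_succ_apply', lintegral_markovOp h, ih]

theorem markovOp_add (κ : Kernel X X) (f g : X → ℝ≥0∞) :
    markovOp κ (f + g) = markovOp κ f + markovOp κ g :=
  funext fun _ => lintegral_add_left (measurable_of_countable f) g

theorem iterate_markovOp_add (κ : Kernel X X) (t : ℕ) (f g : X → ℝ≥0∞) :
    (markovOp κ)^[t] (f + g) = (markovOp κ)^[t] f + (markovOp κ)^[t] g := by
  induction t generalizing f g with
  | zero => rfl
  | succ t ih => simp only [Function.iterate_succ_apply, markovOp_add, ih]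

/-- Telescoping of the drift inequality under iteration, kept in additive form because differences
in `ℝ≥0∞` are truncated. -/
theorem sum_iterate_markovOp_le_of_drift {κ : Kernel X X} {V g h : X → ℝ≥0∞}
    (hd : ∀ x, markovOp κ V x + g x ≤ V x + h x) (N : ℕ) (x : X) :
    ∑ t ∈ Finset.range N, (markovOp κ)^[t] g x + (markovOp κ)^[N] V x
      ≤ V x + ∑ t ∈ Finset.range N, (markovOp κ)^[t] h x := by
  induction N with
  | zero => simp
  | succ N ih =>
    have h1 : (markovOp κ)^[N] (markovOp κ V + g) x ≤ (markovOp κ)^[N] (V + h) x :=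
      (markovOp_mono κ).iterate N (show markovOp κ V + g ≤ V + h from hd) x
    rw [iterate_markovOp_add, iterate_markovOp_add, ← Function.iterate_succ_apply] at h1
    simp only [Pi.add_apply] at h1
    rw [Finset.sum_range_succ, Finset.sum_range_succ]
    calc _ = ∑ t ∈ Finset.range N, (markovOp κ)^[t] g x
          + ((markovOp κ)^[N + 1] V x + (markovOp κ)^[N] g x) := by ring
      _ ≤ ∑ t ∈ Finset.range N, (markovOp κ)^[t] g x
          + ((markovOp κ)^[N] V x + (markovOp κ)^[N] h x) := by gcongr
      _ = (∑ t ∈ Finset.range N, (markovOp κ)^[t] g x + (markovOp κ)^[N] V x)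
          + (markovOp κ)^[N] h x := by ring
      _ ≤ (V x + ∑ t ∈ Finset.range N, (markovOp κ)^[t] h x) + (markovOp κ)^[N] h x := by gcongr
      _ = _ := by ring

/-- Comparison of stationary expectations under a Foster–Lyapunov drift condition; no integrability
of the Lyapunov function is needed. -/
theorem lintegral_le_of_drift {κ : Kernel X X} [IsMarkovKernel κ] {ρ : Measure X}
    [IsProbabilityMeasure ρ] (hρ : κ.Invariant ρ) {V g h : X → ℝ≥0∞} (hV : ∀ x, V x ≠ ∞)
    (hd : ∀ x, markovOp κ V x + g x ≤ V x + h x) : ∫⁻ x, g x ∂ρ ≤ ∫⁻ x, h x ∂ρ := by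
  -- Averaging the telescoped drift over `N + 1` steps leaves `V / (N + 1)`, which tends to zero
  -- pointwise but need not be integrable. Cutting `g` off at `M` allows this term to be replaced by
  -- `min M (V / (N + 1))`, to which dominated convergence applies.
  have key : ∀ M : ℕ, ∫⁻ x, min (g x) M ∂ρ ≤ ∫⁻ x, h x ∂ρ := by
    intro M
    set gM : X → ℝ≥0∞ := fun x => min (g x) M with hgM
    have hdM : ∀ x, markovOp κ V x + gM x ≤ V x + h x := fun x =>
      (by gcongr; exact min_le_left _ _ : _ ≤ markovOp κ V x + g x).trans (hd x)
    have hN : ∀ N : ℕ, ∫⁻ x, gM x ∂ρ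
        ≤ ∫⁻ x, min (M : ℝ≥0∞) (V x / (N + 1 : ℕ)) ∂ρ + ∫⁻ x, h x ∂ρ := by
      intro N
      have hN0 : ((N + 1 : ℕ) : ℝ≥0∞) ≠ 0 := by simp
      have hNt : ((N + 1 : ℕ) : ℝ≥0∞) ≠ ∞ := ENNReal.natCast_ne_top _
      have hav : ∀ f : X → ℝ≥0∞,
          ∫⁻ x, (∑ t ∈ Finset.range (N + 1), (markovOp κ)^[t] f x) / (N + 1 : ℕ) ∂ρ
            = ∫⁻ x, f x ∂ρ := by
        intro f
        simp_rw [div_eq_mul_inv]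
        rw [lintegral_mul_const _ (measurable_of_countable _),
          lintegral_finsetSum _ (fun t _ => measurable_of_countable _)]
        simp_rw [lintegral_iterate_markovOp hρ]
        rw [Finset.sum_const, Finset.card_range, nsmul_eq_mul, mul_comm, ← mul_assoc,
          ENNReal.inv_mul_cancel hN0 hNt, one_mul]
      rw [← hav gM, ← hav h, ← lintegral_add_left (measurable_of_countable _)]
      refine lintegral_mono fun x => ?_
      have h1 : (∑ t ∈ Finset.range (N + 1), (markovOp κ)^[t] gM x) / (N + 1 : ℕ) ≤ M := by
        rw [ENNReal.div_le_iff hN0 hNt]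
        calc _ ≤ ∑ t ∈ Finset.range (N + 1), (M : ℝ≥0∞) :=
              Finset.sum_le_sum fun t _ => iterate_markovOp_le κ t (fun _ => min_le_right _ _) x
          _ = _ := by simp [mul_comm]
      have h2 : (∑ t ∈ Finset.range (N + 1), (markovOp κ)^[t] gM x) / (N + 1 : ℕ)
          ≤ V x / (N + 1 : ℕ)
            + (∑ t ∈ Finset.range (N + 1), (markovOp κ)^[t] h x) / (N + 1 : ℕ) := by
        rw [← ENNReal.add_div]
        gcongr
        exact le_self_add.trans (sum_iterate_markovOp_le_of_drift hdM (N + 1) x)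
      calc _ ≤ min (M : ℝ≥0∞) (V x / (N + 1 : ℕ)
            + (∑ t ∈ Finset.range (N + 1), (markovOp κ)^[t] h x) / (N + 1 : ℕ)) := le_min h1 h2
        _ ≤ _ := by
          rw [min_le_iff]
          rcases le_total (M : ℝ≥0∞) (V x / (N + 1 : ℕ)) with h3 | h3
          · left; rw [min_eq_left h3]; exact le_self_add
          · right; rw [min_eq_right h3]
    have hlim : Tendsto (fun N : ℕ => ∫⁻ x, min (M : ℝ≥0∞) (V x / (N + 1 : ℕ)) ∂ρ) atTop
        (𝓝 (∫⁻ _, 0 ∂ρ)) := by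
      refine tendsto_lintegral_of_dominated_convergence (fun _ => (M : ℝ≥0∞))
        (fun _ => measurable_of_countable _) (fun _ => ae_of_all _ fun _ => min_le_left _ _)
        (by simp) (ae_of_all _ fun x => ?_)
      have h1 : Tendsto (fun N : ℕ => V x / (N + 1 : ℕ)) atTop (𝓝 0) := by
        have := ENNReal.Tendsto.const_div (a := V x)
          (ENNReal.tendsto_nat_nhds_top.comp (tendsto_add_atTop_nat 1)) (Or.inr (hV x))
        simpa using this
      exact tendsto_of_tendsto_of_tendsto_of_le_of_le tendsto_const_nhds h1
        (fun _ => zero_le) (fun _ => min_le_right _ _)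
    have h2 := ge_of_tendsto' (hlim.add_const (∫⁻ x, h x ∂ρ)) hN
    simpa using h2
  have hmono : ∫⁻ x, g x ∂ρ = ⨆ M : ℕ, ∫⁻ x, min (g x) M ∂ρ := by
    rw [← lintegral_iSup (fun _ => measurable_of_countable _)
      (fun a b hab x => by dsimp only; gcongr)]
    refine lintegral_congr fun x => ?_
    rw [← inf_iSup_eq, ENNReal.iSup_natCast, inf_top_eq]
  rw [hmono]
  exact iSup_le key

/-- A chain on a countable space with a Foster–Lyapunov drift that has finite sublevel sets has a
stationary distribution. -/
theorem exists_invariant_of_drift (κ : Kernel X X) [IsMarkovKernel κ] (x₀ : X)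
    {V g : X → ℝ≥0∞} {C : ℝ≥0∞} (hC : C ≠ ∞) (hV : V x₀ ≠ ∞)
    (hd : ∀ x, markovOp κ V x + g x ≤ V x + C) (hg : ∀ R : ℕ, {x | g x ≤ R}.Finite) :
    ∃ ρ : Measure X, IsProbabilityMeasure ρ ∧ κ.Invariant ρ := by
  classical
  -- Krylov–Bogolyubov: along a nonprincipal ultrafilter the Cesàro averages of all test functions
  -- converge at once in the compact space `ℝ≥0∞`, so no subsequence has to be extracted. The limit
  -- `Λ` is additive and monotone.
  let U : Ultrafilter ℕ := hyperfilter ℕ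
  have hU : (U : Filter ℕ) ≤ atTop := Nat.hyperfilter_le_atTop
  let avg (f : X → ℝ≥0∞) (N : ℕ) : ℝ≥0∞ :=
    (∑ t ∈ Finset.range N, (markovOp κ)^[t] f x₀) / N
  have hex : ∀ f, ∃ l, Tendsto (avg f) U (𝓝 l) := fun f =>
    ⟨_, Ultrafilter.le_nhds_lim (U.map (avg f))⟩
  choose Λ hΛ using hex
  have avg_add : ∀ f g, avg (f + g) = avg f + avg g := by
    intro f g
    funext N
    simp only [avg, iterate_markovOp_add, Pi.add_apply, Finset.sum_add_distrib, ENNReal.add_div]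
  have Λ_add : ∀ f g, Λ (f + g) = Λ f + Λ g := fun f g =>
    tendsto_nhds_unique (hΛ (f + g)) (by rw [avg_add]; exact (hΛ f).add (hΛ g))
  have avg_mono : ∀ f g, f ≤ g → ∀ N, avg f N ≤ avg g N := by
    intro f g hfg N
    refine ENNReal.div_le_div_right (Finset.sum_le_sum fun t _ => ?_) _
    exact (markovOp_mono κ).iterate t hfg x₀
  have Λ_mono : ∀ f g, f ≤ g → Λ f ≤ Λ g := fun f g hfg =>
    le_of_tendsto_of_tendsto' (hΛ f) (hΛ g) (avg_mono f g hfg)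
  have evN : ∀ᶠ N in (U : Filter ℕ), 1 ≤ N := hU (eventually_ge_atTop 1)
  have Λ_const : ∀ c, Λ (fun _ => c) = c := by
    intro c
    refine tendsto_nhds_unique (hΛ _) (tendsto_const_nhds.congr' ?_)
    filter_upwards [evN] with N hN
    have h0 : (N : ℝ≥0∞) ≠ 0 := by exact_mod_cast (by omega : N ≠ 0)
    simp only [avg, iterate_markovOp_const, Finset.sum_const, Finset.card_range, nsmul_eq_mul]
    rw [mul_comm, ENNReal.mul_div_cancel_right h0 (ENNReal.natCast_ne_top _)]
  have Λ_smul : ∀ (f : X → ℝ≥0∞) (c : ℝ≥0∞), c ≠ ∞ → Λ (fun x => f x * c) = Λ f * c := by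
    intro f c hc
    have it : ∀ t, (markovOp κ)^[t] (fun x => f x * c) = fun x => (markovOp κ)^[t] f x * c := by
      intro t
      induction t with
      | zero => rfl
      | succ t ih =>
        rw [Function.iterate_succ_apply', ih, Function.iterate_succ_apply']
        funext x
        exact lintegral_mul_const _ (measurable_of_countable _)
    refine tendsto_nhds_unique (hΛ _) ?_
    have : avg (fun x => f x * c) = fun N => avg f N * c := by
      funext N
      simp only [avg, it, ← Finset.sum_mul, div_eq_mul_inv]
      ring
    rw [this]
    exact ENNReal.Tendsto.mul_const (hΛ f) (Or.inr hc)
  let e (y : X) : X → ℝ≥0∞ := fun x => if x = y then 1 else 0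
  have Λ_sum : ∀ (F : Finset X) (c : X → ℝ≥0∞), (∀ x, c x ≠ ∞) →
      Λ (fun x => if x ∈ F then c x else 0) = ∑ y ∈ F, Λ (e y) * c y := by
    intro F c hc
    induction F using Finset.induction_on with
    | empty => simpa using Λ_const 0
    | insert a F ha ih =>
      rw [Finset.sum_insert ha, ← ih, ← Λ_smul _ _ (hc a), ← Λ_add]
      congr 1
      funext x
      by_cases hxa : x = a
      · subst hxa; simp [e, ha]
      · simp [e, hxa]
  -- `Λ` is only known to be finitely additive. The measure `ρ` keeps its point masses, and
  -- integration against `ρ` is at most `Λ`.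
  let ρ : Measure X := Measure.sum fun y => Λ (e y) • Measure.dirac y
  have hρf : ∀ f : X → ℝ≥0∞, ∫⁻ x, f x ∂ρ = ∑' y, Λ (e y) * f y := by
    intro f
    simp [ρ, lintegral_sum_measure, lintegral_smul_measure]
  have hρle : ∀ f : X → ℝ≥0∞, (∀ x, f x ≠ ∞) → ∫⁻ x, f x ∂ρ ≤ Λ f := by
    intro f hf
    rw [hρf, ENNReal.tsum_eq_iSup_sum]
    refine iSup_le fun F => ?_
    rw [← Λ_sum F f hf]
    refine Λ_mono _ _ fun x => ?_
    dsimp only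
    split_ifs <;> simp
  have hΛg : Λ g ≤ C := by
    have h1 : Tendsto (fun N : ℕ => V x₀ / N + C) U (𝓝 (0 + C)) := by
      refine Tendsto.add_const C (Tendsto.mono_left ?_ hU)
      simpa using ENNReal.Tendsto.const_div (a := V x₀) ENNReal.tendsto_nat_nhds_top (Or.inr hV)
    rw [← zero_add C]
    refine le_of_tendsto_of_tendsto (hΛ g) h1 ?_
    filter_upwards [evN] with N hN
    have h0 : (N : ℝ≥0∞) ≠ 0 := by exact_mod_cast (by omega : N ≠ 0)
    have h2 := sum_iterate_markovOp_le_of_drift (h := fun _ => C) hd N x₀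
    simp only [iterate_markovOp_const, Finset.sum_const, Finset.card_range, nsmul_eq_mul] at h2
    calc avg g N ≤ (V x₀ + N * C) / N := ENNReal.div_le_div_right (le_self_add.trans h2) _
      _ = _ := by
        rw [ENNReal.add_div, mul_comm, ENNReal.mul_div_cancel_right h0 (ENNReal.natCast_ne_top _)]
  -- Tightness: since `Λ g ≤ C` and `g` has finite sublevel sets, no mass escapes to infinity.
  have huniv : ρ Set.univ = 1 := by
    rw [← lintegral_one]
    refine le_antisymm ((hρle _ (by simp)).trans (Λ_const 1).le) ?_
    have hR : ∀ R : ℕ, 1 ≤ ∫⁻ _, 1 ∂ρ + C / (R + 1 : ℕ) := by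
      intro R
      have hR0 : ((R + 1 : ℕ) : ℝ≥0∞) ≠ 0 := by simp
      have hRt : ((R + 1 : ℕ) : ℝ≥0∞) ≠ ∞ := ENNReal.natCast_ne_top _
      let F := (hg (R + 1)).toFinset
      calc (1 : ℝ≥0∞) = Λ (fun _ => 1) := (Λ_const 1).symm
        _ ≤ Λ ((fun x => if x ∈ F then 1 else 0) + fun x => g x * ((R + 1 : ℕ) : ℝ≥0∞)⁻¹) := by
          refine Λ_mono _ _ fun x => ?_
          by_cases hx : x ∈ F
          · simp [hx]
          · simp only [Pi.add_apply, hx, if_false, zero_add, ← div_eq_mul_inv]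
            rw [ENNReal.le_div_iff_mul_le (Or.inl hR0) (Or.inl hRt), one_mul]
            simp only [F, Set.Finite.mem_toFinset, Set.mem_ofPred_eq, not_le] at hx
            exact hx.le
        _ = Λ (fun x => if x ∈ F then 1 else 0) + Λ g * ((R + 1 : ℕ) : ℝ≥0∞)⁻¹ := by
          rw [Λ_add, Λ_smul _ _ (by simp)]
        _ ≤ _ := by
          rw [Λ_sum F (fun _ => 1) (by simp), hρf, div_eq_mul_inv]
          gcongr
          exact ENNReal.sum_le_tsum F
    have h1 : Tendsto (fun R : ℕ => ∫⁻ _, 1 ∂ρ + C / (R + 1 : ℕ)) atTop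
        (𝓝 (∫⁻ _, 1 ∂ρ + 0)) := by
      refine Tendsto.const_add _ ?_
      simpa using ENNReal.Tendsto.const_div (a := C)
        (ENNReal.tendsto_nat_nhds_top.comp (tendsto_add_atTop_nat 1)) (Or.inr hC)
    simpa using ge_of_tendsto' h1 hR
  have hprob : IsProbabilityMeasure ρ := ⟨huniv⟩
  refine ⟨ρ, hprob, ?_⟩
  -- Both measures have mass one, so an inequality between them forces equality, and on a countable
  -- space it can be checked at points.
  refine Measure.eq_of_le_of_measure_univ_eq ?_ (by simp)
  have hle : ∀ y, (κ ∘ₘ ρ) {y} ≤ ρ {y} := by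
    intro y
    have e_le : ∀ x, e y x ≤ 1 := fun x => by simp only [e]; split_ifs <;> simp
    have h1 : (κ ∘ₘ ρ) {y} ≤ Λ (markovOp κ (e y)) := by
      rw [Measure.bind_apply (measurableSet_singleton y) κ.measurable.aemeasurable]
      refine (hρle _ fun x => measure_ne_top _ _).trans (Λ_mono _ _ fun x => ?_)
      rw [markovOp, ← lintegral_indicator_one (measurableSet_singleton y)]
      refine lintegral_mono fun z => ?_
      simp only [e, Set.indicator_apply, Set.mem_singleton_iff, Pi.one_apply, le_refl]
    -- Applying the operator once more shifts the Cesàro sum by one index, which raises it by at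
    -- most one.
    have h2 : Λ (markovOp κ (e y)) ≤ Λ (e y) := by
      have h3 : Tendsto (fun N : ℕ => avg (e y) N + 1 / N) U (𝓝 (Λ (e y) + 0)) := by
        refine (hΛ _).add (Tendsto.mono_left ?_ hU)
        simpa using ENNReal.Tendsto.const_div (a := 1) ENNReal.tendsto_nat_nhds_top (by simp)
      rw [← add_zero (Λ (e y))]
      refine le_of_tendsto_of_tendsto' (hΛ _) h3 fun N => ?_
      simp only [avg]
      rw [← ENNReal.add_div]
      refine ENNReal.div_le_div_right ?_ _
      have h4 : ∑ t ∈ Finset.range N, (markovOp κ)^[t] (markovOp κ (e y)) x₀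
          ≤ ∑ t ∈ Finset.range (N + 1), (markovOp κ)^[t] (e y) x₀ := by
        rw [Finset.sum_range_succ']
        exact le_self_add
      refine h4.trans ?_
      rw [Finset.sum_range_succ]
      gcongr
      exact iterate_markovOp_le κ N e_le x₀
    have h5 : ρ {y} = Λ (e y) := by
      rw [← lintegral_indicator_one (measurableSet_singleton y), hρf, tsum_eq_single y]
      · simp
      · intro z hz
        simp [hz]
    exact (h1.trans h2).trans h5.ge
  refine Measure.le_iff.2 fun s _ => ?_
  have hsum : ∀ m : Measure X, m s = ∑' y : s, m {(y : X)} := fun m =>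
    (Measure.tsum_indicator_apply_singleton m s (Set.to_countable s).measurableSet).symm.trans
      (tsum_subtype s fun y => m {y}).symm
  rw [hsum, hsum]
  exact ENNReal.tsum_le_tsum fun y => hle y

end CountableMarkov

/-! ### One-step expectations of the two chains. -/

/-- The law of the inputs `(a, s, v, w)` of one time slot. -/
noncomputable abbrev inputLaw {n : ℕ} (svc : Measure (Fin n → ℕ)) (arr : Measure ℕ) :
    Measure (ℕ × (Fin n → ℕ) × unitInterval × unitInterval) :=
  arr.prod (svc.prod ((volume : Measure unitInterval).prod (volume : Measure unitInterval)))

section Kernels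

variable {n : ℕ} (P : Policy n) (svc : Measure (Fin n → ℕ)) [IsProbabilityMeasure svc]
  (arr : Measure ℕ) [IsProbabilityMeasure arr]

theorem markovOp_kernel (f : P.State → ℝ≥0∞) (x : P.State) :
    markovOp (P.kernel svc arr) f x
      = ∫⁻ i, f (P.step (serviceRate svc) x i) ∂inputLaw svc arr :=
  lintegral_map (measurable_of_countable f) (P.measurable_step _ x)

theorem step_fst (μ : Fin n → ℝ) (x : P.State)
    (i : ℕ × (Fin n → ℕ) × unitInterval × unitInterval) :
    (P.step μ x i).1 = P.nextQueue x i.1 i.2.1 := by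
  unfold Policy.step
  split_ifs <;> rfl

theorem lintegral_inputLaw_fst_snd (f : ℕ → (Fin n → ℕ) → ℝ≥0∞) :
    ∫⁻ i, f i.1 i.2.1 ∂inputLaw svc arr = ∫⁻ a, ∫⁻ s, f a s ∂svc ∂arr := by
  have hf : Measurable fun p : ℕ × (Fin n → ℕ) => f p.1 p.2 := measurable_of_countable _
  have hf' : Measurable fun i : ℕ × (Fin n → ℕ) × unitInterval × unitInterval => f i.1 i.2.1 :=
    hf.comp (measurable_fst.prodMk (measurable_fst.comp measurable_snd))
  rw [lintegral_prod _ hf'.aemeasurable]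
  refine lintegral_congr fun a => ?_
  have ha : Measurable fun i : (Fin n → ℕ) × unitInterval × unitInterval => f a i.1 :=
    (measurable_of_countable (f a)).comp measurable_fst
  rw [lintegral_prod _ ha.aemeasurable]
  simp

theorem markovOp_kernel_of_queue (f : (Fin n → ℕ) → ℝ≥0∞) (x : P.State) :
    markovOp (P.kernel svc arr) (fun y => f y.1) x
      = ∫⁻ a, ∫⁻ s, f (P.nextQueue x a s) ∂svc ∂arr := by
  rw [markovOp_kernel, ← lintegral_inputLaw_fst_snd]
  simp_rw [step_fst]

instance : IsMarkovKernel (pooledKernel svc arr) :=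
  ⟨fun _ => Measure.isProbabilityMeasure_map (measurable_of_countable _).aemeasurable⟩

theorem markovOp_pooledKernel (f : ℕ → ℝ≥0∞) (q : ℕ) :
    markovOp (pooledKernel svc arr) f q = ∫⁻ a, ∫⁻ s, f (q + a - ∑ l, s l) ∂svc ∂arr := by
  unfold markovOp
  change ∫⁻ y, f y ∂((arr.prod svc).map fun i => q + i.1 - ∑ l, i.2 l) = _
  rw [lintegral_map (measurable_of_countable f) (measurable_of_countable _),
    lintegral_prod _ (measurable_of_countable _).aemeasurable]

end Kernels

/-! ### Little's law: cumulative services and the law of a delay. -/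

section Little

variable {n : ℕ} (svc : Measure (Fin n → ℕ)) [IsProbabilityMeasure svc]

/-- The law of the vector of cumulative services of `N` slots. -/
noncomputable def serviceSum : ℕ → Measure (Fin n → ℕ)
  | 0 => Measure.dirac 0
  | N + 1 => (svc.prod (serviceSum N)).map fun p => p.1 + p.2

instance (N : ℕ) : IsProbabilityMeasure (serviceSum svc N) := by
  induction N with
  | zero => unfold serviceSum; infer_instance
  | succ N ih =>
    unfold serviceSum
    exact Measure.isProbabilityMeasure_map (measurable_of_countable _).aemeasurable

theorem lintegral_serviceSum_zero (f : (Fin n → ℕ) → ℝ≥0∞) :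
    ∫⁻ s, f s ∂serviceSum svc 0 = f 0 :=
  lintegral_dirac _ _

theorem lintegral_serviceSum_succ (N : ℕ) (f : (Fin n → ℕ) → ℝ≥0∞) :
    ∫⁻ s, f s ∂serviceSum svc (N + 1) = ∫⁻ s, ∫⁻ s', f (s + s') ∂serviceSum svc N ∂svc := by
  rw [serviceSum, lintegral_map (measurable_of_countable f) (measurable_of_countable _),
    lintegral_prod _ (measurable_of_countable _).aemeasurable]

/-- Delays live on an infinite product space, but only partial sums of services matter. Their laws
sit on a countable space and satisfy a recursion that splits off a single slot, the form in which
stationarity can be used. -/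
theorem map_sum_range_infinitePi (N : ℕ) :
    (Measure.infinitePi fun _ : ℕ => svc).map (fun s => ∑ r ∈ Finset.range N, s r)
      = serviceSum svc N := by
  have hmeas : ∀ N : ℕ, Measurable fun s : ℕ → Fin n → ℕ => ∑ r ∈ Finset.range N, s r :=
    fun N => Finset.measurable_sum _ fun r _ => measurable_pi_apply r
  induction N with
  | zero => simp [serviceSum]
  | succ N ih =>
    have hind : iIndepFun (fun (r : ℕ) (s : ℕ → Fin n → ℕ) => s r)
        (Measure.infinitePi fun _ : ℕ => svc) :=
      iIndepFun_infinitePi (P := fun _ : ℕ => svc) (X := fun _ s => s) fun _ => measurable_id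
    have h2 := (hind.indepFun_finsetSum_of_notMem (fun r => measurable_pi_apply r)
      (Finset.notMem_range_self (n := N))).symm
    have h4 : (∑ j ∈ Finset.range N, fun s : ℕ → Fin n → ℕ => s j)
        = fun s => ∑ r ∈ Finset.range N, s r := by
      funext s; simp
    rw [h4] at h2
    have h3 := (indepFun_iff_map_prod_eq_prod_map_map (measurable_pi_apply N).aemeasurable
      (hmeas N).aemeasurable).1 h2
    rw [Measure.infinitePi_map_eval] at h3
    rw [serviceSum, ← ih, ← h3, Measure.map_map (measurable_of_countable _)
      ((measurable_pi_apply N).prodMk (hmeas N))]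
    congr 1
    funext s
    simp [Finset.sum_range_succ, add_comm]

theorem lintegral_delay (l : Fin n) (p : ℕ) :
    ∫⁻ s, delay l p s ∂(Measure.infinitePi fun _ : ℕ => svc)
      = ∑' N : ℕ, serviceSum svc (N + 1) {s | s l ≤ p} := by
  have hmeas : ∀ N : ℕ, Measurable fun s : ℕ → Fin n → ℕ => ∑ r ∈ Finset.range N, s r :=
    fun N => Finset.measurable_sum _ fun r _ => measurable_pi_apply r
  have hg : Measurable fun s : Fin n → ℕ => if s l ≤ p then (1 : ℝ≥0∞) else 0 :=
    measurable_of_countable _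
  have heq : ∀ s : ℕ → Fin n → ℕ, delay l p s
      = ∑' N : ℕ, if (∑ r ∈ Finset.range (N + 1), s r) l ≤ p then (1 : ℝ≥0∞) else 0 := by
    intro s
    simp [delay, Finset.sum_apply]
  simp_rw [heq]
  have hg' : ∀ N : ℕ, Measurable fun s : ℕ → Fin n → ℕ =>
      if (∑ r ∈ Finset.range (N + 1), s r) l ≤ p then (1 : ℝ≥0∞) else 0 :=
    fun N => hg.comp (hmeas (N + 1))
  rw [lintegral_tsum fun N => (hg' N).aemeasurable]
  refine tsum_congr fun N => ?_
  rw [← map_sum_range_infinitePi, ← lintegral_indicator_one (Set.to_countable _).measurableSet,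
    lintegral_map (measurable_of_countable _) (hmeas (N + 1))]
  refine lintegral_congr fun s => ?_
  simp [Set.indicator_apply]

end Little

/-! ### Little's law: telescoping over the age of the jobs. -/

section Little

variable {n : ℕ} (P : Policy n) (svc : Measure (Fin n → ℕ)) [IsProbabilityMeasure svc]
  (arr : Measure ℕ) [IsProbabilityMeasure arr]

/-- Queue lengths after `a` jobs have joined the queue of server `l`. -/
def addArrivals (q : Fin n → ℕ) (l : Fin n) (a : ℕ) : Fin n → ℕ :=
  fun m => q m + if l = m then a else 0

theorem nextQueue_eq_addArrivals_sub (x : P.State) (a : ℕ) (s : Fin n → ℕ) :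
    P.nextQueue x a s = addArrivals x.1 (x.2.1 x.2.2) a - s := rfl

/-- In FIFO order the new job with `q + k` jobs ahead of it survives `s` services iff `s ≤ q + k`,
so the jobs left split into old ones and surviving new ones. -/
theorem add_sub_eq_sub_add_sum (q a s : ℕ) :
    q + a - s = (q - s) + ∑ k ∈ Finset.range a, if s ≤ q + k then 1 else 0 := by
  induction a with
  | zero => simp
  | succ a ih =>
    rw [Finset.sum_range_succ, ← add_assoc, ← add_assoc (q - s), ← ih]
    split_ifs <;> omega

theorem sum_addArrivals_sub (q s : Fin n → ℕ) (l : Fin n) (a : ℕ) :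
    ∑ m, (addArrivals q l a - s) m
      = ∑ m, (q - s) m + ∑ k ∈ Finset.range a, if s l ≤ q l + k then 1 else 0 := by
  have h : ∀ m, (addArrivals q l a - s) m
      = (q - s) m + if l = m then ∑ k ∈ Finset.range a, if s l ≤ q l + k then 1 else 0 else 0 := by
    intro m
    simp only [addArrivals, Pi.sub_apply]
    split_ifs with h
    · subst h; exact add_sub_eq_sub_add_sum _ _ _
    · simp
  simp_rw [h, Finset.sum_add_distrib]
  simp

/-- Expectation of a function of the jobs left after `N` slots without arrivals. -/
noncomputable def afterServices (F : ℕ → ℝ≥0∞) (N : ℕ) (q : Fin n → ℕ) : ℝ≥0∞ :=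
  ∫⁻ s, F (∑ m, (q - s) m) ∂serviceSum svc N

/-- Truncated subtraction composes, `(q - s) - s' = q - (s + s')`. Serving for `N` slots after a
stationary step is therefore the same as serving for `N + 1` slots right after the arrivals have
joined. -/
theorem lintegral_afterServices_succ {ρ : Measure P.State} (hρ : P.IsSteadyState svc arr ρ)
    (F : ℕ → ℝ≥0∞) (N : ℕ) :
    ∫⁻ x, afterServices svc F N x.1 ∂ρ
      = ∫⁻ x, ∫⁻ a, afterServices svc F (N + 1) (addArrivals x.1 (x.2.1 x.2.2) a) ∂arr ∂ρ := by
  rw [← lintegral_markovOp hρ.2]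
  refine lintegral_congr fun x => ?_
  rw [markovOp_kernel_of_queue]
  refine lintegral_congr fun a => ?_
  rw [afterServices, lintegral_serviceSum_succ]
  refine lintegral_congr fun s => ?_
  rw [nextQueue_eq_addArrivals_sub, afterServices]
  refine lintegral_congr fun s' => ?_
  simp [Pi.sub_apply, Nat.sub_sub]

/-- The expected number of the jobs arriving in a slot that are present `N` slots later. -/
noncomputable def presentAfter (ρ : Measure P.State) (N : ℕ) : ℝ≥0∞ :=
  ∫⁻ x, ∫⁻ a : ℕ, ∑ k ∈ Finset.range a,
    serviceSum svc N {s | s (x.2.1 x.2.2) ≤ x.1 (x.2.1 x.2.2) + k} ∂arr ∂ρ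

/-- The expected sum of the delays of the jobs arriving in a slot. -/
noncomputable def totalDelay (ρ : Measure P.State) : ℝ≥0∞ :=
  ∫⁻ x, ∫⁻ a : ℕ, ∑ k ∈ Finset.range a,
    ∫⁻ s, delay (x.2.1 x.2.2) (x.1 (x.2.1 x.2.2) + k) s ∂(Measure.infinitePi fun _ : ℕ => svc)
    ∂arr ∂ρ

theorem totalDelay_eq_tsum (ρ : Measure P.State) :
    totalDelay P svc arr ρ = ∑' N : ℕ, presentAfter P svc arr ρ (N + 1) := by
  simp only [totalDelay, presentAfter, lintegral_delay]
  rw [← lintegral_tsum fun _ => (measurable_of_countable _).aemeasurable]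
  refine lintegral_congr fun x => ?_
  rw [← lintegral_tsum fun _ => (measurable_of_countable _).aemeasurable]
  refine lintegral_congr fun a => ?_
  exact (Summable.tsum_finsetSum fun _ _ => ENNReal.summable).symm

theorem lintegral_sum_ite_serviceSum (N a p : ℕ) (l : Fin n) :
    ∫⁻ s, ∑ k ∈ Finset.range a, (if s l ≤ p + k then (1 : ℝ≥0∞) else 0) ∂serviceSum svc N
      = ∑ k ∈ Finset.range a, serviceSum svc N {s | s l ≤ p + k} := by
  rw [lintegral_finsetSum _ fun _ _ => measurable_of_countable _]
  refine Finset.sum_congr rfl fun k _ => ?_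
  rw [← lintegral_indicator_one (Set.to_countable _).measurableSet]
  refine lintegral_congr fun s => ?_
  simp [Set.indicator_apply]

theorem afterServices_cast_addArrivals (N : ℕ) (q : Fin n → ℕ) (l : Fin n) (a : ℕ) :
    afterServices svc (fun j => (j : ℝ≥0∞)) N (addArrivals q l a)
      = afterServices svc (fun j => (j : ℝ≥0∞)) N q
        + ∑ k ∈ Finset.range a, serviceSum svc N {s | s l ≤ q l + k} := by
  rw [← lintegral_sum_ite_serviceSum, afterServices, afterServices,
    ← lintegral_add_left (measurable_of_countable _)]
  refine lintegral_congr fun s => ?_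
  rw [sum_addArrivals_sub]
  push_cast
  rfl

theorem afterServices_min_addArrivals_le (M : ℝ≥0∞) (N : ℕ) (q : Fin n → ℕ) (l : Fin n) (a : ℕ) :
    afterServices svc (fun j => min M j) N (addArrivals q l a)
      ≤ afterServices svc (fun j => min M j) N q
        + ∑ k ∈ Finset.range a, serviceSum svc N {s | s l ≤ q l + k} := by
  rw [← lintegral_sum_ite_serviceSum, afterServices, afterServices,
    ← lintegral_add_left (measurable_of_countable _)]
  refine lintegral_mono fun s => ?_
  dsimp only
  rw [sum_addArrivals_sub]
  push_cast
  rcases le_total M (∑ m, ((q - s) m : ℕ) : ℝ≥0∞) with h | h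
  · rw [min_eq_left h]; exact (min_le_left _ _).trans le_self_add
  · rw [min_eq_right h]; exact min_le_right _ _

theorem meanTotalQueue_eq_afterServices (ρ : Measure P.State) :
    P.meanTotalQueue ρ = ∫⁻ x, afterServices svc (fun j => (j : ℝ≥0∞)) 0 x.1 ∂ρ := by
  refine lintegral_congr fun x => ?_
  rw [afterServices, lintegral_serviceSum_zero]
  simp

/-- The jobs in the stationary system are those of the last `N` slots that are still present, plus
what remains of the queues from `N` slots ago. Dropping the remnant and letting `N` grow gives this
direction, even for an infinite mean. -/
theorem totalDelay_le_meanTotalQueue {ρ : Measure P.State} (hρ : P.IsSteadyState svc arr ρ) :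
    totalDelay P svc arr ρ ≤ P.meanTotalQueue ρ := by
  have hstep : ∀ N, ∫⁻ x, afterServices svc (fun j => (j : ℝ≥0∞)) N x.1 ∂ρ
      = ∫⁻ x, afterServices svc (fun j => (j : ℝ≥0∞)) (N + 1) x.1 ∂ρ
        + presentAfter P svc arr ρ (N + 1) := by
    intro N
    rw [lintegral_afterServices_succ P svc arr hρ, presentAfter,
      ← lintegral_add_left (measurable_of_countable _)]
    refine lintegral_congr fun x => ?_
    simp_rw [afterServices_cast_addArrivals]
    rw [lintegral_add_left measurable_const]
    simp
  have hsum : ∀ N, P.meanTotalQueue ρ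
      = ∫⁻ x, afterServices svc (fun j => (j : ℝ≥0∞)) N x.1 ∂ρ
        + ∑ i ∈ Finset.range N, presentAfter P svc arr ρ (i + 1) := by
    intro N
    induction N with
    | zero => simp [meanTotalQueue_eq_afterServices P svc]
    | succ N ih => rw [ih, hstep, Finset.sum_range_succ]; ring
  rw [totalDelay_eq_tsum, ENNReal.tsum_eq_iSup_nat]
  refine iSup_le fun N => ?_
  rw [hsum N]
  exact le_add_self

theorem lintegral_exp_neg_lt_one (l : Fin n) (h : 0 < serviceRate svc l) :
    ∫⁻ s, ENNReal.ofReal (Real.exp (-(s l : ℝ))) ∂svc < 1 := by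
  have hle : ∀ s : Fin n → ℕ, ENNReal.ofReal (Real.exp (-(s l : ℝ))) ≤ 1 := fun s => by
    rw [ENNReal.ofReal_le_one, Real.exp_le_one_iff]
    simp
  have h1 : ∫⁻ s, ENNReal.ofReal (Real.exp (-(s l : ℝ))) ∂svc < ∫⁻ _, 1 ∂svc := by
    refine lintegral_strict_mono_of_ae_le_of_ae_lt_on (s := {s | s l ≠ 0})
      (measurable_const.aemeasurable) ?_ (ae_of_all _ hle) ?_ ?_
    · exact ((lintegral_mono hle).trans_lt (by simp)).ne
    · intro h0
      have h2 : ∀ᵐ s ∂svc, s l = 0 := by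
        rw [ae_iff]; exact h0
      have h3 : serviceRate svc l = 0 := by
        rw [serviceRate, integral_eq_zero_of_ae]
        filter_upwards [h2] with s hs
        simp [hs]
      exact h.ne' h3
    · refine ae_of_all _ fun s hs => ?_
      rw [ENNReal.ofReal_lt_one, Real.exp_lt_one_iff]
      have : 0 < s l := Nat.pos_of_ne_zero hs
      simpa using this
  simpa using h1

theorem lintegral_exp_neg_serviceSum (l : Fin n) (N : ℕ) :
    ∫⁻ s, ENNReal.ofReal (Real.exp (-(s l : ℝ))) ∂serviceSum svc N
      = (∫⁻ s, ENNReal.ofReal (Real.exp (-(s l : ℝ))) ∂svc) ^ N := by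
  induction N with
  | zero => rw [lintegral_serviceSum_zero]; simp
  | succ N ih =>
    rw [lintegral_serviceSum_succ, pow_succ, mul_comm, ← ih,
      ← lintegral_mul_const _ (measurable_of_countable _)]
    refine lintegral_congr fun s => ?_
    rw [← lintegral_const_mul _ (measurable_of_countable _)]
    refine lintegral_congr fun s' => ?_
    rw [← ENNReal.ofReal_mul (Real.exp_pos _).le, ← Real.exp_add]
    congr 2
    simp only [Pi.add_apply, Nat.cast_add]
    ring

/-- Use `[q - s]⁺ ≤ exp (q - s)`. The mean of `exp (-s)` decays geometrically in the number of slots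
because a positive service rate excludes services that vanish almost surely. -/
theorem tendsto_afterServices_min (hμ : ∀ l, 0 < serviceRate svc l) (M : ℝ≥0∞) (q : Fin n → ℕ) :
    Tendsto (fun N => afterServices svc (fun j => min M j) N q) atTop (𝓝 0) := by
  have hb : ∀ N, afterServices svc (fun j => min M j) N q
      ≤ ∑ l, ENNReal.ofReal (Real.exp (q l))
        * (∫⁻ s, ENNReal.ofReal (Real.exp (-(s l : ℝ))) ∂svc) ^ N := by
    intro N
    simp_rw [← lintegral_exp_neg_serviceSum]
    simp_rw [← lintegral_const_mul _ (measurable_of_countable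
      (fun s : Fin n → ℕ => ENNReal.ofReal (Real.exp (-(s _ : ℝ)))))]
    rw [← lintegral_finsetSum _ fun _ _ => measurable_of_countable _]
    refine lintegral_mono fun s => (min_le_right _ _).trans ?_
    push_cast
    refine Finset.sum_le_sum fun l _ => ?_
    rw [← ENNReal.ofReal_mul (Real.exp_pos _).le, ← Real.exp_add, ← ENNReal.ofReal_natCast]
    refine ENNReal.ofReal_le_ofReal ?_
    simp only [Pi.sub_apply]
    rcases le_total (s l) (q l) with h | h
    · rw [Nat.cast_sub h]
      linarith [Real.add_one_le_exp ((q l : ℝ) + -(s l : ℝ))]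
    · rw [Nat.sub_eq_zero_of_le h]
      simpa using (Real.exp_pos _).le
  refine tendsto_of_tendsto_of_tendsto_of_le_of_le tendsto_const_nhds (h := fun N => ∑ l,
    ENNReal.ofReal (Real.exp (q l))
      * (∫⁻ s, ENNReal.ofReal (Real.exp (-(s l : ℝ))) ∂svc) ^ N) ?_ (fun _ => zero_le) hb
  rw [← Finset.sum_const_zero (s := (Finset.univ : Finset (Fin n)))]
  refine tendsto_finsetSum _ fun l _ => ?_
  have := ENNReal.Tendsto.const_mul (a := ENNReal.ofReal (Real.exp (q l)))
    (ENNReal.tendsto_pow_atTop_nhds_zero_of_lt_one (lintegral_exp_neg_lt_one svc l (hμ l)))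
    (Or.inr ENNReal.ofReal_ne_top)
  simpa using this

/-- Here the remnant must vanish as `N` grows. The mean total queue length may be infinite, so the
telescoping is repeated for the total cut off at `M`, where it becomes an inequality and dominated
convergence applies; then `M` is sent to infinity. -/
theorem meanTotalQueue_le_totalDelay (hμ : ∀ l, 0 < serviceRate svc l) {ρ : Measure P.State}
    (hρ : P.IsSteadyState svc arr ρ) : P.meanTotalQueue ρ ≤ totalDelay P svc arr ρ := by
  have := hρ.1
  have key : ∀ M : ℕ, ∫⁻ x, min (M : ℝ≥0∞) (∑ l, (x.1 l : ℝ≥0∞)) ∂ρ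
      ≤ totalDelay P svc arr ρ := by
    intro M
    have hstep : ∀ N, ∫⁻ x, afterServices svc (fun j => min (M : ℝ≥0∞) j) N x.1 ∂ρ
        ≤ ∫⁻ x, afterServices svc (fun j => min (M : ℝ≥0∞) j) (N + 1) x.1 ∂ρ
          + presentAfter P svc arr ρ (N + 1) := by
      intro N
      rw [lintegral_afterServices_succ P svc arr hρ, presentAfter,
        ← lintegral_add_left (measurable_of_countable _)]
      refine lintegral_mono fun x => ?_
      calc _ ≤ _ := lintegral_mono fun a => afterServices_min_addArrivals_le svc M (N + 1) x.1 _ a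
        _ = _ := by
          rw [lintegral_add_left measurable_const]
          simp
    have hsum : ∀ N, ∫⁻ x, min (M : ℝ≥0∞) (∑ l, (x.1 l : ℝ≥0∞)) ∂ρ
        ≤ ∫⁻ x, afterServices svc (fun j => min (M : ℝ≥0∞) j) N x.1 ∂ρ
          + totalDelay P svc arr ρ := by
      intro N
      have h1 : ∫⁻ x, min (M : ℝ≥0∞) (∑ l, (x.1 l : ℝ≥0∞)) ∂ρ
          ≤ ∫⁻ x, afterServices svc (fun j => min (M : ℝ≥0∞) j) N x.1 ∂ρ
          + ∑ i ∈ Finset.range N, presentAfter P svc arr ρ (i + 1) := by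
        induction N with
        | zero =>
          simp only [afterServices, lintegral_serviceSum_zero]
          simp
        | succ N ih =>
          refine ih.trans ?_
          rw [Finset.sum_range_succ, add_comm (∑ i ∈ _, _), ← add_assoc]
          gcongr
          exact hstep N
      refine h1.trans ?_
      gcongr
      rw [totalDelay_eq_tsum]
      exact ENNReal.sum_le_tsum _
    have hlim : Tendsto (fun N => ∫⁻ x, afterServices svc (fun j => min (M : ℝ≥0∞) j) N x.1 ∂ρ)
        atTop (𝓝 (∫⁻ _, 0 ∂ρ)) := by
      refine tendsto_lintegral_of_dominated_convergence (fun _ => (M : ℝ≥0∞))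
        (fun _ => measurable_of_countable _) (fun N => ae_of_all _ fun x => ?_)
        (by simp) (ae_of_all _ fun x => tendsto_afterServices_min svc hμ _ _)
      calc afterServices svc (fun j => min (M : ℝ≥0∞) j) N x.1
          ≤ ∫⁻ _, (M : ℝ≥0∞) ∂serviceSum svc N := lintegral_mono fun _ => min_le_left _ _
        _ = M := by simp
    have h2 := ge_of_tendsto' (hlim.add_const (totalDelay P svc arr ρ)) hsum
    simpa using h2
  have hmono : P.meanTotalQueue ρ
      = ⨆ M : ℕ, ∫⁻ x, min (M : ℝ≥0∞) (∑ l, (x.1 l : ℝ≥0∞)) ∂ρ := by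
    rw [← lintegral_iSup (fun _ => measurable_of_countable _)
      (fun a b hab x => by dsimp only; gcongr)]
    refine lintegral_congr fun x => ?_
    rw [← iSup_inf_eq, ENNReal.iSup_natCast, top_inf_eq]
  rw [hmono]
  exact iSup_le key

/-- **Little's law** for the policies of the framework. -/
theorem meanDelay_eq (hμ : ∀ l, 0 < serviceRate svc l) {ρ : Measure P.State}
    (hρ : P.IsSteadyState svc arr ρ) :
    P.meanDelay svc arr ρ = P.meanTotalQueue ρ / ∫⁻ a : ℕ, (a : ℝ≥0∞) ∂arr := by
  rw [le_antisymm (meanTotalQueue_le_totalDelay P svc arr hμ hρ)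
    (totalDelay_le_meanTotalQueue P svc arr hρ)]
  rfl

end Little

/-! ### Moments and exponential moments of the net input of a slot. -/

/-- Arrival and service laws bounded by `b`, with `ε` the gap between the capacity and the mean
number of arrivals. -/
structure Regime {n : ℕ} (svc : Measure (Fin n → ℕ)) (arr : Measure ℕ) (b ε : ℝ) : Prop where
  arr_le : ∀ᵐ a : ℕ ∂arr, (a : ℝ) ≤ b
  svc_le : ∀ᵐ s ∂svc, ∀ l, (s l : ℝ) ≤ b
  mean : ∫ a : ℕ, (a : ℝ) ∂arr = (∑ l, serviceRate svc l) - ε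

/-- The net input `a - ∑ s_l` of a slot. -/
def netInput {n : ℕ} (i : ℕ × (Fin n → ℕ) × unitInterval × unitInterval) : ℝ :=
  i.1 - ∑ l, (i.2.1 l : ℝ)

namespace Regime

variable {n : ℕ} {svc : Measure (Fin n → ℕ)} [IsProbabilityMeasure svc]
  {arr : Measure ℕ} [IsProbabilityMeasure arr] {b ε : ℝ}

theorem b_nonneg (H : Regime svc arr b ε) : 0 ≤ b := by
  obtain ⟨a, ha⟩ := H.arr_le.exists
  exact (Nat.cast_nonneg a).trans ha

theorem ae_arr_le (H : Regime svc arr b ε) : ∀ᵐ i ∂inputLaw svc arr, (i.1 : ℝ) ≤ b :=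
  Measure.quasiMeasurePreserving_fst.ae H.arr_le

theorem ae_svc_le (H : Regime svc arr b ε) :
    ∀ᵐ i ∂inputLaw svc arr, ∀ l, (i.2.1 l : ℝ) ≤ b :=
  Measure.quasiMeasurePreserving_snd.ae (Measure.quasiMeasurePreserving_fst.ae H.svc_le)

theorem measurable_inputs {E : Type*} [MeasurableSpace E] (f : ℕ → (Fin n → ℕ) → E) :
    Measurable fun i : ℕ × (Fin n → ℕ) × unitInterval × unitInterval => f i.1 i.2.1 :=
  (measurable_of_countable fun p : ℕ × (Fin n → ℕ) => f p.1 p.2).comp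
    (measurable_fst.prodMk (measurable_fst.comp measurable_snd))

theorem measurable_netInput :
    Measurable (netInput : ℕ × (Fin n → ℕ) × unitInterval × unitInterval → ℝ) :=
  measurable_inputs fun a s => (a : ℝ) - ∑ l, (s l : ℝ)

theorem integrable_arr (H : Regime svc arr b ε) : Integrable (fun a : ℕ => (a : ℝ)) arr := by
  refine Integrable.of_bound (measurable_of_countable _).aestronglyMeasurable b ?_
  filter_upwards [H.arr_le] with a ha
  simpa using ha

theorem integrable_svc (H : Regime svc arr b ε) (l : Fin n) :
    Integrable (fun s : Fin n → ℕ => (s l : ℝ)) svc := by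
  refine Integrable.of_bound (measurable_of_countable _).aestronglyMeasurable b ?_
  filter_upwards [H.svc_le] with s hs
  simpa using hs l

theorem integrable_input_arr (H : Regime svc arr b ε) :
    Integrable (fun i : ℕ × (Fin n → ℕ) × unitInterval × unitInterval => (i.1 : ℝ))
      (inputLaw svc arr) :=
  H.integrable_arr.comp_fst _

theorem integrable_input_svc (H : Regime svc arr b ε) (l : Fin n) :
    Integrable (fun i : ℕ × (Fin n → ℕ) × unitInterval × unitInterval => (i.2.1 l : ℝ))
      (inputLaw svc arr) :=
  ((H.integrable_svc l).comp_fst _).comp_snd _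

theorem integral_input_arr (H : Regime svc arr b ε) :
    ∫ i, (i.1 : ℝ) ∂inputLaw svc arr = (∑ l, serviceRate svc l) - ε := by
  rw [← H.mean]
  simpa using integral_fun_fst (μ := arr) (ν := svc.prod
    ((volume : Measure unitInterval).prod (volume : Measure unitInterval))) fun a : ℕ => (a : ℝ)

theorem integral_input_svc (l : Fin n) :
    ∫ i, (i.2.1 l : ℝ) ∂inputLaw svc arr = serviceRate svc l := by
  have h1 := integral_fun_snd (μ := arr) (ν := svc.prod
    ((volume : Measure unitInterval).prod (volume : Measure unitInterval)))
    fun p : (Fin n → ℕ) × unitInterval × unitInterval => (p.1 l : ℝ)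
  have h2 := integral_fun_fst (μ := svc) (ν :=
    ((volume : Measure unitInterval).prod (volume : Measure unitInterval)))
    fun s : Fin n → ℕ => (s l : ℝ)
  simp only [probReal_univ, one_smul] at h1 h2
  rw [h1, h2, serviceRate]

theorem integrable_netInput (H : Regime svc arr b ε) :
    Integrable netInput (inputLaw svc arr) :=
  H.integrable_input_arr.sub (integrable_finsetSum _ fun l _ => H.integrable_input_svc l)

theorem integral_netInput (H : Regime svc arr b ε) :
    ∫ i, netInput i ∂inputLaw svc arr = -ε := by
  unfold netInput
  rw [integral_sub H.integrable_input_arr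
    (integrable_finsetSum _ fun l _ => H.integrable_input_svc l),
    integral_finsetSum _ fun l _ => H.integrable_input_svc l, H.integral_input_arr]
  simp_rw [integral_input_svc]
  ring

theorem ae_abs_netInput_le (H : Regime svc arr b ε) :
    ∀ᵐ i ∂inputLaw svc arr, |netInput i| ≤ (n + 1) * b := by
  filter_upwards [H.ae_arr_le, H.ae_svc_le] with i ha hs
  have h1 : ∑ l, (i.2.1 l : ℝ) ≤ n * b := by
    calc _ ≤ ∑ _l : Fin n, b := Finset.sum_le_sum fun l _ => hs l
      _ = _ := by simp
  have h2 : 0 ≤ ∑ l, (i.2.1 l : ℝ) := Finset.sum_nonneg fun l _ => Nat.cast_nonneg _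
  have h3 : (0 : ℝ) ≤ i.1 := Nat.cast_nonneg _
  have h4 := H.b_nonneg
  have h5 : 0 ≤ (n : ℝ) * b := by positivity
  rw [abs_le, netInput]
  constructor <;> linarith

/-- The gap is minus the mean of a bounded variable. This keeps the Chernoff exponent in the range
where `exp` is bounded by a quadratic polynomial. -/
theorem eps_le (H : Regime svc arr b ε) : ε ≤ (n + 1) * b := by
  have h1 : ‖∫ i, netInput i ∂inputLaw svc arr‖ ≤ (n + 1) * b := by
    simpa using norm_integral_le_of_norm_le_const (f := netInput) H.ae_abs_netInput_le
  rw [H.integral_netInput, norm_neg, Real.norm_eq_abs] at h1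
  exact (le_abs_self ε).trans h1

theorem integrable_netInput_sq (H : Regime svc arr b ε) :
    Integrable (fun i => netInput i ^ 2) (inputLaw svc arr) := by
  refine Integrable.of_bound (measurable_netInput.pow_const 2).aestronglyMeasurable
    (((n + 1) * b) ^ 2) ?_
  filter_upwards [H.ae_abs_netInput_le] with i hi
  rw [Real.norm_eq_abs, abs_pow]
  gcongr

theorem memLp_arr (H : Regime svc arr b ε) : MemLp (fun a : ℕ => (a : ℝ)) 2 arr := by
  refine MemLp.of_bound (measurable_of_countable _).aestronglyMeasurable b ?_
  filter_upwards [H.arr_le] with a ha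
  simpa using ha

theorem memLp_svc (H : Regime svc arr b ε) (l : Fin n) :
    MemLp (fun s : Fin n → ℕ => (s l : ℝ)) 2 svc := by
  refine MemLp.of_bound (measurable_of_countable _).aestronglyMeasurable b ?_
  filter_upwards [H.svc_le] with s hs
  simpa using hs l

theorem variance_netInput (H : Regime svc arr b ε) :
    variance netInput (inputLaw svc arr) = variance (fun a : ℕ => (a : ℝ)) arr
      + variance (fun s : Fin n → ℕ => ∑ l, (s l : ℝ)) svc := by
  have hS : MemLp (fun s : Fin n → ℕ => ∑ l, (s l : ℝ)) 2 svc :=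
    memLp_finsetSum _ fun l _ => H.memLp_svc l
  have hY : MemLp (fun s : Fin n → ℕ => -∑ l, (s l : ℝ)) 2 svc := hS.neg
  have hneg : variance (fun s : Fin n → ℕ => -∑ l, (s l : ℝ)) svc
      = variance (fun s : Fin n → ℕ => ∑ l, (s l : ℝ)) svc := variance_fun_neg
  have hvar' := variance_add_prod hY (memLp_const (0 : ℝ)
    (μ := (volume : Measure unitInterval).prod (volume : Measure unitInterval)))
  have hY' : MemLp (fun p : (Fin n → ℕ) × unitInterval × unitInterval => -∑ l, (p.1 l : ℝ)) 2
      (svc.prod ((volume : Measure unitInterval).prod (volume : Measure unitInterval))) :=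
    hY.comp_fst _
  have hvar := variance_add_prod H.memLp_arr hY'
  have h0 : variance (fun _ : unitInterval × unitInterval => (0 : ℝ))
      ((volume : Measure unitInterval).prod (volume : Measure unitInterval)) = 0 := variance_zero _
  simp only [add_zero, h0, hneg] at hvar'
  rw [hvar'] at hvar
  rw [← hvar]
  congr 1

theorem integral_netInput_sq (H : Regime svc arr b ε) :
    ∫ i, netInput i ^ 2 ∂inputLaw svc arr = variance (fun a : ℕ => (a : ℝ)) arr
      + variance (fun s : Fin n → ℕ => ∑ l, (s l : ℝ)) svc + ε ^ 2 := by
  have hz : MemLp netInput 2 (inputLaw svc arr) :=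
    MemLp.of_bound measurable_netInput.aestronglyMeasurable _ H.ae_abs_netInput_le
  have hv := variance_eq_sub hz
  rw [H.integral_netInput, H.variance_netInput] at hv
  simp only [Pi.pow_apply] at hv
  linarith

theorem integrable_quadratic_netInput (H : Regime svc arr b ε) (c₀ c₁ c₂ : ℝ) :
    Integrable (fun i => c₀ + c₁ * netInput i + c₂ * netInput i ^ 2) (inputLaw svc arr) :=
  ((integrable_const c₀).add (H.integrable_netInput.const_mul c₁)).add
    (H.integrable_netInput_sq.const_mul c₂)

theorem integral_quadratic_netInput (H : Regime svc arr b ε) (c₀ c₁ c₂ : ℝ) :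
    ∫ i, (c₀ + c₁ * netInput i + c₂ * netInput i ^ 2) ∂inputLaw svc arr
      = c₀ - c₁ * ε + c₂ * ∫ i, netInput i ^ 2 ∂inputLaw svc arr := by
  have h1 : Integrable (fun i => c₀ + c₁ * netInput i) (inputLaw svc arr) :=
    (integrable_const c₀).add (H.integrable_netInput.const_mul c₁)
  rw [integral_add h1 (H.integrable_netInput_sq.const_mul c₂),
    integral_add (integrable_const c₀) (H.integrable_netInput.const_mul c₁),
    integral_const_mul, integral_const_mul, H.integral_netInput]
  simp only [integral_const, probReal_univ, one_smul]
  ring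

/-- The Chernoff factor of the net input is below one for a small exponent. -/
theorem exists_exp_netInput_lt (H : Regime svc arr b ε) (hε : 0 < ε) :
    ∃ θ > 0, ∃ c ∈ Set.Ioo (0 : ℝ) 1, Integrable (fun i => Real.exp (θ * netInput i)) (inputLaw svc arr) ∧
      ∫ i, Real.exp (θ * netInput i) ∂inputLaw svc arr ≤ c := by
  set B : ℝ := (n + 1) * b with hB
  have hBε : ε ≤ B := H.eps_le
  have hBpos : 0 < B := hε.trans_le hBε
  -- The minimizer of `-θ * ε + θ ^ 2 * B ^ 2`, with minimum `-ε ^ 2 / (4 * B ^ 2)`.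
  set θ : ℝ := ε / (2 * B ^ 2) with hθ
  have hθpos : 0 < θ := by positivity
  have hθB : θ * B ≤ 1 := by
    have : θ * B = ε / B / 2 := by rw [hθ]; field_simp
    rw [this]
    have : ε / B ≤ 1 := (div_le_one hBpos).2 hBε
    linarith
  have hint : Integrable (fun i => Real.exp (θ * netInput i)) (inputLaw svc arr) := by
    refine Integrable.of_bound
      (Real.measurable_exp.comp (measurable_netInput.const_mul θ)).aestronglyMeasurable
      (Real.exp (θ * B)) ?_
    filter_upwards [H.ae_abs_netInput_le] with i hi
    rw [Real.norm_eq_abs, abs_of_pos (Real.exp_pos _)]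
    have := (le_abs_self _).trans hi
    gcongr
  refine ⟨θ, hθpos, 1 - ε ^ 2 / (4 * B ^ 2), ⟨?_, ?_⟩, hint, ?_⟩
  · have h1 : ε ^ 2 ≤ B ^ 2 := by gcongr
    have : ε ^ 2 / (4 * B ^ 2) ≤ 1 / 4 := by
      rw [div_le_div_iff₀ (by positivity) (by norm_num)]; linarith
    linarith
  · have : 0 < ε ^ 2 / (4 * B ^ 2) := by positivity
    linarith
  · have h1 : ∀ᵐ i ∂inputLaw svc arr,
        Real.exp (θ * netInput i) ≤ 1 + θ * netInput i + θ ^ 2 * B ^ 2 := by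
      filter_upwards [H.ae_abs_netInput_le] with i hi
      have h2 : |θ * netInput i| ≤ 1 := by
        rw [abs_mul, abs_of_pos hθpos]
        exact (mul_le_mul_of_nonneg_left hi hθpos.le).trans hθB
      have h3 := (le_abs_self _).trans (Real.abs_exp_sub_one_sub_id_le h2)
      have h4 : netInput i ^ 2 ≤ B ^ 2 := sq_le_sq' (by linarith [abs_le.1 hi]) (abs_le.1 hi).2
      have h5 : (θ * netInput i) ^ 2 ≤ θ ^ 2 * B ^ 2 := by rw [mul_pow]; gcongr
      linarith
    have hlin := H.integrable_quadratic_netInput (1 + θ ^ 2 * B ^ 2) θ 0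
    have h6 := H.integral_quadratic_netInput (1 + θ ^ 2 * B ^ 2) θ 0
    refine (integral_mono_ae hint hlin ?_).trans (le_of_eq ?_)
    · filter_upwards [h1] with i hi
      linarith
    · rw [h6, hθ]
      field_simp
      ring

end Regime

/-! ### The pooled queue: stability and a lower bound for its mean. -/

section Pooled

variable {n : ℕ} {svc : Measure (Fin n → ℕ)} [IsProbabilityMeasure svc]
  {arr : Measure ℕ} [IsProbabilityMeasure arr] {b ε : ℝ}

theorem markovOp_pooledKernel' (f : ℕ → ℝ≥0∞) (q : ℕ) :
    markovOp (pooledKernel svc arr) f q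
      = ∫⁻ i, f (q + i.1 - ∑ l, i.2.1 l) ∂inputLaw svc arr := by
  rw [markovOp_pooledKernel]
  exact (lintegral_inputLaw_fst_snd svc arr fun a s => f (q + a - ∑ l, s l)).symm

theorem cast_pooled_next (q : ℕ) (i : ℕ × (Fin n → ℕ) × unitInterval × unitInterval) :
    ((q + i.1 - ∑ l, i.2.1 l : ℕ) : ℝ) = max (q + netInput i) 0 := by
  unfold netInput
  have h : ((∑ l, i.2.1 l : ℕ) : ℝ) = ∑ l, (i.2.1 l : ℝ) := by push_cast; rfl
  rw [← h]
  rcases le_total (∑ l, i.2.1 l) (q + i.1) with h1 | h1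
  · rw [Nat.cast_sub h1, max_eq_left]
    · push_cast; ring
    · have : ((∑ l, i.2.1 l : ℕ) : ℝ) ≤ ((q + i.1 : ℕ) : ℝ) := by exact_mod_cast h1
      push_cast at this ⊢; linarith
  · rw [Nat.sub_eq_zero_of_le h1, max_eq_right]
    · simp
    · have : ((q + i.1 : ℕ) : ℝ) ≤ ((∑ l, i.2.1 l : ℕ) : ℝ) := by exact_mod_cast h1
      push_cast at this ⊢; linarith

/-- The bound `exp (θ max(y, 0)) ≤ 1 + exp (θ y)` turns reflection at zero into an additive
constant. Both existence of a stationary law and its exponential moments come from this drift. -/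
theorem pooled_exp_drift {θ c : ℝ} (hc : c ∈ Set.Ioo (0 : ℝ) 1)
    (hint : Integrable (fun i => Real.exp (θ * netInput i)) (inputLaw svc arr))
    (hle : ∫ i, Real.exp (θ * netInput i) ∂inputLaw svc arr ≤ c) (q : ℕ) :
    markovOp (pooledKernel svc arr) (fun q => ENNReal.ofReal (Real.exp (θ * q))) q
      + ENNReal.ofReal ((1 - c) * Real.exp (θ * q))
      ≤ ENNReal.ofReal (Real.exp (θ * q)) + 1 := by
  have hI : Integrable (fun i => 1 + Real.exp (θ * q) * Real.exp (θ * netInput i))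
      (inputLaw svc arr) := (integrable_const _).add (hint.const_mul _)
  have h1 : markovOp (pooledKernel svc arr) (fun q => ENNReal.ofReal (Real.exp (θ * q))) q
      ≤ ENNReal.ofReal (1 + Real.exp (θ * q) * c) := by
    rw [markovOp_pooledKernel']
    calc _ ≤ ∫⁻ i, ENNReal.ofReal (1 + Real.exp (θ * q) * Real.exp (θ * netInput i))
          ∂inputLaw svc arr := by
          refine lintegral_mono fun i => ENNReal.ofReal_le_ofReal ?_
          rw [cast_pooled_next, ← Real.exp_add, ← mul_add]
          rcases le_total 0 ((q : ℝ) + netInput i) with h | h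
          · rw [max_eq_left h]; linarith
          · rw [max_eq_right h, mul_zero, Real.exp_zero]
            linarith [Real.exp_pos (θ * (q + netInput i))]
      _ = ENNReal.ofReal (∫ i, (1 + Real.exp (θ * q) * Real.exp (θ * netInput i))
          ∂inputLaw svc arr) := by
          rw [ofReal_integral_eq_lintegral_ofReal hI]
          exact ae_of_all _ fun i => by positivity
      _ ≤ _ := by
          refine ENNReal.ofReal_le_ofReal ?_
          rw [integral_add (integrable_const _) (hint.const_mul _), integral_const_mul]
          simp only [integral_const, probReal_univ, one_smul]
          gcongr
  refine (add_le_add_left h1 _).trans ?_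
  have h0 := hc.1
  have h2 : 0 ≤ 1 - c := by linarith [hc.2]
  rw [← ENNReal.ofReal_add (by positivity) (by positivity), ← ENNReal.ofReal_one,
    ← ENNReal.ofReal_add (by positivity) (by positivity)]
  refine ENNReal.ofReal_le_ofReal (le_of_eq (by ring))

theorem exists_pooledSteadyState (H : Regime svc arr b ε) (hε : 0 < ε) :
    ∃ ν, IsPooledSteadyState svc arr ν := by
  obtain ⟨θ, hθ, c, hc, hint, hle⟩ := H.exists_exp_netInput_lt hε
  refine exists_invariant_of_drift (pooledKernel svc arr) 0 (C := 1) (by simp)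
    ENNReal.ofReal_ne_top (pooled_exp_drift hc hint hle) fun R => ?_
  refine (Set.finite_Iic ⌈(R : ℝ) / (θ * (1 - c))⌉₊).subset fun q hq => ?_
  have h2 : 0 < 1 - c := by linarith [hc.2]
  simp only [Set.mem_ofPred_eq] at hq
  rw [← ENNReal.ofReal_natCast, ENNReal.ofReal_le_ofReal_iff (by positivity)] at hq
  have h3 := Real.add_one_le_exp (θ * q)
  have h4 : (1 - c) * (θ * q) ≤ R := by
    refine le_trans ?_ hq
    gcongr
    linarith
  have h5 : (q : ℝ) ≤ R / (θ * (1 - c)) := by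
    rw [le_div_iff₀ (by positivity)]; linarith
  exact_mod_cast h5.trans (Nat.le_ceil _)

theorem lintegral_pooled_exp_le {θ c : ℝ} (hc : c ∈ Set.Ioo (0 : ℝ) 1)
    (hint : Integrable (fun i => Real.exp (θ * netInput i)) (inputLaw svc arr))
    (hle : ∫ i, Real.exp (θ * netInput i) ∂inputLaw svc arr ≤ c) {ν : Measure ℕ}
    (hν : IsPooledSteadyState svc arr ν) :
    ∫⁻ q : ℕ, ENNReal.ofReal ((1 - c) * Real.exp (θ * q)) ∂ν ≤ 1 := by
  have := hν.1
  refine (lintegral_le_of_drift hν.2 (fun _ => ENNReal.ofReal_ne_top)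
    (h := fun _ => 1) (pooled_exp_drift hc hint hle)).trans ?_
  simp

/-- Finiteness is what permits cancelling the quadratic test function in
`le_two_mul_pooledMeanQueue`. -/
theorem lintegral_pooled_sq_add_lt_top (H : Regime svc arr b ε) (hε : 0 < ε) (B : ℝ) (hB : 0 ≤ B)
    {ν : Measure ℕ} (hν : IsPooledSteadyState svc arr ν) :
    ∫⁻ q : ℕ, ENNReal.ofReal ((q : ℝ) ^ 2 + B * q) ∂ν < ∞ := by
  obtain ⟨θ, hθ, c, hc, hint, hle⟩ := H.exists_exp_netInput_lt hε
  have h2 : 0 < 1 - c := by linarith [hc.2]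
  set K : ℝ := (2 / θ ^ 2 + B / θ) / (1 - c) with hK
  have hKpos : 0 ≤ K := by positivity
  have h1 : ∀ q : ℕ, ENNReal.ofReal ((q : ℝ) ^ 2 + B * q)
      ≤ ENNReal.ofReal K * ENNReal.ofReal ((1 - c) * Real.exp (θ * q)) := by
    intro q
    rw [← ENNReal.ofReal_mul hKpos]
    refine ENNReal.ofReal_le_ofReal ?_
    have h3 := Real.add_one_le_exp (θ * q)
    have h4 := Real.quadratic_le_exp_of_nonneg (show 0 ≤ θ * q by positivity)
    have h5 : (q : ℝ) ^ 2 ≤ 2 / θ ^ 2 * Real.exp (θ * q) := by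
      rw [div_mul_eq_mul_div, le_div_iff₀ (by positivity)]
      have : 0 ≤ θ * q := by positivity
      nlinarith
    have h6 : B * q ≤ B / θ * Real.exp (θ * q) := by
      rw [div_mul_eq_mul_div, le_div_iff₀ hθ, mul_assoc]
      gcongr
      linarith
    calc _ ≤ (2 / θ ^ 2 + B / θ) * Real.exp (θ * q) := by linarith
      _ = _ := by rw [hK]; field_simp
  refine (lintegral_mono h1).trans_lt ?_
  rw [lintegral_const_mul _ (measurable_of_countable _)]
  exact ENNReal.mul_lt_top ENNReal.ofReal_lt_top
    ((lintegral_pooled_exp_le hc hint hle hν).trans_lt ENNReal.one_lt_top)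

theorem pooledMeanQueue_eq (ν : Measure ℕ) :
    pooledMeanQueue ν = ∫⁻ q : ℕ, ENNReal.ofReal q ∂ν := by
  simp [pooledMeanQueue]

/-- Stationarity of the test function `q² + B q`, with `B` a bound on the net input `z`. The linear
term makes reflection harmless: if `y = q + z` is negative, then `y² + B y = y (y + B) ≤ 0` because
`y ≥ -B`, so the reflected value zero is no smaller. The price is only `B ε`. -/
theorem le_two_mul_pooledMeanQueue (H : Regime svc arr b ε) (hε : 0 < ε) {ν : Measure ℕ}
    (hν : IsPooledSteadyState svc arr ν) :
    ENNReal.ofReal (∫ i, netInput i ^ 2 ∂inputLaw svc arr)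
      ≤ ENNReal.ofReal (2 * ε) * pooledMeanQueue ν + ENNReal.ofReal ((n + 1) * b * ε) := by
  have := hν.1
  set Z := ∫ i, netInput i ^ 2 ∂inputLaw svc arr with hZ
  have hZ0 : 0 ≤ Z := integral_nonneg fun i => sq_nonneg _
  set B : ℝ := (n + 1) * b with hB
  have hB0 : 0 ≤ B := by have := H.b_nonneg; positivity
  set F : ℕ → ℝ≥0∞ := fun q => ENNReal.ofReal ((q : ℝ) ^ 2 + B * q) with hF
  have hfin := lintegral_pooled_sq_add_lt_top H hε B hB0 hν
  have hpt : ∀ q, F q + ENNReal.ofReal Z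
      ≤ markovOp (pooledKernel svc arr) F q + (ENNReal.ofReal (2 * ε) * ENNReal.ofReal q
        + ENNReal.ofReal (B * ε)) := by
    intro q
    have hI := H.integrable_quadratic_netInput ((q : ℝ) ^ 2 + B * q) (2 * q + B) 1
    have hval := H.integral_quadratic_netInput ((q : ℝ) ^ 2 + B * q) (2 * q + B) 1
    have hG : Integrable (fun i => max ((q : ℝ) + netInput i) 0 ^ 2
        + B * max ((q : ℝ) + netInput i) 0) (inputLaw svc arr) := by
      refine Integrable.of_bound ?_ ((q + B) ^ 2 + B * (q + B)) ?_
      · have hm : Measurable fun i : ℕ × (Fin n → ℕ) × unitInterval × unitInterval =>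
            max ((q : ℝ) + netInput i) 0 :=
          (Regime.measurable_netInput.const_add _).max measurable_const
        exact ((hm.pow_const 2).add (hm.const_mul B)).aestronglyMeasurable
      · filter_upwards [H.ae_abs_netInput_le] with i hi
        have h3 : 0 ≤ max ((q : ℝ) + netInput i) 0 := le_max_right _ _
        have h4 : max ((q : ℝ) + netInput i) 0 ≤ q + B :=
          max_le (by linarith [(abs_le.1 hi).2]) (by positivity)
        rw [Real.norm_eq_abs, abs_of_nonneg (by positivity)]
        gcongr
    have h1 : ENNReal.ofReal ((q : ℝ) ^ 2 + B * q - (2 * q + B) * ε + 1 * Z)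
        ≤ markovOp (pooledKernel svc arr) F q := by
      rw [markovOp_pooledKernel', ← hval]
      calc _ ≤ ENNReal.ofReal (∫ i, (max (q + netInput i) 0 ^ 2 + B * max (q + netInput i) 0)
            ∂inputLaw svc arr) := by
            refine ENNReal.ofReal_le_ofReal (integral_mono_ae hI hG ?_)
            filter_upwards [H.ae_abs_netInput_le] with i hi
            rcases le_total 0 ((q : ℝ) + netInput i) with h | h
            · rw [max_eq_left h]; exact le_of_eq (by ring)
            · rw [max_eq_right h]
              have h6 : -B ≤ netInput i := (abs_le.1 hi).1
              have h7 : (0 : ℝ) ≤ q := Nat.cast_nonneg _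
              nlinarith
        _ = _ := by
            rw [ofReal_integral_eq_lintegral_ofReal hG]
            · refine lintegral_congr fun i => ?_
              rw [hF]
              dsimp only
              rw [cast_pooled_next]
            · refine ae_of_all _ fun i => ?_
              have h3 : 0 ≤ max ((q : ℝ) + netInput i) 0 := le_max_right _ _
              change 0 ≤ max ((q : ℝ) + netInput i) 0 ^ 2 + B * max ((q : ℝ) + netInput i) 0
              positivity
    refine le_trans ?_ (add_le_add_left h1 _)
    rw [hF, ← ENNReal.ofReal_mul (by positivity), ← ENNReal.ofReal_add (by positivity) hZ0,
      ← ENNReal.ofReal_add (by positivity) (by positivity)]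
    refine le_trans (ENNReal.ofReal_le_ofReal (le_of_eq ?_)) ENNReal.ofReal_add_le
    ring
  have h3 : ∫⁻ q, F q ∂ν + ENNReal.ofReal Z ≤ ∫⁻ q, F q ∂ν
      + (ENNReal.ofReal (2 * ε) * pooledMeanQueue ν + ENNReal.ofReal (B * ε)) := by
    calc _ = ∫⁻ q, (F q + ENNReal.ofReal Z) ∂ν := by
          rw [lintegral_add_left (measurable_of_countable _)]; simp
      _ ≤ _ := lintegral_mono hpt
      _ = _ := by
        rw [lintegral_add_left (measurable_of_countable _), lintegral_markovOp hν.2,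
          lintegral_add_left (measurable_of_countable _),
          lintegral_const_mul _ (measurable_of_countable _), pooledMeanQueue_eq]
        simp
  exact (ENNReal.add_le_add_iff_left hfin.ne).1 h3

end Pooled

/-! ### Coupling the pooled queue with an arbitrary policy. -/

section Coupling

variable {n : ℕ} {svc : Measure (Fin n → ℕ)} [IsProbabilityMeasure svc]
  {arr : Measure ℕ} [IsProbabilityMeasure arr] {b ε : ℝ}

/-- The expected positive part, truncated at `M`, of the random walk driven by the net inputs. -/
noncomputable def walkExcess (svc : Measure (Fin n → ℕ)) (arr : Measure ℕ) (M : ℝ≥0∞) :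
    ℕ → ℝ → ℝ≥0∞
  | 0, r => min M (ENNReal.ofReal r)
  | t + 1, r => ∫⁻ i, walkExcess svc arr M t (r + netInput i) ∂inputLaw svc arr

theorem walkExcess_le (M : ℝ≥0∞) (t : ℕ) (r : ℝ) : walkExcess svc arr M t r ≤ M := by
  induction t generalizing r with
  | zero => exact min_le_left _ _
  | succ t ih =>
    calc walkExcess svc arr M (t + 1) r ≤ ∫⁻ _, M ∂inputLaw svc arr := lintegral_mono fun i => ih _
      _ = M := by simp

theorem walkExcess_le_exp {θ c : ℝ} (hθ : 0 < θ) (hc : 0 ≤ c)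
    (hint : Integrable (fun i => Real.exp (θ * netInput i)) (inputLaw svc arr))
    (hle : ∫ i, Real.exp (θ * netInput i) ∂inputLaw svc arr ≤ c) (M : ℝ≥0∞) (t : ℕ) (r : ℝ) :
    walkExcess svc arr M t r ≤ ENNReal.ofReal (Real.exp (θ * r) / θ * c ^ t) := by
  induction t generalizing r with
  | zero =>
    refine (min_le_right _ _).trans (ENNReal.ofReal_le_ofReal ?_)
    rw [pow_zero, mul_one, le_div_iff₀ hθ]
    linarith [Real.add_one_le_exp (θ * r)]
  | succ t ih =>
    have h1 : ∀ i : ℕ × (Fin n → ℕ) × unitInterval × unitInterval,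
        Real.exp (θ * (r + netInput i)) / θ * c ^ t
          = Real.exp (θ * r) / θ * c ^ t * Real.exp (θ * netInput i) := by
      intro i
      rw [mul_add, Real.exp_add]; ring
    calc walkExcess svc arr M (t + 1) r
        ≤ ∫⁻ i, ENNReal.ofReal (Real.exp (θ * r) / θ * c ^ t * Real.exp (θ * netInput i))
          ∂inputLaw svc arr := lintegral_mono fun i => by rw [← h1]; exact ih _
      _ = ENNReal.ofReal (∫ i, Real.exp (θ * r) / θ * c ^ t * Real.exp (θ * netInput i)
          ∂inputLaw svc arr) :=
        (ofReal_integral_eq_lintegral_ofReal (hint.const_mul _)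
          (ae_of_all _ fun i => by positivity)).symm
      _ ≤ _ := by
        refine ENNReal.ofReal_le_ofReal ?_
        rw [integral_const_mul, pow_succ, ← mul_assoc]
        gcongr

theorem tendsto_walkExcess (H : Regime svc arr b ε) (hε : 0 < ε) (M : ℝ≥0∞) (r : ℝ) :
    Tendsto (fun t => walkExcess svc arr M t r) atTop (𝓝 0) := by
  obtain ⟨θ, hθ, c, hc, hint, hle⟩ := H.exists_exp_netInput_lt hε
  refine tendsto_of_tendsto_of_tendsto_of_le_of_le tendsto_const_nhds ?_ (fun _ => zero_le)
    (fun t => walkExcess_le_exp hθ hc.1.le hint hle M t r)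
  have h1 := (tendsto_pow_atTop_nhds_zero_of_lt_one hc.1.le hc.2).const_mul
    (Real.exp (θ * r) / θ)
  rw [mul_zero] at h1
  simpa using ENNReal.tendsto_ofReal h1

theorem add_netInput_le_sum_nextQueue (P : Policy n) (x : P.State)
    (i : ℕ × (Fin n → ℕ) × unitInterval × unitInterval) :
    ∑ l, (x.1 l : ℝ) + netInput i ≤ ∑ l, (P.nextQueue x i.1 i.2.1 l : ℝ) := by
  have h1 : ∀ l, (x.1 l : ℝ) + (if x.2.1 x.2.2 = l then (i.1 : ℝ) else 0) - i.2.1 l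
      ≤ (P.nextQueue x i.1 i.2.1 l : ℝ) := by
    intro l
    have h2 : x.1 l + (if x.2.1 x.2.2 = l then i.1 else 0) ≤ P.nextQueue x i.1 i.2.1 l + i.2.1 l :=
      le_tsub_add
    have h3 : ((x.1 l + (if x.2.1 x.2.2 = l then i.1 else 0) : ℕ) : ℝ)
        ≤ ((P.nextQueue x i.1 i.2.1 l + i.2.1 l : ℕ) : ℝ) := by exact_mod_cast h2
    push_cast at h3
    linarith
  have h2 := Finset.sum_le_sum fun l (_ : l ∈ Finset.univ) => h1 l
  rw [Finset.sum_sub_distrib, Finset.sum_add_distrib] at h2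
  simp only [Finset.sum_ite_eq, Finset.mem_univ, if_true] at h2
  unfold netInput
  linarith

/-- The pooled queue, the policy and a free walk `r` share their inputs. The relation `q ≤ max (∑
Q_l) r` survives a step: `∑ Q_l` stays nonnegative and grows by at least the net input, while `r`
moves by exactly the net input. The walk carries the effect of unordered initial states. -/
theorem iterate_pooledKernel_le (P : Policy n) (M : ℝ≥0∞) (t : ℕ) :
    ∀ (q : ℕ) (x : P.State) (r : ℝ), (q : ℝ) ≤ max (∑ l, (x.1 l : ℝ)) r →
      (markovOp (pooledKernel svc arr))^[t] (fun q => min M (q : ℝ≥0∞)) q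
        ≤ (markovOp (P.kernel svc arr))^[t] (fun x => ∑ l, (x.1 l : ℝ≥0∞)) x
          + walkExcess svc arr M t r := by
  induction t with
  | zero =>
    intro q x r h
    simp only [Function.iterate_zero, id, walkExcess]
    have hx : (∑ l, (x.1 l : ℝ≥0∞)) = ENNReal.ofReal (∑ l, (x.1 l : ℝ)) := by
      rw [ENNReal.ofReal_sum_of_nonneg fun l _ => Nat.cast_nonneg _]
      simp
    rw [hx, ← ENNReal.ofReal_natCast]
    rcases le_max_iff.1 h with h | h
    · exact ((min_le_right _ _).trans (ENNReal.ofReal_le_ofReal h)).trans le_self_add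
    · exact (min_le_min le_rfl (ENNReal.ofReal_le_ofReal h)).trans le_add_self
  | succ t ih =>
    intro q x r h
    have hm : Measurable fun i : ℕ × (Fin n → ℕ) × unitInterval × unitInterval =>
        (markovOp (P.kernel svc arr))^[t] (fun x => ∑ l, (x.1 l : ℝ≥0∞))
          (P.step (serviceRate svc) x i) :=
      (measurable_of_countable _).comp (P.measurable_step _ x)
    rw [Function.iterate_succ_apply', Function.iterate_succ_apply', markovOp_pooledKernel',
      markovOp_kernel, walkExcess, ← lintegral_add_left hm]
    refine lintegral_mono fun i => ih _ _ _ ?_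
    rw [cast_pooled_next, step_fst]
    have h1 := add_netInput_le_sum_nextQueue P x i
    have h2 : 0 ≤ ∑ l, (P.nextQueue x i.1 i.2.1 l : ℝ) :=
      Finset.sum_nonneg fun l _ => Nat.cast_nonneg _
    refine max_le ?_ (h2.trans (le_max_left _ _))
    rcases le_max_iff.1 h with h | h
    · exact le_max_of_le_left (by linarith)
    · exact le_max_of_le_right (by linarith)

/-- The resource-pooled queue is a lower bound for the stationary mean total queue length of every
policy. -/
theorem pooledMeanQueue_le_meanTotalQueue (H : Regime svc arr b ε) (hε : 0 < ε) {ν : Measure ℕ}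
    (hν : IsPooledSteadyState svc arr ν) (P : Policy n) {ρ : Measure P.State}
    (hρ : P.IsSteadyState svc arr ρ) : pooledMeanQueue ν ≤ P.meanTotalQueue ρ := by
  have := hν.1
  have := hρ.1
  have key : ∀ M : ℕ, ∫⁻ q : ℕ, min (M : ℝ≥0∞) q ∂ν ≤ P.meanTotalQueue ρ := by
    intro M
    -- Start both chains independently from their stationary laws, and the walk from `q`.
    -- Stationarity removes `t` from the two means, and negative drift removes the walk as `t`
    -- grows.
    have ht : ∀ t, ∫⁻ q : ℕ, min (M : ℝ≥0∞) q ∂ν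
        ≤ P.meanTotalQueue ρ + ∫⁻ q : ℕ, walkExcess svc arr M t q ∂ν := by
      intro t
      have h1 : ∀ x : P.State, ∫⁻ q : ℕ, min (M : ℝ≥0∞) q ∂ν
          ≤ (markovOp (P.kernel svc arr))^[t] (fun x => ∑ l, (x.1 l : ℝ≥0∞)) x
            + ∫⁻ q : ℕ, walkExcess svc arr M t q ∂ν := by
        intro x
        rw [← lintegral_iterate_markovOp hν.2 _ t]
        calc _ ≤ ∫⁻ q : ℕ, ((markovOp (P.kernel svc arr))^[t] (fun x => ∑ l, (x.1 l : ℝ≥0∞)) x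
              + walkExcess svc arr M t q) ∂ν :=
              lintegral_mono fun q => iterate_pooledKernel_le P M t q x q (le_max_right _ _)
          _ = _ := by rw [lintegral_add_left measurable_const]; simp
      calc _ = ∫⁻ _ : P.State, (∫⁻ q : ℕ, min (M : ℝ≥0∞) q ∂ν) ∂ρ := by simp
        _ ≤ _ := lintegral_mono h1
        _ = _ := by
          rw [lintegral_add_left (measurable_of_countable _), lintegral_iterate_markovOp hρ.2]
          simp [Policy.meanTotalQueue]
    have hlim : Tendsto (fun t => ∫⁻ q : ℕ, walkExcess svc arr M t q ∂ν) atTop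
        (𝓝 (∫⁻ _, 0 ∂ν)) :=
      tendsto_lintegral_of_dominated_convergence (fun _ => (M : ℝ≥0∞))
        (fun _ => measurable_of_countable _) (fun t => ae_of_all _ fun q => walkExcess_le _ _ _)
        (by simp) (ae_of_all _ fun q => tendsto_walkExcess H hε _ _)
    have h2 := ge_of_tendsto' (hlim.const_add (P.meanTotalQueue ρ)) ht
    simpa using h2
  have hmono : pooledMeanQueue ν = ⨆ M : ℕ, ∫⁻ q : ℕ, min (M : ℝ≥0∞) q ∂ν := by
    rw [← lintegral_iSup (fun _ => measurable_of_countable _)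
      (fun a b hab x => by dsimp only; gcongr)]
    refine lintegral_congr fun x => ?_
    rw [← iSup_inf_eq, ENNReal.iSup_natCast, top_inf_eq]
  rw [hmono]
  exact iSup_le key

end Coupling

/-! ### Summation by parts for sorted sequences. -/

theorem sum_range_mul_by_parts (o c : ℕ → ℝ) (N : ℕ) :
    ∑ k ∈ Finset.range (N + 1), o k * c k
      = o N * ∑ k ∈ Finset.range (N + 1), c k
        + ∑ m ∈ Finset.range N, (o m - o (m + 1)) * ∑ k ∈ Finset.range (m + 1), c k := by
  induction N with
  | zero => simp
  | succ N ih =>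
    rw [Finset.sum_range_succ, ih, Finset.sum_range_succ (fun m => (o m - o (m + 1)) * _) N,
      Finset.sum_range_succ c (N + 1)]
    ring

theorem sum_fin_filter_lt {n m : ℕ} (hm : m ≤ n) (g : ℕ → ℝ) :
    ∑ l : Fin n with l.val < m, g l = ∑ k ∈ Finset.range m, g k := by
  rw [Finset.sum_filter, Fin.sum_univ_eq_sum_range (fun k => if k < m then g k else 0) n,
    ← Finset.sum_filter]
  congr 1
  ext k
  simp only [Finset.mem_filter, Finset.mem_range]
  omega

/-- A decreasing sequence weighted by a sequence with negative partial sums. -/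
theorem sum_antitone_mul_le {N : ℕ} {o c : Fin (N + 1) → ℝ} {δ ε : ℝ} (ho : Antitone o)
    (hc : ∀ m, 1 ≤ m → m < N + 1 → ∑ l : Fin (N + 1) with l.val < m, c l ≤ -δ)
    (hsum : ∑ l, c l = -ε) :
    ∑ l, o l * c l ≤ -δ * (o 0 - o (Fin.last N)) - ε * o (Fin.last N) := by
  let o' : ℕ → ℝ := fun k => if h : k < N + 1 then o ⟨k, h⟩ else 0
  let c' : ℕ → ℝ := fun k => if h : k < N + 1 then c ⟨k, h⟩ else 0
  have ho' : ∀ l : Fin (N + 1), o' l = o l := fun l => dif_pos l.isLt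
  have hc' : ∀ l : Fin (N + 1), c' l = c l := fun l => dif_pos l.isLt
  have h1 : ∑ l, o l * c l = ∑ k ∈ Finset.range (N + 1), o' k * c' k := by
    rw [← Fin.sum_univ_eq_sum_range (fun k => o' k * c' k)]
    simp_rw [ho', hc']
  have h2 : ∑ k ∈ Finset.range (N + 1), c' k = -ε := by
    rw [← Fin.sum_univ_eq_sum_range c', ← hsum]
    simp_rw [hc']
  have h3 : ∀ m < N, ∑ k ∈ Finset.range (m + 1), c' k ≤ -δ := by
    intro m hm
    rw [← sum_fin_filter_lt (by omega : m + 1 ≤ N + 1) c']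
    simp_rw [hc']
    exact hc (m + 1) (by omega) (by omega)
  rw [h1, sum_range_mul_by_parts, h2]
  have h4 : ∑ m ∈ Finset.range N, (o' m - o' (m + 1)) * ∑ k ∈ Finset.range (m + 1), c' k
      ≤ ∑ m ∈ Finset.range N, (o' m - o' (m + 1)) * -δ := by
    refine Finset.sum_le_sum fun m hm => ?_
    rw [Finset.mem_range] at hm
    refine mul_le_mul_of_nonneg_left (h3 m hm) ?_
    rw [sub_nonneg]
    have e1 := ho' ⟨m, by omega⟩
    have e2 := ho' ⟨m + 1, by omega⟩
    simp only at e1 e2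
    rw [e1, e2]
    exact ho (by simp [Fin.le_def])
  rw [← Finset.sum_mul, Finset.sum_range_sub'] at h4
  have e0 : o' 0 = o 0 := ho' 0
  have eN : o' N = o (Fin.last N) := ho' (Fin.last N)
  rw [e0, eN] at h4
  rw [eN]
  linarith

/-! ### The quadratic forms for stability (`θ = 0`) and collapse (`θ = 1`). -/

namespace Policy

variable {n : ℕ} (P : Policy n)

/-- The sum of the scaling factors. -/
noncomputable def Γ : ℝ := ∑ l, (P.γ l : ℝ)

/-- The gradient of half the quadratic form `∑ v_l² / γ_l - θ (∑ v_l)² / Γ`. -/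
noncomputable def coeff (θ : ℝ) (v : Fin n → ℝ) (l : Fin n) : ℝ :=
  v l / P.γ l - θ * ((∑ m, v m) / P.Γ)

/-- The bilinear form `∑ v_l w_l / γ_l - θ (∑ v_l) (∑ w_l) / Γ`. -/
noncomputable def pairing (θ : ℝ) (v w : Fin n → ℝ) : ℝ := ∑ l, P.coeff θ v l * w l

/-- A constant bounding the bilinear forms `pairing θ`. -/
noncomputable def formBound : ℝ := ∑ l, 1 / (P.γ l : ℝ) + (n : ℝ) ^ 2 / P.Γ

theorem γ_pos' (l : Fin n) : 0 < (P.γ l : ℝ) := by exact_mod_cast P.γ_pos l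

theorem Γ_pos (hn : 0 < n) : 0 < P.Γ :=
  Finset.sum_pos (fun l _ => P.γ_pos' l) ⟨⟨0, hn⟩, Finset.mem_univ _⟩

theorem Γ_nonneg : 0 ≤ P.Γ := Finset.sum_nonneg fun l _ => (P.γ_pos' l).le

theorem formBound_nonneg : 0 ≤ P.formBound := by
  have h1 : 0 ≤ ∑ l, 1 / (P.γ l : ℝ) := Finset.sum_nonneg fun l _ => by positivity
  have h2 := P.Γ_nonneg
  unfold formBound
  positivity

theorem coeff_add (θ : ℝ) (v v' : Fin n → ℝ) (l : Fin n) :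
    P.coeff θ (v + v') l = P.coeff θ v l + P.coeff θ v' l := by
  simp only [coeff, Pi.add_apply, Finset.sum_add_distrib]
  ring

theorem pairing_add_left (θ : ℝ) (v v' w : Fin n → ℝ) :
    P.pairing θ (v + v') w = P.pairing θ v w + P.pairing θ v' w := by
  simp only [pairing, coeff_add, add_mul, Finset.sum_add_distrib]

theorem pairing_add_right (θ : ℝ) (v w w' : Fin n → ℝ) :
    P.pairing θ v (w + w') = P.pairing θ v w + P.pairing θ v w' := by
  simp only [pairing, Pi.add_apply, mul_add, Finset.sum_add_distrib]

theorem pairing_eq (θ : ℝ) (v w : Fin n → ℝ) :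
    P.pairing θ v w = ∑ l, v l * w l / P.γ l - θ * ((∑ l, v l) * (∑ l, w l) / P.Γ) := by
  simp only [pairing, coeff, sub_mul, Finset.sum_sub_distrib, ← Finset.mul_sum]
  congr 1
  · exact Finset.sum_congr rfl fun l _ => by ring
  · ring

theorem pairing_comm (θ : ℝ) (v w : Fin n → ℝ) : P.pairing θ v w = P.pairing θ w v := by
  rw [pairing_eq, pairing_eq, mul_comm (∑ l, v l)]
  simp_rw [mul_comm (v _)]

theorem pairing_add_self (θ : ℝ) (v d : Fin n → ℝ) :
    P.pairing θ (v + d) (v + d)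
      = P.pairing θ v v + 2 * P.pairing θ v d + P.pairing θ d d := by
  rw [pairing_add_left, pairing_add_right, pairing_add_right, P.pairing_comm θ d v]
  ring

theorem abs_pairing_le {θ : ℝ} (h0 : 0 ≤ θ) (h1 : θ ≤ 1) {v w : Fin n → ℝ} {c c' : ℝ}
    (hc : 0 ≤ c) (hv : ∀ l, |v l| ≤ c) (hw : ∀ l, |w l| ≤ c') :
    |P.pairing θ v w| ≤ P.formBound * (c * c') := by
  have hΓ := P.Γ_nonneg
  have hs : ∀ (u : Fin n → ℝ) (d : ℝ), (∀ l, |u l| ≤ d) → |∑ l, u l| ≤ n * d := by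
    intro u d hu
    calc _ ≤ ∑ l, |u l| := Finset.abs_sum_le_sum_abs _ _
      _ ≤ ∑ _l : Fin n, d := Finset.sum_le_sum fun l _ => hu l
      _ = _ := by simp
  have ha : |∑ l, v l * w l / P.γ l| ≤ (∑ l, 1 / (P.γ l : ℝ)) * (c * c') := by
    rw [Finset.sum_mul]
    refine (Finset.abs_sum_le_sum_abs _ _).trans (Finset.sum_le_sum fun l _ => ?_)
    rw [abs_div, abs_mul, abs_of_pos (P.γ_pos' l), one_div_mul_eq_div]
    have := P.γ_pos' l
    gcongr
    · exact hv l
    · exact hw l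
  have hb : |(∑ l, v l) * (∑ l, w l) / P.Γ| ≤ (n : ℝ) ^ 2 / P.Γ * (c * c') := by
    rw [abs_div, abs_mul, abs_of_nonneg hΓ, div_mul_eq_mul_div]
    refine div_le_div_of_nonneg_right ?_ hΓ
    calc _ ≤ (n * c) * (n * c') := mul_le_mul (hs v c hv) (hs w c' hw) (abs_nonneg _) (by positivity)
      _ = _ := by ring
  rw [pairing_eq, formBound, add_mul]
  refine (abs_sub _ _).trans (add_le_add ha ?_)
  rw [abs_mul, abs_of_nonneg h0]
  calc _ ≤ 1 * |(∑ l, v l) * (∑ l, w l) / P.Γ| := by gcongr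
    _ ≤ _ := by rw [one_mul]; exact hb

theorem sum_γ_mul_coeff_one (hn : 0 < n) (v : Fin n → ℝ) :
    ∑ l, (P.γ l : ℝ) * P.coeff 1 v l = 0 := by
  have hΓ := P.Γ_pos hn
  have h1 : ∀ l, (P.γ l : ℝ) * P.coeff 1 v l = v l - P.γ l * ((∑ m, v m) / P.Γ) := by
    intro l
    have := (P.γ_pos' l).ne'
    unfold coeff
    field_simp
  simp_rw [h1, Finset.sum_sub_distrib, ← Finset.sum_mul]
  change _ - P.Γ * _ = 0
  field_simp
  ring

/-- For `θ = 1` the coefficients are the scaled queue lengths minus their `γ`-weighted mean `(∑ v) /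
Γ`. The form is therefore a weighted variance, and it vanishes exactly on multiples of `γ`. -/
theorem pairing_one_self (hn : 0 < n) (v : Fin n → ℝ) :
    P.pairing 1 v v = ∑ l, (P.γ l : ℝ) * P.coeff 1 v l ^ 2 := by
  have h1 : ∀ l, (P.γ l : ℝ) * P.coeff 1 v l ^ 2
      = P.coeff 1 v l * v l - ((∑ m, v m) / P.Γ) * (P.γ l * P.coeff 1 v l) := by
    intro l
    have h2 : (P.γ l : ℝ) * P.coeff 1 v l = v l - P.γ l * ((∑ m, v m) / P.Γ) := by
      have := (P.γ_pos' l).ne'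
      unfold coeff
      field_simp
    calc _ = (P.γ l * P.coeff 1 v l) * P.coeff 1 v l := by ring
      _ = _ := by rw [h2]; linear_combination -((∑ m, v m) / P.Γ) * h2
  simp_rw [h1, Finset.sum_sub_distrib, ← Finset.mul_sum, P.sum_γ_mul_coeff_one hn]
  simp [pairing]

theorem pairing_one_self_nonneg (hn : 0 < n) (v : Fin n → ℝ) : 0 ≤ P.pairing 1 v v := by
  rw [P.pairing_one_self hn]
  exact Finset.sum_nonneg fun l _ => by have := P.γ_pos' l; positivity

theorem pairing_zero_self_nonneg (v : Fin n → ℝ) : 0 ≤ P.pairing 0 v v := by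
  rw [pairing_eq, zero_mul, sub_zero]
  exact Finset.sum_nonneg fun l _ => by
    have := P.γ_pos' l
    have := mul_self_nonneg (v l)
    positivity

/-- Nonnegativity of the form at `v - d`. -/
theorem pairing_one_add_self_le (hn : 0 < n) (v d : Fin n → ℝ) :
    P.pairing 1 (v + d) (v + d) ≤ 2 * P.pairing 1 v v + 2 * P.pairing 1 d d := by
  have h1 := P.pairing_one_self_nonneg hn (v + -d)
  have h2 : ∀ u w, P.pairing 1 u (-w) = -P.pairing 1 u w := by
    intro u w
    simp [pairing]
  rw [pairing_add_self, h2, h2, P.pairing_comm 1 (-d), h2] at h1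
  rw [pairing_add_self]
  linarith

/-- Cauchy–Schwarz with weights `√γ_l`. Having the form of `v`, rather than the size of `v`, on the
right means that a bounded increment changes the form only by the order of its square root. -/
theorem pairing_one_sq_le (hn : 0 < n) (v d : Fin n → ℝ) {c : ℝ}
    (hd : ∀ l, |d l| ≤ c) :
    P.pairing 1 v d ^ 2 ≤ P.pairing 1 v v * (P.formBound * c ^ 2) := by
  have hb : ∑ l, d l ^ 2 / P.γ l ≤ P.formBound * c ^ 2 := by
    have h2 : ∑ l, d l ^ 2 / P.γ l ≤ (∑ l, 1 / (P.γ l : ℝ)) * c ^ 2 := by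
      rw [Finset.sum_mul]
      refine Finset.sum_le_sum fun l _ => ?_
      have := P.γ_pos' l
      rw [one_div_mul_eq_div]
      exact div_le_div_of_nonneg_right (sq_le_sq' (abs_le.1 (hd l)).1 (abs_le.1 (hd l)).2) this.le
    refine h2.trans ?_
    have := P.Γ_nonneg
    unfold formBound
    gcongr
    have : 0 ≤ (n : ℝ) ^ 2 / P.Γ := by positivity
    linarith
  have hcs := Finset.sum_mul_sq_le_sq_mul_sq Finset.univ
    (fun l => √(P.γ l : ℝ) * P.coeff 1 v l) (fun l => d l / √(P.γ l : ℝ))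
  have e1 : ∀ l, √(P.γ l : ℝ) * P.coeff 1 v l * (d l / √(P.γ l : ℝ)) = P.coeff 1 v l * d l := by
    intro l
    have : √(P.γ l : ℝ) ≠ 0 := (Real.sqrt_pos.2 (P.γ_pos' l)).ne'
    field_simp
  have e2 : ∀ l, (√(P.γ l : ℝ) * P.coeff 1 v l) ^ 2 = P.γ l * P.coeff 1 v l ^ 2 := by
    intro l
    rw [mul_pow, Real.sq_sqrt (P.γ_pos' l).le]
  have e3 : ∀ l, (d l / √(P.γ l : ℝ)) ^ 2 = d l ^ 2 / P.γ l := by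
    intro l
    rw [div_pow, Real.sq_sqrt (P.γ_pos' l).le]
  simp_rw [e1, e2, e3] at hcs
  rw [← P.pairing_one_self hn] at hcs
  exact hcs.trans (mul_le_mul_of_nonneg_left hb (P.pairing_one_self_nonneg hn v))

/-- If one queue is empty, the total is controlled by the deviation from proportionality to `γ`. -/
theorem sum_sq_le_of_eq_zero (hn : 0 < n) {v : Fin n → ℝ} {l : Fin n} (hl : v l = 0) :
    (∑ m, v m) ^ 2 ≤ P.Γ ^ 2 * P.formBound * P.pairing 1 v v := by
  have hΓ := P.Γ_pos hn
  have hγ := P.γ_pos' l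
  have h1 : (P.γ l : ℝ) * P.coeff 1 v l ^ 2 ≤ P.pairing 1 v v := by
    rw [P.pairing_one_self hn]
    exact Finset.single_le_sum (f := fun l => (P.γ l : ℝ) * P.coeff 1 v l ^ 2)
      (fun m _ => by have := P.γ_pos' m; positivity) (Finset.mem_univ l)
  -- At an empty queue the coefficient is minus the weighted mean.
  have h2 : (∑ m, v m) ^ 2 = P.Γ ^ 2 * (1 / P.γ l) * (P.γ l * P.coeff 1 v l ^ 2) := by
    unfold coeff
    rw [hl]
    field_simp
    ring
  have h3 : 1 / (P.γ l : ℝ) ≤ P.formBound := by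
    have h4 : 1 / (P.γ l : ℝ) ≤ ∑ m, 1 / (P.γ m : ℝ) :=
      Finset.single_le_sum (f := fun m => 1 / (P.γ m : ℝ)) (fun m _ => by positivity)
        (Finset.mem_univ l)
    unfold formBound
    have : 0 ≤ (n : ℝ) ^ 2 / P.Γ := by positivity
    linarith
  rw [h2]
  have := P.pairing_one_self_nonneg hn v
  have := P.formBound_nonneg
  gcongr

/-- Deviation from proportionality in terms of the spread of the scaled queue lengths. -/
theorem pairing_one_self_le_spread (hn : 0 < n) {v : Fin n → ℝ} {lo hi : ℝ}
    (hlo : ∀ l, lo ≤ v l / P.γ l) (hhi : ∀ l, v l / P.γ l ≤ hi) :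
    P.pairing 1 v v ≤ P.Γ * (hi - lo) ^ 2 := by
  have hΓ := P.Γ_pos hn
  -- The form does not see multiples of `γ`. After this subtraction the entries lie between `0` and
  -- `γ_l (hi - lo)`.
  set w : Fin n → ℝ := fun l => v l - lo * P.γ l with hw
  have hwb : ∀ l, 0 ≤ w l ∧ w l ≤ P.γ l * (hi - lo) := by
    intro l
    have h1 := hlo l
    have h2 := hhi l
    rw [le_div_iff₀ (P.γ_pos' l)] at h1
    rw [div_le_iff₀ (P.γ_pos' l)] at h2
    constructor
    · simp only [hw]; linarith
    · simp only [hw]; linarith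
  have hc : ∀ l, P.coeff 1 v l = P.coeff 1 w l := by
    intro l
    have hs : ∑ m, w m = ∑ m, v m - lo * P.Γ := by
      simp only [hw, Finset.sum_sub_distrib, ← Finset.mul_sum]
      rfl
    have := (P.γ_pos' l).ne'
    unfold coeff
    rw [hs]
    simp only [hw]
    field_simp
    ring
  rw [P.pairing_one_self hn]
  simp_rw [hc]
  rw [← P.pairing_one_self hn, pairing_eq]
  have h1 : 0 ≤ 1 * ((∑ l, w l) * (∑ l, w l) / P.Γ) := by
    have := mul_self_nonneg (∑ l, w l)
    positivity
  refine (sub_le_self _ h1).trans ?_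
  rw [Γ, Finset.sum_mul]
  refine Finset.sum_le_sum fun l _ => ?_
  have hγ := P.γ_pos' l
  rw [div_le_iff₀ hγ]
  calc w l * w l ≤ (P.γ l * (hi - lo)) * (P.γ l * (hi - lo)) :=
        mul_le_mul (hwb l).2 (hwb l).2 (hwb l).1 ((hwb l).1.trans (hwb l).2)
    _ = _ := by ring

end Policy

/-! ### The forecast of the queue lengths at the end of a cycle. -/

namespace Policy

variable {n : ℕ} (P : Policy n)

/-- The expected net input to the queues during the slots `j, …, T - 1` of a cycle with decision
vector `φ`, when the rates of arrivals and services are `r` and `μ`. -/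
noncomputable def remainingDrift (μ : Fin n → ℝ) (r : ℝ) (φ : Fin P.T → Fin n) (j : ℕ)
    (l : Fin n) : ℝ :=
  ∑ i : Fin P.T, if j ≤ (i : ℕ) then (if φ i = l then r else 0) - μ l else 0

/-- The queue lengths predicted for the end of the cycle. -/
noncomputable def forecast (μ : Fin n → ℝ) (r : ℝ) (x : P.State) : Fin n → ℝ :=
  (fun l => (x.1 l : ℝ)) + P.remainingDrift μ r x.2.1 x.2.2

/-- The drift of a whole cycle starting in `x`, if a cycle starts in `x`. -/
noncomputable def renewedDrift (μ : Fin n → ℝ) (r : ℝ) (x : P.State) : Fin n → ℝ :=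
  P.remainingDrift μ r x.2.1 0

/-- The centered net input of a slot. -/
noncomputable def noise (μ : Fin n → ℝ) (r : ℝ) (x : P.State)
    (i : ℕ × (Fin n → ℕ) × unitInterval × unitInterval) (l : Fin n) : ℝ :=
  (if x.2.1 x.2.2 = l then (i.1 : ℝ) - r else 0) - (i.2.1 l - μ l)

/-- The unused services of a slot. -/
noncomputable def unused (x : P.State) (i : ℕ × (Fin n → ℕ) × unitInterval × unitInterval)
    (l : Fin n) : ℝ :=
  (P.nextQueue x i.1 i.2.1 l : ℝ)
    - (x.1 l + (if x.2.1 x.2.2 = l then (i.1 : ℝ) else 0) - i.2.1 l)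

theorem remainingDrift_eq (μ : Fin n → ℝ) (r : ℝ) (φ : Fin P.T → Fin n) (j : Fin P.T)
    (l : Fin n) :
    P.remainingDrift μ r φ j l
      = ((if φ j = l then r else 0) - μ l) + P.remainingDrift μ r φ (j + 1) l := by
  have h : ∀ i : Fin P.T, (if (j : ℕ) ≤ (i : ℕ) then (if φ i = l then r else 0) - μ l else 0)
      = (if i = j then (if φ i = l then r else 0) - μ l else 0)
        + (if (j : ℕ) + 1 ≤ (i : ℕ) then (if φ i = l then r else 0) - μ l else 0) := by
    intro i
    rcases lt_trichotomy (i : ℕ) j with h | h | h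
    · simp [show ¬ (j : ℕ) ≤ i by omega, show i ≠ j by rintro rfl; omega,
        show ¬ (j : ℕ) + 1 ≤ i by omega]
    · have : i = j := Fin.ext h
      subst this
      simp
    · simp [h.le, show i ≠ j by rintro rfl; omega, Nat.succ_le_of_lt h]
  unfold remainingDrift
  simp_rw [h, Finset.sum_add_distrib]
  simp

theorem remainingDrift_eq_zero (μ : Fin n → ℝ) (r : ℝ) (φ : Fin P.T → Fin n) {j : ℕ}
    (hj : P.T ≤ j) (l : Fin n) : P.remainingDrift μ r φ j l = 0 :=
  Finset.sum_eq_zero fun i _ => if_neg (by omega)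

theorem step_of_lt (μ : Fin n → ℝ) {x : P.State} (h : (x.2.2 : ℕ) + 1 < P.T)
    (i : ℕ × (Fin n → ℕ) × unitInterval × unitInterval) :
    P.step μ x i = (P.nextQueue x i.1 i.2.1, x.2.1, ⟨x.2.2 + 1, h⟩) := dif_pos h

theorem step_of_not_lt (μ : Fin n → ℝ) {x : P.State} (h : ¬ (x.2.2 : ℕ) + 1 < P.T)
    (i : ℕ × (Fin n → ℕ) × unitInterval × unitInterval) :
    P.step μ x i = (P.nextQueue x i.1 i.2.1,
      P.decision μ (P.nextQueue x i.1 i.2.1) i.2.2.1 i.2.2.2, ⟨0, P.T_pos⟩) := dif_neg h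

/-- The increment of the forecast apart from the noise. -/
noncomputable def forecastShift (μ : Fin n → ℝ) (r : ℝ) (x : P.State)
    (i : ℕ × (Fin n → ℕ) × unitInterval × unitInterval) : Fin n → ℝ :=
  if (x.2.2 : ℕ) + 1 < P.T then 0 else P.renewedDrift μ r (P.step μ x i)

/-- The expected input of the present slot leaves the forecast just as the actual input enters the
queues, so their difference is noise. At the end of a cycle nothing is left to predict, and the
drift of a full new cycle is added. -/
theorem forecast_step (μ : Fin n → ℝ) (r : ℝ) (x : P.State)
    (i : ℕ × (Fin n → ℕ) × unitInterval × unitInterval) :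
    P.forecast μ r (P.step μ x i) = P.forecast μ r x
      + (P.noise μ r x i + P.unused x i + P.forecastShift μ r x i) := by
  funext l
  have hr := P.remainingDrift_eq μ r x.2.1 x.2.2 l
  by_cases h : (x.2.2 : ℕ) + 1 < P.T
  · simp only [forecast, forecastShift, step_of_lt P μ h, h, if_true, Pi.add_apply, Pi.zero_apply,
      hr, noise, unused]
    split_ifs <;> ring
  · have h0 := P.remainingDrift_eq_zero μ r x.2.1 (j := (x.2.2 : ℕ) + 1) (by omega) l
    rw [h0] at hr
    simp only [forecast, forecastShift, renewedDrift, step_of_not_lt P μ h, h, if_false,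
      Pi.add_apply, hr, noise, unused]
    split_ifs <;> ring

theorem abs_remainingDrift_le {μ : Fin n → ℝ} {r b : ℝ} (hμ : ∀ l, 0 ≤ μ l ∧ μ l ≤ b)
    (hr : 0 ≤ r ∧ r ≤ b) (φ : Fin P.T → Fin n) (j : ℕ) (l : Fin n) :
    |P.remainingDrift μ r φ j l| ≤ P.T * b := by
  have hb : 0 ≤ b := hr.1.trans hr.2
  calc _ ≤ ∑ _i : Fin P.T, b := by
        refine (Finset.abs_sum_le_sum_abs _ _).trans (Finset.sum_le_sum fun i _ => ?_)
        have := hμ l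
        split_ifs
        · rw [abs_le]; constructor <;> linarith
        · rw [abs_le]; constructor <;> linarith
        · simpa using hb
    _ = _ := by simp

theorem unused_eq (x : P.State) (i : ℕ × (Fin n → ℕ) × unitInterval × unitInterval) (l : Fin n) :
    P.unused x i l
      = ((i.2.1 l - (x.1 l + if x.2.1 x.2.2 = l then i.1 else 0) : ℕ) : ℝ) := by
  unfold unused nextQueue
  set z := x.1 l + if x.2.1 x.2.2 = l then i.1 else 0 with hz
  have hz' : (x.1 l : ℝ) + (if x.2.1 x.2.2 = l then (i.1 : ℝ) else 0) = z := by
    rw [hz]; push_cast; rfl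
  rw [hz']
  rcases le_total z (i.2.1 l) with h | h
  · rw [Nat.sub_eq_zero_of_le h, Nat.cast_sub h]; push_cast; ring
  · rw [Nat.sub_eq_zero_of_le h, Nat.cast_sub h]; push_cast; ring

theorem unused_nonneg (x : P.State) (i : ℕ × (Fin n → ℕ) × unitInterval × unitInterval)
    (l : Fin n) : 0 ≤ P.unused x i l := by
  rw [unused_eq]; exact Nat.cast_nonneg _

theorem unused_le (x : P.State) (i : ℕ × (Fin n → ℕ) × unitInterval × unitInterval)
    (l : Fin n) : P.unused x i l ≤ i.2.1 l := by
  rw [unused_eq]; exact_mod_cast Nat.sub_le _ _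

/-- Service is wasted only when it exceeds the queue, so a nonzero product forces `Q_l ≤ S_l`. -/
theorem queue_mul_unused_le (x : P.State) (i : ℕ × (Fin n → ℕ) × unitInterval × unitInterval)
    (l : Fin n) : (x.1 l : ℝ) * P.unused x i l ≤ i.2.1 l * i.2.1 l := by
  by_cases h : x.1 l ≤ i.2.1 l
  · have h1 : (x.1 l : ℝ) ≤ i.2.1 l := by exact_mod_cast h
    exact mul_le_mul h1 (P.unused_le x i l) (P.unused_nonneg x i l) (Nat.cast_nonneg _)
  · rw [unused_eq, Nat.sub_eq_zero_of_le (by omega)]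
    simp only [Nat.cast_zero, mul_zero]
    positivity

theorem nextQueue_eq_zero_of_unused_ne_zero {x : P.State}
    {i : ℕ × (Fin n → ℕ) × unitInterval × unitInterval} {l : Fin n} (h : P.unused x i l ≠ 0) :
    P.nextQueue x i.1 i.2.1 l = 0 := by
  rw [unused_eq, Nat.cast_ne_zero] at h
  unfold nextQueue
  omega

theorem abs_nextQueue_sub_le (x : P.State) (i : ℕ × (Fin n → ℕ) × unitInterval × unitInterval)
    {b : ℝ} (ha : (i.1 : ℝ) ≤ b) (hs : ∀ l, (i.2.1 l : ℝ) ≤ b) (l : Fin n) :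
    |(P.nextQueue x i.1 i.2.1 l : ℝ) - x.1 l| ≤ b := by
  have h1 : P.nextQueue x i.1 i.2.1 l ≤ x.1 l + i.1 := by
    unfold nextQueue; split_ifs <;> omega
  have h2 : x.1 l ≤ P.nextQueue x i.1 i.2.1 l + i.2.1 l := by
    unfold nextQueue; split_ifs <;> omega
  have h1' : (P.nextQueue x i.1 i.2.1 l : ℝ) ≤ x.1 l + i.1 := by exact_mod_cast h1
  have h2' : (x.1 l : ℝ) ≤ P.nextQueue x i.1 i.2.1 l + i.2.1 l := by exact_mod_cast h2
  have := hs l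
  rw [abs_le]
  constructor <;> linarith

theorem sum_nextQueue_eq (x : P.State) (i : ℕ × (Fin n → ℕ) × unitInterval × unitInterval) :
    ∑ l, (P.nextQueue x i.1 i.2.1 l : ℝ)
      = ∑ l, (x.1 l : ℝ) + netInput i + ∑ l, P.unused x i l := by
  simp only [unused, netInput, Finset.sum_sub_distrib, Finset.sum_add_distrib]
  simp only [Finset.sum_ite_eq, Finset.mem_univ, if_true]
  ring

end Policy

/-! ### Integrability of one-step quantities and centering of the noise. -/

section Expectation

variable {n : ℕ} (P : Policy n) {svc : Measure (Fin n → ℕ)} [IsProbabilityMeasure svc]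
  {arr : Measure ℕ} [IsProbabilityMeasure arr] {b ε : ℝ}

theorem Regime.serviceRate_mem (H : Regime svc arr b ε) (l : Fin n) :
    0 ≤ serviceRate svc l ∧ serviceRate svc l ≤ b := by
  constructor
  · exact integral_nonneg fun s => Nat.cast_nonneg _
  · calc serviceRate svc l ≤ ∫ _, b ∂svc := by
          refine integral_mono_ae (H.integrable_svc l) (integrable_const _) ?_
          filter_upwards [H.svc_le] with s hs using hs l
      _ = b := by simp

theorem Regime.arrivalRate_mem (H : Regime svc arr b ε) :
    0 ≤ (∑ l, serviceRate svc l) - ε ∧ (∑ l, serviceRate svc l) - ε ≤ b := by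
  rw [← H.mean]
  constructor
  · exact integral_nonneg fun s => Nat.cast_nonneg _
  · calc _ ≤ ∫ _, b ∂arr := integral_mono_ae H.integrable_arr (integrable_const _) H.arr_le
      _ = b := by simp

theorem finite_setOf_queue_le (c : Fin n → ℕ) : {y : P.State | ∀ l, y.1 l ≤ c l}.Finite := by
  have h : {y : P.State | ∀ l, y.1 l ≤ c l} = (Set.Iic c) ×ˢ Set.univ := by
    ext y; simp [Pi.le_def]
  rw [h]
  exact (Set.finite_Iic c).prod Set.finite_univ

/-- Bounded arrivals confine the next state to a finite set almost surely. -/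
theorem Regime.integrable_step (H : Regime svc arr b ε) (G : P.State → ℝ) (x : P.State) :
    Integrable (fun i => G (P.step (serviceRate svc) x i)) (inputLaw svc arr) := by
  set F := (finite_setOf_queue_le P fun l => x.1 l + ⌊b⌋₊).toFinset with hF
  refine Integrable.of_bound ((measurable_of_countable G).comp
    (P.measurable_step _ x)).aestronglyMeasurable (∑ y ∈ F, ‖G y‖) ?_
  filter_upwards [H.ae_arr_le] with i hi
  refine Finset.single_le_sum (f := fun y => ‖G y‖) (fun _ _ => norm_nonneg _) ?_
  rw [hF, Set.Finite.mem_toFinset]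
  intro l
  have h1 : i.1 ≤ ⌊b⌋₊ := Nat.le_floor hi
  rw [step_fst]
  unfold Policy.nextQueue
  split_ifs <;> omega

theorem Regime.integrable_noise (H : Regime svc arr b ε) (r : ℝ) (x : P.State) (l : Fin n) :
    Integrable (fun i => P.noise (serviceRate svc) r x i l) (inputLaw svc arr) := by
  have h2 : Integrable (fun i : ℕ × (Fin n → ℕ) × unitInterval × unitInterval =>
      (i.2.1 l : ℝ) - serviceRate svc l) (inputLaw svc arr) :=
    (H.integrable_input_svc l).sub (integrable_const _)
  unfold Policy.noise
  split_ifs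
  · exact (H.integrable_input_arr.sub (integrable_const r)).sub h2
  · exact (integrable_const _).sub h2

theorem Regime.integral_noise (H : Regime svc arr b ε) (x : P.State) (l : Fin n) :
    ∫ i, P.noise (serviceRate svc) ((∑ l, serviceRate svc l) - ε) x i l ∂inputLaw svc arr = 0 := by
  have h2 : Integrable (fun i : ℕ × (Fin n → ℕ) × unitInterval × unitInterval =>
      (i.2.1 l : ℝ) - serviceRate svc l) (inputLaw svc arr) :=
    (H.integrable_input_svc l).sub (integrable_const _)
  have e2 : ∫ i, ((i.2.1 l : ℝ) - serviceRate svc l) ∂inputLaw svc arr = 0 := by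
    rw [integral_sub (H.integrable_input_svc l) (integrable_const _), integral_input_svc]
    simp
  have h1 : Integrable (fun i : ℕ × (Fin n → ℕ) × unitInterval × unitInterval =>
      (i.1 : ℝ) - ((∑ l, serviceRate svc l) - ε)) (inputLaw svc arr) :=
    H.integrable_input_arr.sub (integrable_const _)
  have e1 : ∫ i, ((i.1 : ℝ) - ((∑ l, serviceRate svc l) - ε)) ∂inputLaw svc arr = 0 := by
    rw [integral_sub H.integrable_input_arr (integrable_const _), H.integral_input_arr]
    simp
  unfold Policy.noise
  split_ifs
  · rw [integral_sub h1 h2, e1, e2, sub_zero]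
  · rw [integral_sub (integrable_const _) h2, e2]
    simp

theorem Regime.integral_pairing_noise (H : Regime svc arr b ε) (θ : ℝ) (v : Fin n → ℝ)
    (x : P.State) :
    ∫ i, P.pairing θ v (P.noise (serviceRate svc) ((∑ l, serviceRate svc l) - ε) x i)
      ∂inputLaw svc arr = 0 := by
  unfold Policy.pairing
  rw [integral_finsetSum _ fun l _ => (H.integrable_noise P _ x l).const_mul _]
  simp_rw [integral_const_mul, H.integral_noise P, mul_zero, Finset.sum_const_zero]

theorem Regime.integrable_pairing_noise (H : Regime svc arr b ε) (θ r : ℝ) (v : Fin n → ℝ)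
    (x : P.State) :
    Integrable (fun i => P.pairing θ v (P.noise (serviceRate svc) r x i)) (inputLaw svc arr) :=
  integrable_finsetSum _ fun l _ => (H.integrable_noise P _ x l).const_mul _

theorem abs_noise_le {μ : Fin n → ℝ} {r : ℝ} (hμ : ∀ l, 0 ≤ μ l ∧ μ l ≤ b) (hr : 0 ≤ r ∧ r ≤ b)
    (x : P.State) {i : ℕ × (Fin n → ℕ) × unitInterval × unitInterval} (ha : (i.1 : ℝ) ≤ b)
    (hs : ∀ l, (i.2.1 l : ℝ) ≤ b) (l : Fin n) : |P.noise μ r x i l| ≤ 2 * b := by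
  have h1 := hμ l
  have h2 := hs l
  have h3 : (0 : ℝ) ≤ i.1 := Nat.cast_nonneg _
  have h4 : (0 : ℝ) ≤ i.2.1 l := Nat.cast_nonneg _
  unfold Policy.noise
  rw [abs_le]
  split_ifs <;> constructor <;> linarith

end Expectation

/-! ### The mean drift produced by a sorted decision. -/

theorem integral_prod_le_of_ae {α β : Type*} [MeasurableSpace α] [MeasurableSpace β]
    {μ : Measure α} {ν : Measure β} [IsProbabilityMeasure μ] [IsProbabilityMeasure ν]
    {F : α × β → ℝ} (hF : Integrable F (μ.prod ν)) {c : ℝ}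
    (h : ∀ᵐ x ∂μ, Integrable (fun y => F (x, y)) ν → ∫ y, F (x, y) ∂ν ≤ c) :
    ∫ z, F z ∂μ.prod ν ≤ c := by
  rw [integral_prod F hF]
  calc ∫ x, ∫ y, F (x, y) ∂ν ∂μ ≤ ∫ _, c ∂μ := by
        refine integral_mono_ae hF.integral_prod_left (integrable_const c) ?_
        filter_upwards [h, hF.prod_right_ae] with x h1 h2 using h1 h2
    _ = c := by simp

namespace Policy

variable {n : ℕ} (P : Policy n)

/-- The number of slots of a cycle whose arrivals are sent to server `l`. -/
noncomputable def slotCount (μ : Fin n → ℝ) (η : Equiv.Perm (Fin n)) (w : unitInterval)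
    (l : Fin n) : ℝ :=
  ((Finset.univ.filter fun j => P.Y η μ w j = l).card : ℝ)

theorem integrable_slotCount (μ : Fin n → ℝ) (η : Equiv.Perm (Fin n)) (l : Fin n) :
    Integrable (fun w => P.slotCount μ η w l) := by
  have hY : Measurable (P.Y η μ) := measurable_to_countable' fun d => P.Y_measurable η μ d
  refine Integrable.of_bound ((measurable_of_countable fun φ : Fin P.T → Fin n =>
    ((Finset.univ.filter fun j => φ j = l).card : ℝ)).comp hY).aestronglyMeasurable P.T ?_
  refine ae_of_all _ fun w => ?_
  change ‖P.slotCount μ η w l‖ ≤ _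
  rw [slotCount, Real.norm_natCast]
  exact_mod_cast (Finset.card_le_univ _).trans_eq (Fintype.card_fin _)

theorem integral_slotCount (μ : Fin n → ℝ) (η : Equiv.Perm (Fin n)) (l : Fin n) :
    ∫ w, P.slotCount μ η w (η l) = P.T * P.f μ η l := by
  have hT : (P.T : ℝ) ≠ 0 := by exact_mod_cast P.T_pos.ne'
  unfold f
  rw [integral_div, mul_div_cancel₀ _ hT]
  rfl

theorem f_nonneg (μ : Fin n → ℝ) (η : Equiv.Perm (Fin n)) (l : Fin n) : 0 ≤ P.f μ η l :=
  integral_nonneg fun w => by positivity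

theorem sum_f (μ : Fin n → ℝ) (η : Equiv.Perm (Fin n)) : ∑ l, P.f μ η l = 1 := by
  have hT : (P.T : ℝ) ≠ 0 := by exact_mod_cast P.T_pos.ne'
  have h1 : ∑ l, (P.T : ℝ) * P.f μ η l = P.T := by
    simp_rw [← integral_slotCount]
    rw [← integral_finsetSum _ fun l _ => P.integrable_slotCount μ η (η l)]
    have h2 : ∀ w, ∑ l, P.slotCount μ η w (η l) = P.T := by
      intro w
      rw [Equiv.sum_comp η (P.slotCount μ η w)]
      unfold slotCount
      rw [← Nat.cast_sum, ← Finset.card_eq_sum_card_fiberwise fun _ _ => Finset.mem_coe.2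
        (Finset.mem_univ _)]
      simp
    simp_rw [h2]
    simp
  rw [← Finset.mul_sum] at h1
  exact mul_left_cancel₀ hT (h1.trans (mul_one _).symm)

theorem remainingDrift_zero_eq (μ : Fin n → ℝ) (r : ℝ) (η : Equiv.Perm (Fin n))
    (w : unitInterval) (l : Fin n) :
    P.remainingDrift μ r (P.Y η μ w) 0 l = r * P.slotCount μ η w l - P.T * μ l := by
  unfold remainingDrift slotCount
  simp only [Nat.zero_le, if_true, Finset.sum_sub_distrib, Finset.sum_const, Finset.card_univ,
    Fintype.card_fin, nsmul_eq_mul]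
  rw [Finset.card_filter]
  push_cast
  rw [Finset.mul_sum]
  congr 1
  exact Finset.sum_congr rfl fun j _ => by split_ifs <;> simp

theorem integral_pairing_remainingDrift (μ : Fin n → ℝ) (θ r : ℝ) (v : Fin n → ℝ)
    (η : Equiv.Perm (Fin n)) :
    ∫ w, P.pairing θ v (P.remainingDrift μ r (P.Y η μ w) 0)
      = P.T * ∑ i, P.coeff θ v (η i) * (r * P.f μ η i - μ (η i)) := by
  unfold pairing
  simp_rw [remainingDrift_zero_eq]
  have hint : ∀ l, Integrable (fun w => P.coeff θ v l * (r * P.slotCount μ η w l - P.T * μ l)) :=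
    fun l => (((P.integrable_slotCount μ η l).const_mul r).sub (integrable_const _)).const_mul _
  rw [integral_finsetSum _ fun l _ => hint l, Finset.mul_sum, ← Equiv.sum_comp η]
  refine Finset.sum_congr rfl fun i _ => ?_
  rw [integral_const_mul, integral_sub ((P.integrable_slotCount μ η _).const_mul r)
    (integrable_const _), integral_const_mul, integral_slotCount]
  simp only [integral_const, probReal_univ, one_smul]
  ring

/-- A uniform version of the strict majorization condition. -/
theorem StrictMajorization.exists_gap {P : Policy n} {μ : Fin n → ℝ}
    (hP : P.StrictMajorization μ) (hμ : 0 < ∑ l, μ l) :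
    ∃ δ > 0, ∀ (η : Equiv.Perm (Fin n)) (m : ℕ), 1 ≤ m → m < n →
      (∑ l, μ l) * (∑ l : Fin n with l.val < m, P.f μ η l)
        - ∑ l : Fin n with l.val < m, μ (η l) ≤ -δ := by
  have h : ∀ᶠ δ in 𝓝[>] (0 : ℝ), ∀ p : Equiv.Perm (Fin n) × Fin n, 1 ≤ (p.2 : ℕ) →
      (∑ l, μ l) * (∑ l : Fin n with l.val < (p.2 : ℕ), P.f μ p.1 l)
        - ∑ l : Fin n with l.val < (p.2 : ℕ), μ (p.1 l) ≤ -δ := by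
    -- There are finitely many pairs `(η, m)`, so the strict inequalities share a positive gap.
    rw [eventually_all]
    intro p
    by_cases hp : 1 ≤ (p.2 : ℕ)
    · have h1 := hP p.1 p.2 hp p.2.isLt
      rw [Equiv.sum_comp p.1 μ, lt_div_iff₀ hμ] at h1
      have h2 : 0 < -((∑ l, μ l) * (∑ l : Fin n with l.val < (p.2 : ℕ), P.f μ p.1 l)
        - ∑ l : Fin n with l.val < (p.2 : ℕ), μ (p.1 l)) := by linarith
      filter_upwards [mem_nhdsWithin_of_mem_nhds (Iio_mem_nhds h2)] with δ hδ _
      have : δ < _ := hδ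
      linarith
    · exact Eventually.of_forall fun δ h => absurd h hp
  obtain ⟨δ, h1, h2⟩ := (h.and self_mem_nhdsWithin).exists
  exact ⟨δ, h2, fun η m hm hmn => h1 (η, ⟨m, hmn⟩) hm⟩

/-- Summation by parts with weights of total `-ε`. Lowering the arrival rate by `ε` only decreases
their partial sums since `f ≥ 0`, so the gap `δ` persists. The mean part of the coefficients is
constant and sees only the total. -/
theorem sorted_pairing_le (hn : 0 < n) {μ : Fin n → ℝ} {δ ε θ : ℝ} (hε : 0 ≤ ε)
    (hδ : ∀ (η : Equiv.Perm (Fin n)) (m : ℕ), 1 ≤ m → m < n →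
      (∑ l, μ l) * (∑ l : Fin n with l.val < m, P.f μ η l)
        - ∑ l : Fin n with l.val < m, μ (η l) ≤ -δ)
    {v : Fin n → ℝ} {η : Equiv.Perm (Fin n)} (hη : Antitone fun i => v (η i) / P.γ (η i)) :
    ∃ lo hi, (∀ l, lo ≤ v l / P.γ l ∧ v l / P.γ l ≤ hi) ∧
      ∑ i, P.coeff θ v (η i) * (((∑ l, μ l) - ε) * P.f μ η i - μ (η i))
        ≤ -δ * (hi - lo) - ε * lo + ε * (θ * ((∑ l, v l) / P.Γ)) := by
  obtain ⟨N, rfl⟩ : ∃ N, n = N + 1 := ⟨n - 1, by omega⟩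
  refine ⟨v (η (Fin.last N)) / P.γ (η (Fin.last N)), v (η 0) / P.γ (η 0), fun l => ?_, ?_⟩
  · have h1 := hη (Fin.le_last (η.symm l))
    have h2 := hη (Fin.zero_le (η.symm l))
    simp only [Equiv.apply_symm_apply] at h1 h2
    exact ⟨h1, h2⟩
  · have hs : ∑ i, (((∑ l, μ l) - ε) * P.f μ η i - μ (η i)) = -ε := by
      rw [Finset.sum_sub_distrib, ← Finset.mul_sum, sum_f, Equiv.sum_comp η μ]
      ring
    have hc : ∀ m, 1 ≤ m → m < N + 1 →
        ∑ i : Fin (N + 1) with i.val < m, (((∑ l, μ l) - ε) * P.f μ η i - μ (η i)) ≤ -δ := by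
      intro m h1 h2
      have h3 := hδ η m h1 h2
      have h4 : 0 ≤ ∑ l : Fin (N + 1) with l.val < m, P.f μ η l :=
        Finset.sum_nonneg fun l _ => P.f_nonneg μ η l
      rw [Finset.sum_sub_distrib, ← Finset.mul_sum]
      nlinarith
    have h := sum_antitone_mul_le hη hc hs
    have e : ∑ i, P.coeff θ v (η i) * (((∑ l, μ l) - ε) * P.f μ η i - μ (η i))
        = ∑ i, v (η i) / P.γ (η i) * (((∑ l, μ l) - ε) * P.f μ η i - μ (η i))
          - (θ * ((∑ l, v l) / P.Γ)) * ∑ i, (((∑ l, μ l) - ε) * P.f μ η i - μ (η i)) := by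
      rw [Finset.mul_sum, ← Finset.sum_sub_distrib]
      exact Finset.sum_congr rfl fun i _ => by unfold coeff; ring
    rw [e, hs]
    linarith

theorem sum_div_Γ_le (hn : 0 < n) {v : Fin n → ℝ} {hi : ℝ} (h : ∀ l, v l / P.γ l ≤ hi) :
    (∑ l, v l) / P.Γ ≤ hi := by
  rw [div_le_iff₀ (P.Γ_pos hn), Γ, Finset.mul_sum]
  exact Finset.sum_le_sum fun l _ => (div_le_iff₀ (P.γ_pos' l)).1 (h l)

/-- As `ε ≤ δ`, `-δ (hi - lo) - ε lo ≤ -ε hi`, and `hi` is at least the weighted mean. This drift is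
of order `ε` times the total queue, enough for stability at fixed `ε`. -/
theorem sorted_pairing_zero_le (hn : 0 < n) {μ : Fin n → ℝ} {δ ε : ℝ} (hε : 0 ≤ ε)
    (hεδ : ε ≤ δ)
    (hδ : ∀ (η : Equiv.Perm (Fin n)) (m : ℕ), 1 ≤ m → m < n →
      (∑ l, μ l) * (∑ l : Fin n with l.val < m, P.f μ η l)
        - ∑ l : Fin n with l.val < m, μ (η l) ≤ -δ)
    {v : Fin n → ℝ} {η : Equiv.Perm (Fin n)} (hη : Antitone fun i => v (η i) / P.γ (η i)) :
    ∑ i, P.coeff 0 v (η i) * (((∑ l, μ l) - ε) * P.f μ η i - μ (η i))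
      ≤ -(ε * ((∑ l, v l) / P.Γ)) := by
  obtain ⟨lo, hi, h1, h2⟩ := P.sorted_pairing_le (θ := 0) hn hε hδ hη
  have h3 := P.sum_div_Γ_le hn fun l => (h1 l).2
  have h4 : lo ≤ hi := (h1 ⟨0, hn⟩).1.trans (h1 ⟨0, hn⟩).2
  nlinarith

/-- The mean exceeds `lo` by at most the spread, so the term of order `ε` is absorbed by half of
`δ`. The remaining rate does not depend on `ε`, which makes the collapse uniform. -/
theorem sorted_pairing_one_le (hn : 0 < n) {μ : Fin n → ℝ} {δ ε : ℝ} (hε : 0 ≤ ε)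
    (hεδ : ε ≤ δ / 2)
    (hδ : ∀ (η : Equiv.Perm (Fin n)) (m : ℕ), 1 ≤ m → m < n →
      (∑ l, μ l) * (∑ l : Fin n with l.val < m, P.f μ η l)
        - ∑ l : Fin n with l.val < m, μ (η l) ≤ -δ)
    {v : Fin n → ℝ} {η : Equiv.Perm (Fin n)} (hη : Antitone fun i => v (η i) / P.γ (η i)) :
    ∑ i, P.coeff 1 v (η i) * (((∑ l, μ l) - ε) * P.f μ η i - μ (η i))
      ≤ -(δ / 2 * √(P.pairing 1 v v / P.Γ)) := by
  obtain ⟨lo, hi, h1, h2⟩ := P.sorted_pairing_le (θ := 1) hn hε hδ hη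
  have h3 := P.sum_div_Γ_le hn fun l => (h1 l).2
  have h4 : lo ≤ hi := (h1 ⟨0, hn⟩).1.trans (h1 ⟨0, hn⟩).2
  have h5 : √(P.pairing 1 v v / P.Γ) ≤ hi - lo := by
    rw [Real.sqrt_le_left (by linarith), div_le_iff₀ (P.Γ_pos hn), mul_comm]
    exact P.pairing_one_self_le_spread hn (fun l => (h1 l).1) fun l => (h1 l).2
  have h6 : 0 ≤ √(P.pairing 1 v v / P.Γ) := Real.sqrt_nonneg _
  nlinarith

end Policy

/-! ### One-step drift of the quadratic forms at the forecast. -/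

section Drift

variable {n : ℕ} (P : Policy n) {svc : Measure (Fin n → ℕ)} [IsProbabilityMeasure svc]
  {arr : Measure ℕ} [IsProbabilityMeasure arr] {b ε : ℝ}

/-- The mean effect of a newly drawn decision vector. -/
theorem Regime.integral_pairing_renewedDrift_le (H : Regime svc arr b ε) (θ r c : ℝ)
    {x : P.State} (hx : ¬ (x.2.2 : ℕ) + 1 < P.T)
    (hc : ∀ (a : ℕ) (s : Fin n → ℕ), (a : ℝ) ≤ b → (∀ l, (s l : ℝ) ≤ b) →
      ∀ η : Equiv.Perm (Fin n),
        (Antitone fun i => (P.nextQueue x a s (η i) : ℝ) / P.γ (η i)) →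
        ∑ i, P.coeff θ (fun l => (P.nextQueue x a s l : ℝ)) (η i)
          * (r * P.f (serviceRate svc) η i - serviceRate svc (η i)) ≤ -c) :
    ∫ i, P.pairing θ (fun l => ((P.step (serviceRate svc) x i).1 l : ℝ))
        (P.renewedDrift (serviceRate svc) r (P.step (serviceRate svc) x i)) ∂inputLaw svc arr
      ≤ -(P.T * c) := by
  have hint := H.integrable_step P (fun y => P.pairing θ (fun l => (y.1 l : ℝ))
    (P.renewedDrift (serviceRate svc) r y)) x
  refine integral_prod_le_of_ae hint ?_
  filter_upwards [H.arr_le] with a ha h1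
  refine integral_prod_le_of_ae h1 ?_
  filter_upwards [H.svc_le] with s hs h2
  -- With `a`, `s`, `v` fixed, the sampled queues and their order are fixed; averaging over `w`
  -- turns slot counts into `f`.
  refine integral_prod_le_of_ae h2 (ae_of_all _ fun v _ => ?_)
  simp only [Policy.step_of_not_lt P _ hx, Policy.renewedDrift, Policy.decision]
  rw [Policy.integral_pairing_remainingDrift, ← mul_neg]
  refine mul_le_mul_of_nonneg_left (hc a s ha hs _ ?_) (Nat.cast_nonneg _)
  have h3 := P.L_sorted (fun l => (P.nextQueue x a s l : ℝ≥0) / P.γ l) v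
  intro i j hij
  have h4 := h3 hij
  exact_mod_cast h4

/-- The constant of the quadratic drift inequality. -/
noncomputable def Policy.driftBound (b : ℝ) : ℝ := P.formBound * (4 * (P.T + 3) ^ 2 * b ^ 2)

theorem Policy.driftBound_nonneg (b : ℝ) : 0 ≤ P.driftBound b := by
  have := P.formBound_nonneg
  unfold Policy.driftBound
  positivity

/-- The increment of the forecast in a step. -/
noncomputable def Policy.increment (μ : Fin n → ℝ) (r : ℝ) (x : P.State)
    (i : ℕ × (Fin n → ℕ) × unitInterval × unitInterval) : Fin n → ℝ :=
  P.noise μ r x i + P.unused x i + P.forecastShift μ r x i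

theorem abs_increment_le {μ : Fin n → ℝ} {r : ℝ} (hμ : ∀ l, 0 ≤ μ l ∧ μ l ≤ b)
    (hr : 0 ≤ r ∧ r ≤ b) (x : P.State) {i : ℕ × (Fin n → ℕ) × unitInterval × unitInterval}
    (ha : (i.1 : ℝ) ≤ b) (hs : ∀ l, (i.2.1 l : ℝ) ≤ b) (l : Fin n) :
    |P.increment μ r x i l| ≤ (P.T + 3) * b := by
  have hb : 0 ≤ b := hr.1.trans hr.2
  have h1 := abs_noise_le P hμ hr x ha hs l
  have h2 : |P.unused x i l| ≤ b := by
    rw [abs_of_nonneg (P.unused_nonneg x i l)]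
    exact (P.unused_le x i l).trans (hs l)
  have h3 : |P.forecastShift μ r x i l| ≤ P.T * b := by
    unfold Policy.forecastShift
    split_ifs
    · simp only [Pi.zero_apply, abs_zero]; positivity
    · exact P.abs_remainingDrift_le hμ hr _ _ _
  have h4 := abs_add_le (P.noise μ r x i l + P.unused x i l) (P.forecastShift μ r x i l)
  have h5 := abs_add_le (P.noise μ r x i l) (P.unused x i l)
  simp only [Policy.increment, Pi.add_apply]
  linarith

/-- Expand the square. Unused service costs a constant, because `Q_l u_l ≤ S_l²` and the subtracted
rank-one term has the favourable sign. In the renewal term the forecast may be replaced by the new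
queue vector, which is within bounded distance. -/
theorem quadratic_increment_le {θ : ℝ} (h0 : 0 ≤ θ) (h1 : θ ≤ 1) {μ : Fin n → ℝ} {r : ℝ}
    (hμ : ∀ l, 0 ≤ μ l ∧ μ l ≤ b) (hr : 0 ≤ r ∧ r ≤ b) (x : P.State)
    {i : ℕ × (Fin n → ℕ) × unitInterval × unitInterval}
    (ha : (i.1 : ℝ) ≤ b) (hs : ∀ l, (i.2.1 l : ℝ) ≤ b) :
    P.pairing θ (P.forecast μ r (P.step μ x i)) (P.forecast μ r (P.step μ x i))
      ≤ P.pairing θ (P.forecast μ r x) (P.forecast μ r x)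
        + 2 * P.pairing θ (P.forecast μ r x) (P.noise μ r x i)
        + 2 * (if (x.2.2 : ℕ) + 1 < P.T then 0 else
            P.pairing θ (fun l => ((P.step μ x i).1 l : ℝ)) (P.renewedDrift μ r (P.step μ x i)))
        + P.driftBound b := by
  have hb : 0 ≤ b := hr.1.trans hr.2
  have hT : (0 : ℝ) ≤ P.T := Nat.cast_nonneg _
  have hF := P.formBound_nonneg
  set X := P.forecast μ r x with hX
  have hrd : ∀ l, |P.remainingDrift μ r x.2.1 x.2.2 l| ≤ P.T * b :=
    P.abs_remainingDrift_le hμ hr _ _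
  have hu : ∀ l, |P.unused x i l| ≤ b := fun l => by
    rw [abs_of_nonneg (P.unused_nonneg x i l)]
    exact (P.unused_le x i l).trans (hs l)
  have hdd : P.pairing θ (P.increment μ r x i) (P.increment μ r x i)
      ≤ P.formBound * (((P.T + 3) * b) * ((P.T + 3) * b)) :=
    (le_abs_self _).trans (P.abs_pairing_le h0 h1 (by positivity)
      (abs_increment_le P hμ hr x ha hs) (abs_increment_le P hμ hr x ha hs))
  have hXu : P.pairing θ X (P.unused x i) ≤ P.formBound * (b * b)
      + P.formBound * (P.T * b * b) := by
    rw [hX, Policy.forecast, Policy.pairing_add_left]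
    refine add_le_add ?_ ((le_abs_self _).trans
      (P.abs_pairing_le h0 h1 (by positivity) hrd hu))
    rw [Policy.pairing_eq]
    have hΓ := P.Γ_nonneg
    have e1 : 0 ≤ θ * ((∑ l, (x.1 l : ℝ)) * (∑ l, P.unused x i l) / P.Γ) := by
      have : 0 ≤ ∑ l, (x.1 l : ℝ) := Finset.sum_nonneg fun l _ => Nat.cast_nonneg _
      have : 0 ≤ ∑ l, P.unused x i l := Finset.sum_nonneg fun l _ => P.unused_nonneg x i l
      positivity
    have e2 : ∑ l, (x.1 l : ℝ) * P.unused x i l / P.γ l ≤ (∑ l, 1 / (P.γ l : ℝ)) * (b * b) := by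
      rw [Finset.sum_mul]
      refine Finset.sum_le_sum fun l _ => ?_
      have := P.γ_pos' l
      rw [one_div_mul_eq_div]
      refine div_le_div_of_nonneg_right ((P.queue_mul_unused_le x i l).trans ?_) this.le
      exact mul_le_mul (hs l) (hs l) (Nat.cast_nonneg _) hb
    have e3 : (∑ l, 1 / (P.γ l : ℝ)) * (b * b) ≤ P.formBound * (b * b) := by
      unfold Policy.formBound
      have : 0 ≤ (n : ℝ) ^ 2 / P.Γ := by positivity
      gcongr
      linarith
    linarith
  have hXs : P.pairing θ X (P.forecastShift μ r x i)
      ≤ (if (x.2.2 : ℕ) + 1 < P.T then 0 else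
            P.pairing θ (fun l => ((P.step μ x i).1 l : ℝ)) (P.renewedDrift μ r (P.step μ x i)))
        + P.formBound * ((P.T + 1) * b * (P.T * b)) := by
    unfold Policy.forecastShift
    split_ifs
    · simp only [Policy.pairing, Pi.zero_apply, mul_zero, Finset.sum_const_zero, zero_add]
      positivity
    · have e1 : X = (fun l => ((P.step μ x i).1 l : ℝ))
          + (X - fun l => ((P.step μ x i).1 l : ℝ)) := by
        rw [add_sub_cancel]
      have e2 : ∀ l, |(X - fun l => ((P.step μ x i).1 l : ℝ)) l| ≤ (P.T + 1) * b := by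
        intro l
        have h3 := P.abs_nextQueue_sub_le x i ha hs l
        have h4 := hrd l
        rw [step_fst, hX]
        simp only [Policy.forecast, Pi.sub_apply, Pi.add_apply]
        rw [abs_le] at h3 h4 ⊢
        constructor <;> linarith
      nth_rewrite 1 [e1]
      rw [Policy.pairing_add_left]
      exact add_le_add le_rfl ((le_abs_self _).trans (P.abs_pairing_le h0 h1 (by positivity) e2
        (P.abs_remainingDrift_le hμ hr _ _)))
  rw [Policy.forecast_step, Policy.pairing_add_self, Policy.pairing_add_right,
    Policy.pairing_add_right]
  change _ + P.pairing θ (P.increment μ r x i) (P.increment μ r x i) ≤ _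
  have hfin : P.formBound * (((P.T + 3) * b) * ((P.T + 3) * b))
      + 2 * (P.formBound * (b * b) + P.formBound * (P.T * b * b))
      + 2 * (P.formBound * ((P.T + 1) * b * (P.T * b))) ≤ P.driftBound b := by
    unfold Policy.driftBound
    -- The slack: the last factor is `4 (T + 3)² - (3 T² + 10 T + 11)`.
    have : 0 ≤ P.formBound * b ^ 2 * (P.T ^ 2 + 14 * P.T + 25) := by positivity
    nlinarith
  linarith

/-- The drift of the quadratic function of the forecast. -/
theorem Regime.quadratic_drift (H : Regime svc arr b ε) {θ : ℝ} (h0 : 0 ≤ θ) (h1 : θ ≤ 1)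
    {r : ℝ} (hr : r = (∑ l, serviceRate svc l) - ε) (x : P.State) {c : ℝ}
    (hc : ¬ (x.2.2 : ℕ) + 1 < P.T →
      ∀ (a : ℕ) (s : Fin n → ℕ), (a : ℝ) ≤ b → (∀ l, (s l : ℝ) ≤ b) →
      ∀ η : Equiv.Perm (Fin n),
        (Antitone fun i => (P.nextQueue x a s (η i) : ℝ) / P.γ (η i)) →
        ∑ i, P.coeff θ (fun l => (P.nextQueue x a s l : ℝ)) (η i)
          * (r * P.f (serviceRate svc) η i - serviceRate svc (η i)) ≤ -c) :
    ∫ i, P.pairing θ (P.forecast (serviceRate svc) r (P.step (serviceRate svc) x i))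
        (P.forecast (serviceRate svc) r (P.step (serviceRate svc) x i)) ∂inputLaw svc arr
      ≤ P.pairing θ (P.forecast (serviceRate svc) r x) (P.forecast (serviceRate svc) r x)
        + P.driftBound b - (if (x.2.2 : ℕ) + 1 < P.T then 0 else 2 * P.T * c) := by
  set μ := serviceRate svc with hμ
  have hmem := H.arrivalRate_mem
  rw [← hμ, ← hr] at hmem
  have hI1 := H.integrable_step P (fun y => P.pairing θ (P.forecast μ r y) (P.forecast μ r y)) x
  have hI2 : Integrable (fun i => P.pairing θ (P.forecast μ r x) (P.noise μ r x i))
      (inputLaw svc arr) := H.integrable_pairing_noise P θ r _ x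
  have hI3 := H.integrable_step P (fun y => if (x.2.2 : ℕ) + 1 < P.T then 0 else
    P.pairing θ (fun l => (y.1 l : ℝ)) (P.renewedDrift μ r y)) x
  have hA : Integrable (fun i => P.pairing θ (P.forecast μ r x) (P.forecast μ r x)
      + 2 * P.pairing θ (P.forecast μ r x) (P.noise μ r x i)) (inputLaw svc arr) :=
    (integrable_const _).add (hI2.const_mul 2)
  have hB : Integrable (fun i => P.pairing θ (P.forecast μ r x) (P.forecast μ r x)
      + 2 * P.pairing θ (P.forecast μ r x) (P.noise μ r x i)
      + 2 * (if (x.2.2 : ℕ) + 1 < P.T then 0 else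
            P.pairing θ (fun l => ((P.step μ x i).1 l : ℝ)) (P.renewedDrift μ r (P.step μ x i))))
      (inputLaw svc arr) := hA.add (hI3.const_mul 2)
  have hle : ∫ i, P.pairing θ (P.forecast μ r (P.step μ x i)) (P.forecast μ r (P.step μ x i))
      ∂inputLaw svc arr ≤ ∫ i, (P.pairing θ (P.forecast μ r x) (P.forecast μ r x)
      + 2 * P.pairing θ (P.forecast μ r x) (P.noise μ r x i)
      + 2 * (if (x.2.2 : ℕ) + 1 < P.T then 0 else
            P.pairing θ (fun l => ((P.step μ x i).1 l : ℝ)) (P.renewedDrift μ r (P.step μ x i)))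
      + P.driftBound b) ∂inputLaw svc arr := by
    refine integral_mono_ae hI1 (hB.add (integrable_const _)) ?_
    filter_upwards [H.ae_arr_le, H.ae_svc_le] with i ha hs
    exact quadratic_increment_le P h0 h1 H.serviceRate_mem hmem x ha hs
  refine hle.trans ?_
  rw [integral_add hB (integrable_const _), integral_add hA (hI3.const_mul 2),
    integral_add (integrable_const _) (hI2.const_mul 2), integral_const_mul, integral_const_mul]
  have hz : ∫ i, P.pairing θ (P.forecast μ r x) (P.noise μ r x i) ∂inputLaw svc arr = 0 := by
    rw [hr]; exact H.integral_pairing_noise P θ _ x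
  rw [hz]
  simp only [integral_const, probReal_univ, one_smul]
  split_ifs with hx
  · simp
  · have := H.integral_pairing_renewedDrift_le P θ r c hx (hc hx)
    rw [← hμ] at this
    linarith

end Drift

/-! ### Stability and finite mean queue lengths at fixed `ε`. -/

section Stability

variable {n : ℕ} (P : Policy n) {svc : Measure (Fin n → ℕ)} [IsProbabilityMeasure svc]
  {arr : Measure ℕ} [IsProbabilityMeasure arr] {b ε : ℝ}

theorem Regime.markovOp_add_le (H : Regime svc arr b ε) {V g : P.State → ℝ} {C : ℝ}
    (hV : ∀ x, 0 ≤ V x) (hg : ∀ x, 0 ≤ g x) (hC : 0 ≤ C)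
    (h : ∀ x, ∫ i, V (P.step (serviceRate svc) x i) ∂inputLaw svc arr + g x ≤ V x + C)
    (x : P.State) :
    markovOp (P.kernel svc arr) (fun y => ENNReal.ofReal (V y)) x + ENNReal.ofReal (g x)
      ≤ ENNReal.ofReal (V x) + ENNReal.ofReal C := by
  rw [markovOp_kernel, ← ofReal_integral_eq_lintegral_ofReal (H.integrable_step P V x)
    (ae_of_all _ fun i => hV _), ← ENNReal.ofReal_add (integral_nonneg fun i => hV _) (hg x),
    ← ENNReal.ofReal_add (hV x) hC]
  exact ENNReal.ofReal_le_ofReal (h x)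

theorem sum_nextQueue_le (x : P.State) (i : ℕ × (Fin n → ℕ) × unitInterval × unitInterval)
    (ha : (i.1 : ℝ) ≤ b) :
    ∑ l, ((P.nextQueue x i.1 i.2.1 l : ℕ) : ℝ) ≤ ∑ l, (x.1 l : ℝ) + b := by
  have h1 : ∀ l, ((P.nextQueue x i.1 i.2.1 l : ℕ) : ℝ)
      ≤ x.1 l + if x.2.1 x.2.2 = l then (i.1 : ℝ) else 0 := by
    intro l
    have : P.nextQueue x i.1 i.2.1 l ≤ x.1 l + if x.2.1 x.2.2 = l then i.1 else 0 :=
      Nat.sub_le _ _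
    exact_mod_cast this
  have h2 := Finset.sum_le_sum fun l (_ : l ∈ Finset.univ) => h1 l
  rw [Finset.sum_add_distrib] at h2
  simp only [Finset.sum_ite_eq, Finset.mem_univ, if_true] at h2
  linarith

/-- The number of slots of the current cycle after the present one. -/
noncomputable def Policy.slotsLeft (x : P.State) : ℝ := (P.T : ℝ) - 1 - (x.2.2 : ℕ)

theorem Policy.slotsLeft_nonneg (x : P.State) : 0 ≤ P.slotsLeft x := by
  have h : (x.2.2 : ℕ) + 1 ≤ P.T := x.2.2.isLt
  have h' : ((x.2.2 : ℕ) : ℝ) + 1 ≤ P.T := by exact_mod_cast h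
  unfold Policy.slotsLeft
  linarith

theorem Policy.slotsLeft_le (x : P.State) : P.slotsLeft x ≤ P.T := by
  have : (0 : ℝ) ≤ (x.2.2 : ℕ) := Nat.cast_nonneg _
  unfold Policy.slotsLeft
  linarith

theorem Policy.slotsLeft_step_of_lt (μ : Fin n → ℝ) {x : P.State} (h : (x.2.2 : ℕ) + 1 < P.T)
    (i : ℕ × (Fin n → ℕ) × unitInterval × unitInterval) :
    P.slotsLeft (P.step μ x i) = P.slotsLeft x - 1 := by
  rw [P.step_of_lt μ h]
  simp only [Policy.slotsLeft]
  push_cast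
  ring

theorem Policy.slotsLeft_step_of_not_lt (μ : Fin n → ℝ) {x : P.State}
    (h : ¬ (x.2.2 : ℕ) + 1 < P.T) (i : ℕ × (Fin n → ℕ) × unitInterval × unitInterval) :
    P.slotsLeft (P.step μ x i) = P.T - 1 := by
  rw [P.step_of_not_lt μ h]
  simp [Policy.slotsLeft]

theorem Policy.slotsLeft_of_not_lt {x : P.State} (h : ¬ (x.2.2 : ℕ) + 1 < P.T) :
    P.slotsLeft x = 0 := by
  have h1 : (x.2.2 : ℕ) + 1 = P.T := by have := x.2.2.isLt; omega
  have h2 : ((x.2.2 : ℕ) : ℝ) + 1 = P.T := by exact_mod_cast h1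
  unfold Policy.slotsLeft
  linarith

/-- A Foster–Lyapunov drift with rate proportional to the total queue length. -/
theorem Regime.exists_queue_drift (H : Regime svc arr b ε) (hn : 0 < n) (hε : 0 < ε) {δ : ℝ}
    (hεδ : ε ≤ δ)
    (hδ : ∀ (η : Equiv.Perm (Fin n)) (m : ℕ), 1 ≤ m → m < n →
      (∑ l, serviceRate svc l) * (∑ l : Fin n with l.val < m, P.f (serviceRate svc) η l)
        - ∑ l : Fin n with l.val < m, serviceRate svc (η l) ≤ -δ) :
    ∃ (V : P.State → ℝ) (β C : ℝ), (∀ x, 0 ≤ V x) ∧ 0 < β ∧ 0 ≤ C ∧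
      ∀ x, ∫ i, V (P.step (serviceRate svc) x i) ∂inputLaw svc arr + β * ∑ l, (x.1 l : ℝ)
        ≤ V x + C := by
  have hΓ := P.Γ_pos hn
  have hb := H.b_nonneg
  have hD := P.driftBound_nonneg b
  have hT : (1 : ℝ) ≤ P.T := by exact_mod_cast P.T_pos
  set r := (∑ l, serviceRate svc l) - ε with hr
  set β := ε / P.Γ with hβ
  have hβ0 : 0 < β := by positivity
  set W : P.State → ℝ := fun x => P.pairing 0 (P.forecast (serviceRate svc) r x) (P.forecast (serviceRate svc) r x) with hW
  set S : P.State → ℝ := fun x => ∑ l, (x.1 l : ℝ) with hS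
  have hS0 : ∀ x, 0 ≤ S x := fun x => Finset.sum_nonneg fun l _ => Nat.cast_nonneg _
  -- Up to constants `W` decreases only at the end of a cycle, by `2 T β S`. The second term pays
  -- out `β S` in each earlier slot and is refilled at the end at a cost of `(T - 1) β S`.
  refine ⟨fun x => W x + β * (P.slotsLeft x * S x), β,
    P.driftBound b + 2 * P.T * (β * (n * b)) + β * (P.T * b), fun x => ?_, hβ0, by positivity,
    fun x => ?_⟩
  · have := P.pairing_zero_self_nonneg (P.forecast (serviceRate svc) r x)
    have := P.slotsLeft_nonneg x
    have := hS0 x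
    positivity
  · have hd := H.quadratic_drift P (θ := 0) le_rfl zero_le_one hr x
      (c := β * (S x - n * b)) (by
        intro _ a s ha hs η hη
        refine (P.sorted_pairing_zero_le (μ := serviceRate svc) hn hε.le hεδ hδ hη).trans ?_
        have h1 : S x - n * b ≤ ∑ l, ((P.nextQueue x a s l : ℕ) : ℝ) := by
          have h2 : ∀ l, (x.1 l : ℝ) - b ≤ ((P.nextQueue x a s l : ℕ) : ℝ) := fun l => by
            have := P.abs_nextQueue_sub_le x (a, s, 0, 0) ha hs l
            linarith [(abs_le.1 this).1]
          calc S x - n * b = ∑ l, ((x.1 l : ℝ) - b) := by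
                rw [Finset.sum_sub_distrib]; simp [hS]
            _ ≤ _ := Finset.sum_le_sum fun l _ => h2 l
        rw [neg_le_neg_iff, hβ, div_mul_eq_mul_div, ← mul_div_assoc]
        gcongr)
    have hI1 := H.integrable_step P W x
    have hI2 := H.integrable_step P (fun y => P.slotsLeft y * S y) x
    have hIS := H.integrable_step P S x
    have hle : ∫ i, S (P.step (serviceRate svc) x i) ∂inputLaw svc arr ≤ S x + b := by
      calc _ ≤ ∫ _, (S x + b) ∂inputLaw svc arr := by
            refine integral_mono_ae hIS (integrable_const _) ?_
            filter_upwards [H.ae_arr_le] with i ha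
            simp only [hS, step_fst]
            exact sum_nextQueue_le P x i ha
        _ = _ := by simp
    rw [integral_add hI1 (hI2.const_mul β), integral_const_mul]
    have hx0 := hS0 x
    by_cases hx : (x.2.2 : ℕ) + 1 < P.T
    · rw [if_pos hx, sub_zero] at hd
      simp only [P.slotsLeft_step_of_lt (serviceRate svc) hx]
      rw [integral_const_mul]
      have h1 : 0 ≤ P.slotsLeft x - 1 := by
        rw [← P.slotsLeft_step_of_lt (serviceRate svc) hx (0, 0, 0, 0)]
        exact P.slotsLeft_nonneg _
      have h2 := mul_le_mul_of_nonneg_left hle h1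
      have h3 : (P.slotsLeft x - 1) * b ≤ P.T * b := by
        have := P.slotsLeft_le x
        gcongr
        linarith
      have h4 : β * ((P.slotsLeft x - 1) * ∫ i, S (P.step (serviceRate svc) x i) ∂inputLaw svc arr)
          ≤ β * ((P.slotsLeft x - 1) * S x + P.T * b) := by
        gcongr
        linarith
      have h5 : 0 ≤ 2 * P.T * (β * (n * b)) := by positivity
      simp only [hW] at hd ⊢
      simp only [hS] at h4 ⊢
      linarith
    · rw [if_neg hx] at hd
      simp only [P.slotsLeft_step_of_not_lt (serviceRate svc) hx, P.slotsLeft_of_not_lt hx]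
      rw [integral_const_mul]
      have h2 : ((P.T : ℝ) - 1) * ∫ i, S (P.step (serviceRate svc) x i) ∂inputLaw svc arr
          ≤ P.T * S x + P.T * b - S x := by
        have h3 := mul_le_mul_of_nonneg_left hle (sub_nonneg.2 hT)
        linarith
      have h4 := mul_le_mul_of_nonneg_left h2 hβ0.le
      have h5 : 0 ≤ P.T * (β * S x) := by positivity
      simp only [hW] at hd ⊢
      simp only [hS] at h4 h5 hd ⊢
      linarith

theorem Regime.exists_steadyState (H : Regime svc arr b ε) (hn : 0 < n) (hε : 0 < ε) {δ : ℝ}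
    (hεδ : ε ≤ δ)
    (hδ : ∀ (η : Equiv.Perm (Fin n)) (m : ℕ), 1 ≤ m → m < n →
      (∑ l, serviceRate svc l) * (∑ l : Fin n with l.val < m, P.f (serviceRate svc) η l)
        - ∑ l : Fin n with l.val < m, serviceRate svc (η l) ≤ -δ) :
    ∃ ρ, P.IsSteadyState svc arr ρ := by
  obtain ⟨V, β, C, hV, hβ, hC, hd⟩ := H.exists_queue_drift P hn hε hεδ hδ
  have hS0 : ∀ x : P.State, 0 ≤ ∑ l, (x.1 l : ℝ) :=
    fun x => Finset.sum_nonneg fun l _ => Nat.cast_nonneg _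
  refine exists_invariant_of_drift (P.kernel svc arr)
    ((0, fun _ => ⟨0, hn⟩, ⟨0, P.T_pos⟩) : P.State) ENNReal.ofReal_ne_top ENNReal.ofReal_ne_top
    (H.markovOp_add_le P hV (fun x => mul_nonneg hβ.le (hS0 x)) hC hd) fun R => ?_
  refine (finite_setOf_queue_le P fun _ => ⌈(R : ℝ) / β⌉₊).subset fun x hx l => ?_
  simp only [Set.mem_ofPred_eq] at hx
  rw [← ENNReal.ofReal_natCast, ENNReal.ofReal_le_ofReal_iff (by positivity)] at hx
  have h1 : (x.1 l : ℝ) ≤ ∑ l, (x.1 l : ℝ) :=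
    Finset.single_le_sum (f := fun l => (x.1 l : ℝ)) (fun m _ => Nat.cast_nonneg _)
      (Finset.mem_univ l)
  have h2 : (x.1 l : ℝ) ≤ R / β := by
    rw [le_div_iff₀ hβ, mul_comm]
    exact (mul_le_mul_of_nonneg_left h1 hβ.le).trans hx
  exact_mod_cast h2.trans (Nat.le_ceil _)

theorem Policy.meanTotalQueue_eq (ρ : Measure P.State) :
    P.meanTotalQueue ρ = ∫⁻ x, ENNReal.ofReal (∑ l, (x.1 l : ℝ)) ∂ρ := by
  refine lintegral_congr fun x => ?_
  rw [ENNReal.ofReal_sum_of_nonneg fun l _ => Nat.cast_nonneg _]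
  simp

theorem Regime.meanTotalQueue_lt_top (H : Regime svc arr b ε) (hn : 0 < n) (hε : 0 < ε) {δ : ℝ}
    (hεδ : ε ≤ δ)
    (hδ : ∀ (η : Equiv.Perm (Fin n)) (m : ℕ), 1 ≤ m → m < n →
      (∑ l, serviceRate svc l) * (∑ l : Fin n with l.val < m, P.f (serviceRate svc) η l)
        - ∑ l : Fin n with l.val < m, serviceRate svc (η l) ≤ -δ)
    {ρ : Measure P.State} (hρ : P.IsSteadyState svc arr ρ) : P.meanTotalQueue ρ < ∞ := by
  have := hρ.1
  obtain ⟨V, β, C, hV, hβ, hC, hd⟩ := H.exists_queue_drift P hn hε hεδ hδ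
  have hS0 : ∀ x : P.State, 0 ≤ ∑ l, (x.1 l : ℝ) :=
    fun x => Finset.sum_nonneg fun l _ => Nat.cast_nonneg _
  have h1 := lintegral_le_of_drift hρ.2 (h := fun _ => ENNReal.ofReal C)
    (fun _ => ENNReal.ofReal_ne_top)
    (H.markovOp_add_le P hV (fun x => mul_nonneg hβ.le (hS0 x)) hC hd)
  simp_rw [ENNReal.ofReal_mul hβ.le] at h1
  rw [lintegral_const_mul _ (measurable_of_countable _), ← P.meanTotalQueue_eq] at h1
  rw [lt_top_iff_ne_top]
  intro htop
  rw [htop, ENNReal.mul_top (by simpa using hβ)] at h1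
  simp at h1

end Stability

/-! ### State space collapse. -/

section Collapse

variable {n : ℕ} (P : Policy n) {svc : Measure (Fin n → ℕ)} [IsProbabilityMeasure svc] {b : ℝ}

/-- The square of the change of the quadratic function in a step. -/
theorem sq_quadratic_sub_le (hn : 0 < n) {μ : Fin n → ℝ} {r : ℝ}
    (hμ : ∀ l, 0 ≤ μ l ∧ μ l ≤ b) (hr : 0 ≤ r ∧ r ≤ b) (x : P.State)
    {i : ℕ × (Fin n → ℕ) × unitInterval × unitInterval}
    (ha : (i.1 : ℝ) ≤ b) (hs : ∀ l, (i.2.1 l : ℝ) ≤ b) :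
    (P.pairing 1 (P.forecast μ r (P.step μ x i)) (P.forecast μ r (P.step μ x i))
        - P.pairing 1 (P.forecast μ r x) (P.forecast μ r x)) ^ 2
      ≤ (8 * (P.formBound * ((P.T + 3) * b) ^ 2) + 2 * (P.formBound * ((P.T + 3) * b) ^ 2) ^ 2)
        * (P.pairing 1 (P.forecast μ r x) (P.forecast μ r x) + 1) := by
  have hb : 0 ≤ b := hr.1.trans hr.2
  have hF := P.formBound_nonneg
  have hinc := abs_increment_le P hμ hr x ha hs
  set X := P.forecast μ r x
  set d := P.increment μ r x i with hd
  have hV := P.pairing_one_self_nonneg hn X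
  have h1 := P.pairing_one_sq_le hn X d hinc
  have h2 : P.pairing 1 d d ≤ P.formBound * ((P.T + 3) * b) ^ 2 := by
    rw [pow_two]
    exact (le_abs_self _).trans
      (P.abs_pairing_le zero_le_one le_rfl (by positivity) hinc hinc)
  have h3 := P.pairing_one_self_nonneg hn d
  have e : P.forecast μ r (P.step μ x i) = X + d := P.forecast_step μ r x i
  rw [e, Policy.pairing_add_self]
  set A := P.formBound * ((P.T + 3) * b) ^ 2
  have h4 : P.pairing 1 d d ^ 2 ≤ A ^ 2 := by gcongr
  have hA : 0 ≤ A := h3.trans h2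
  have h5 : 0 ≤ A ^ 2 * P.pairing 1 X X := by positivity
  -- `(2 a + e)² ≤ 8 a² + 2 e²`, where `a²` is linear in the form by Cauchy–Schwarz.
  nlinarith [sq_nonneg (2 * P.pairing 1 X d - P.pairing 1 d d)]

/-- The end-of-cycle case of the collapse estimate; `E` and `F` stand for the conditional means of
the next value of the form and of its square. The gain in the square is `4 T c V` with `c` of order
`√V`. It beats the linear terms, of total coefficient `K'`, once `V` exceeds `Vs`; below that level
they are at most `K' Vs`. -/
theorem quartic_drift_of_sqrt {V D C₂ T δ C₃ Γ K K' Vs C E F : ℝ} (hV : 0 ≤ V) (hD : 0 ≤ D)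
    (hC₂ : 0 ≤ C₂) (hT : 1 ≤ T) (hδ : 0 < δ) (hC₃ : 0 ≤ C₃) (hΓ : 0 < Γ) (hK : 0 ≤ K)
    (hK' : K' = 2 * D + C₂ + K * T + 1)
    (hVs : Vs = 2 * (Γ * (K' / (2 * T * δ)) ^ 2 + C₃)) (hC : C = C₂ + K * T * D + K' * Vs)
    (hF : F ≤ -V ^ 2 + C₂ * (V + 1) + 2 * V * E)
    (hE : E ≤ V + D - 2 * T * (δ / 2 * √((V / 2 - C₃) / Γ))) :
    F + K * ((T - 1) * E) + V ≤ V ^ 2 + K * (0 * V) + C := by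
  set c := δ / 2 * √((V / 2 - C₃) / Γ) with hc
  have hc0 : 0 ≤ c := by positivity
  have hK'0 : 0 < K' := by rw [hK']; positivity
  have hVs0 : 0 ≤ Vs := by rw [hVs]; positivity
  have hd' : E ≤ V + D := hE.trans (sub_le_self _ (by positivity))
  have h7 : 0 ≤ T - 1 := by linarith
  have h4 : K * ((T - 1) * E) ≤ K * (T * (V + D)) := by
    have : (T - 1) * E ≤ T * (V + D) :=
      (mul_le_mul_of_nonneg_left hd' h7).trans
        (mul_le_mul_of_nonneg_right (by linarith) (by positivity))
    gcongr
  have h5 := mul_le_mul_of_nonneg_left hE (show 0 ≤ 2 * V by positivity)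
  have h6 : (K' - 4 * T * c) * V ≤ K' * Vs := by
    rcases le_total K' (4 * T * c) with h8 | h8
    · exact (mul_nonpos_of_nonpos_of_nonneg (by linarith) hV).trans (by positivity)
    · have h9 : √((V / 2 - C₃) / Γ) ≤ K' / (2 * T * δ) := by
        rw [le_div_iff₀ (by positivity)]
        rw [hc] at h8
        linarith
      rw [Real.sqrt_le_left (by positivity), div_le_iff₀ hΓ] at h9
      have h10 : V ≤ Vs := by rw [hVs]; linarith
      have h11 : 0 ≤ 4 * T * c * V := by positivity
      have h12 := mul_le_mul_of_nonneg_left h10 hK'0.le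
      linarith
  have h13 : K' * V = (2 * D + C₂ + K * T + 1) * V := by rw [hK']
  rw [hC]
  linarith

set_option maxHeartbeats 1000000 in
/-- State space collapse: the stationary mean square deviation of the queue lengths from
proportionality to `γ` is bounded uniformly in heavy traffic. -/
theorem exists_collapse_bound (hn : 0 < n) (hb : 0 ≤ b) {δ : ℝ} (hδ0 : 0 < δ)
    (hδ : ∀ (η : Equiv.Perm (Fin n)) (m : ℕ), 1 ≤ m → m < n →
      (∑ l, serviceRate svc l) * (∑ l : Fin n with l.val < m, P.f (serviceRate svc) η l)
        - ∑ l : Fin n with l.val < m, serviceRate svc (η l) ≤ -δ) :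
    ∃ C : ℝ, 0 ≤ C ∧ ∀ (arr : Measure ℕ) [IsProbabilityMeasure arr] (ε : ℝ),
      Regime svc arr b ε → 0 ≤ ε → ε ≤ δ / 2 → ∀ ρ, P.IsSteadyState svc arr ρ →
        ∫⁻ x, ENNReal.ofReal (P.pairing 1 (fun l => (x.1 l : ℝ)) fun l => (x.1 l : ℝ)) ∂ρ
          ≤ ENNReal.ofReal C := by
  have hΓ := P.Γ_pos hn
  have hF := P.formBound_nonneg
  have hD0 := P.driftBound_nonneg b
  have hT : (1 : ℝ) ≤ P.T := by exact_mod_cast P.T_pos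
  set D := P.driftBound b with hD
  set C₂ := 8 * (P.formBound * ((P.T + 3) * b) ^ 2) + 2 * (P.formBound * ((P.T + 3) * b) ^ 2) ^ 2
    with hC₂
  have hC₂0 : 0 ≤ C₂ := by positivity
  -- Within a cycle `V²` can grow by `(2 D + C₂) V` plus a constant. Losing one slot in `K *
  -- (slotsLeft * V)` offsets this growth and leaves the wanted `-V`.
  set K := 2 * D + C₂ + 1 with hK
  have hK0 : 0 ≤ K := by positivity
  set K' := 2 * D + C₂ + K * P.T + 1 with hK'
  have hK'0 : 0 < K' := by positivity
  set C₃ := P.formBound * (((P.T + 1) * b) * ((P.T + 1) * b)) with hC₃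
  have hC₃0 : 0 ≤ C₃ := by positivity
  set Vs := 2 * (P.Γ * (K' / (2 * P.T * δ)) ^ 2 + C₃) with hVs
  have hVs0 : 0 ≤ Vs := by positivity
  set C := C₂ + K * P.T * D + K' * Vs with hC
  have hC0 : 0 ≤ C := by positivity
  set Cr := P.formBound * ((P.T * b) * (P.T * b)) with hCr
  have hCr0 : 0 ≤ Cr := by positivity
  refine ⟨2 * C + 2 * Cr, by positivity, fun arr _ ε H hε hεδ ρ hρ => ?_⟩
  have := hρ.1
  set r := (∑ l, serviceRate svc l) - ε with hr
  have hmem : 0 ≤ r ∧ r ≤ b := H.arrivalRate_mem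
  set V : P.State → ℝ := fun x => P.pairing 1 (P.forecast (serviceRate svc) r x) (P.forecast (serviceRate svc) r x) with hV
  have hV0 : ∀ x, 0 ≤ V x := fun x => P.pairing_one_self_nonneg hn _
  have hdrift : ∀ x, ∫ i, (V (P.step (serviceRate svc) x i) ^ 2
      + K * (P.slotsLeft (P.step (serviceRate svc) x i) * V (P.step (serviceRate svc) x i))) ∂inputLaw svc arr + V x
      ≤ V x ^ 2 + K * (P.slotsLeft x * V x) + C := by
    intro x
    have hVx := hV0 x
    set c := δ / 2 * √((V x / 2 - C₃) / P.Γ) with hc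
    have hc0 : 0 ≤ c := by positivity
    have hd : ∫ i, V (P.step (serviceRate svc) x i) ∂inputLaw svc arr
        ≤ V x + D - (if (x.2.2 : ℕ) + 1 < P.T then 0 else 2 * P.T * c) := by
      refine H.quadratic_drift P zero_le_one le_rfl hr x ?_
      intro _ a s ha hs η hη
      refine (P.sorted_pairing_one_le (μ := serviceRate svc) hn hε hεδ hδ hη).trans ?_
      rw [neg_le_neg_iff, hc]
      gcongr
      set q' : Fin n → ℝ := fun l => (P.nextQueue x a s l : ℝ) with hq'
      have e1 : P.forecast (serviceRate svc) r x = q' + (P.forecast (serviceRate svc) r x - q') := by rw [add_sub_cancel]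
      have e2 : ∀ l, |(P.forecast (serviceRate svc) r x - q') l| ≤ (P.T + 1) * b := by
        intro l
        have h3 := P.abs_nextQueue_sub_le x (a, s, 0, 0) ha hs l
        have h4 := P.abs_remainingDrift_le H.serviceRate_mem hmem x.2.1 x.2.2 l
        simp only [Policy.forecast, Pi.sub_apply, Pi.add_apply, hq']
        rw [abs_le] at h3 h4 ⊢
        constructor <;> linarith
      -- Sorting acts on the sampled queues, while `V` is taken at the forecast; they differ by a
      -- bounded vector, hence the constant `C₃`.
      have h5 : V x ≤ 2 * P.pairing 1 q' q' + 2 * C₃ := by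
        simp only [hV]
        rw [e1]
        refine (P.pairing_one_add_self_le hn _ _).trans ?_
        have := (le_abs_self _).trans
          (P.abs_pairing_le zero_le_one le_rfl (by positivity) e2 e2)
        linarith
      linarith
    have hI := H.integrable_step P V x
    have hI2 := H.integrable_step P (fun y => V y ^ 2) x
    have hI3 := H.integrable_step P (fun y => P.slotsLeft y * V y) x
    have hlin : Integrable (fun i => (-V x ^ 2 + C₂ * (V x + 1)) + 2 * V x * V (P.step (serviceRate svc) x i))
        (inputLaw svc arr) := (integrable_const _).add (hI.const_mul _)
    have hsq : ∫ i, V (P.step (serviceRate svc) x i) ^ 2 ∂inputLaw svc arr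
        ≤ -V x ^ 2 + C₂ * (V x + 1) + 2 * V x * ∫ i, V (P.step (serviceRate svc) x i) ∂inputLaw svc arr := by
      calc _ ≤ ∫ i, ((-V x ^ 2 + C₂ * (V x + 1)) + 2 * V x * V (P.step (serviceRate svc) x i))
            ∂inputLaw svc arr := by
            refine integral_mono_ae hI2 hlin ?_
            filter_upwards [H.ae_arr_le, H.ae_svc_le] with i ha hs
            have h := sq_quadratic_sub_le P hn H.serviceRate_mem hmem x ha hs
            change (V (P.step (serviceRate svc) x i) - V x) ^ 2 ≤ C₂ * (V x + 1) at h
            linarith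
        _ = _ := by
            rw [integral_add (integrable_const _) (hI.const_mul _), integral_const_mul]
            simp
    rw [integral_add hI2 (hI3.const_mul K), integral_const_mul]
    set E := ∫ i, V (P.step (serviceRate svc) x i) ∂inputLaw svc arr with hE
    have hvs : 0 ≤ K' * Vs := by positivity
    by_cases hx : (x.2.2 : ℕ) + 1 < P.T
    · rw [if_pos hx, sub_zero] at hd
      simp only [P.slotsLeft_step_of_lt (serviceRate svc) hx]
      rw [integral_const_mul]
      have h1 : 0 ≤ P.slotsLeft x - 1 := by
        rw [← P.slotsLeft_step_of_lt (serviceRate svc) hx (0, 0, 0, 0)]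
        exact P.slotsLeft_nonneg _
      have h2 := mul_le_mul_of_nonneg_left hd h1
      have h3 : (P.slotsLeft x - 1) * D ≤ P.T * D := by
        have := P.slotsLeft_le x
        gcongr
        linarith
      have h4 : K * ((P.slotsLeft x - 1) * E) ≤ K * ((P.slotsLeft x - 1) * V x + P.T * D) := by
        gcongr
        linarith
      have h5 := mul_le_mul_of_nonneg_left hd (show 0 ≤ 2 * V x by positivity)
      have h6 : K * V x = (2 * D + C₂ + 1) * V x := by rw [hK]
      rw [hC]
      linarith
    · rw [if_neg hx] at hd
      simp only [P.slotsLeft_step_of_not_lt (serviceRate svc) hx, P.slotsLeft_of_not_lt hx]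
      rw [integral_const_mul]
      exact quartic_drift_of_sqrt hVx hD0 hC₂0 hT hδ0 hC₃0 hΓ hK0 hK' hVs hC hsq hd
  have h1 := lintegral_le_of_drift hρ.2 (h := fun _ => ENNReal.ofReal C)
    (fun _ => ENNReal.ofReal_ne_top)
    (H.markovOp_add_le P (V := fun x => V x ^ 2 + K * (P.slotsLeft x * V x)) (fun x => by
      have := hV0 x
      have := P.slotsLeft_nonneg x
      positivity) hV0 hC0 hdrift)
  have h2 : ∀ x : P.State,
      ENNReal.ofReal (P.pairing 1 (fun l => (x.1 l : ℝ)) fun l => (x.1 l : ℝ))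
        ≤ 2 * ENNReal.ofReal (V x) + 2 * ENNReal.ofReal Cr := by
    intro x
    have hrd := P.abs_remainingDrift_le H.serviceRate_mem hmem x.2.1 x.2.2
    have hrd' : ∀ l, |(-P.remainingDrift (serviceRate svc) r x.2.1 x.2.2) l| ≤ P.T * b := fun l => by
      rw [Pi.neg_apply, abs_neg]; exact hrd l
    have e : (fun l => (x.1 l : ℝ)) = P.forecast (serviceRate svc) r x + -P.remainingDrift (serviceRate svc) r x.2.1 x.2.2 := by
      rw [Policy.forecast]; abel
    have h3 := P.pairing_one_add_self_le hn (P.forecast (serviceRate svc) r x)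
      (-P.remainingDrift (serviceRate svc) r x.2.1 x.2.2)
    rw [← e] at h3
    have h4 := (le_abs_self _).trans
      (P.abs_pairing_le zero_le_one le_rfl (by positivity) hrd' hrd')
    rw [← ENNReal.ofReal_ofNat, ← ENNReal.ofReal_mul (by norm_num),
      ← ENNReal.ofReal_mul (by norm_num), ← ENNReal.ofReal_add (by have := hV0 x; positivity)
        (by positivity)]
    exact ENNReal.ofReal_le_ofReal (by linarith)
  refine (lintegral_mono h2).trans ?_
  have h3 : ENNReal.ofReal (2 * C + 2 * Cr) = 2 * ENNReal.ofReal C + 2 * ENNReal.ofReal Cr := by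
    rw [ENNReal.ofReal_add (mul_nonneg zero_le_two hC0) (mul_nonneg zero_le_two hCr0),
      ENNReal.ofReal_mul zero_le_two, ENNReal.ofReal_mul zero_le_two, ENNReal.ofReal_ofNat]
  rw [lintegral_add_right _ measurable_const, lintegral_const_mul _ (measurable_of_countable _), h3]
  simp only [lintegral_const, measure_univ, mul_one] at h1 ⊢
  gcongr

end Collapse

/-! ### The drift of the squared total queue length. -/

section HeavyTraffic

variable {n : ℕ} (P : Policy n) {svc : Measure (Fin n → ℕ)} [IsProbabilityMeasure svc]
  {arr : Measure ℕ} [IsProbabilityMeasure arr] {b ε : ℝ}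

/-- The expected unused service of a slot. -/
noncomputable def Policy.meanUnused (svc : Measure (Fin n → ℕ)) (arr : Measure ℕ) (x : P.State) :
    ℝ :=
  ∫ i, ∑ l, P.unused x i l ∂inputLaw svc arr

theorem Policy.meanUnused_nonneg (x : P.State) : 0 ≤ P.meanUnused svc arr x :=
  integral_nonneg fun i => Finset.sum_nonneg fun l _ => P.unused_nonneg x i l

theorem Regime.integrable_sum_unused (H : Regime svc arr b ε) (x : P.State) :
    Integrable (fun i => ∑ l, P.unused x i l) (inputLaw svc arr) := by
  have h := ((H.integrable_step P (fun y => ∑ l, (y.1 l : ℝ)) x).sub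
    (integrable_const (∑ l, (x.1 l : ℝ)))).sub H.integrable_netInput
  refine h.congr (ae_of_all _ fun i => ?_)
  simp only [Pi.sub_apply, step_fst, P.sum_nextQueue_eq x i]
  ring

theorem Regime.integral_sum_step (H : Regime svc arr b ε) (x : P.State) :
    ∫ i, ∑ l, ((P.step (serviceRate svc) x i).1 l : ℝ) ∂inputLaw svc arr
      = ∑ l, (x.1 l : ℝ) - ε + P.meanUnused svc arr x := by
  have h1 : Integrable (fun i => ∑ l, (x.1 l : ℝ) + netInput i) (inputLaw svc arr) :=
    (integrable_const _).add H.integrable_netInput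
  simp only [step_fst, P.sum_nextQueue_eq x]
  rw [integral_add h1 (H.integrable_sum_unused P x),
    integral_add (integrable_const _) H.integrable_netInput, H.integral_netInput]
  simp only [integral_const, probReal_univ, one_smul]
  rw [Policy.meanUnused]
  ring

/-- In steady state the expected unused service is the gap between capacity and arrival rate. -/
theorem Regime.lintegral_meanUnused (H : Regime svc arr b ε) (hε : 0 ≤ ε) {ρ : Measure P.State}
    (hρ : P.IsSteadyState svc arr ρ) (hfin : P.meanTotalQueue ρ < ∞) :
    ∫⁻ x, ENNReal.ofReal (P.meanUnused svc arr x) ∂ρ = ENNReal.ofReal ε := by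
  have := hρ.1
  have hS0 : ∀ x : P.State, 0 ≤ ∑ l, (x.1 l : ℝ) :=
    fun x => Finset.sum_nonneg fun l _ => Nat.cast_nonneg _
  have h1 : ∀ x : P.State,
      markovOp (P.kernel svc arr) (fun y => ENNReal.ofReal (∑ l, (y.1 l : ℝ))) x
        + ENNReal.ofReal ε
      = ENNReal.ofReal (∑ l, (x.1 l : ℝ)) + ENNReal.ofReal (P.meanUnused svc arr x) := by
    intro x
    have h2 : 0 ≤ ∫ i, ∑ l, ((P.step (serviceRate svc) x i).1 l : ℝ) ∂inputLaw svc arr :=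
      integral_nonneg fun i => hS0 _
    rw [markovOp_kernel, ← ofReal_integral_eq_lintegral_ofReal
      (H.integrable_step P (fun y => ∑ l, (y.1 l : ℝ)) x) (ae_of_all _ fun i => hS0 _),
      ← ENNReal.ofReal_add h2 hε, ← ENNReal.ofReal_add (hS0 x) (P.meanUnused_nonneg x),
      H.integral_sum_step]
    congr 1
    ring
  have h2 := lintegral_congr (μ := ρ) h1
  rw [lintegral_add_right _ measurable_const, lintegral_markovOp hρ.2,
    lintegral_add_left (measurable_of_countable _), ← P.meanTotalQueue_eq] at h2
  -- Finiteness of the mean is needed to cancel it.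
  have h3 := (ENNReal.add_right_inj hfin.ne).1 h2
  rw [← h3]
  simp

/-- Unused service leaves an empty queue, and then the squared total `y²` is controlled by the
deviation from proportionality. The split `y ≤ K + y² / K` charges one part to the mean unused
service and the other to the collapse bound. -/
theorem sum_nextQueue_mul_unused_le (hn : 0 < n) {K : ℝ} (hK : 0 < K) (x : P.State)
    {i : ℕ × (Fin n → ℕ) × unitInterval × unitInterval} (hs : ∀ l, (i.2.1 l : ℝ) ≤ b) :
    (∑ l, (P.nextQueue x i.1 i.2.1 l : ℝ)) * ∑ l, P.unused x i l
      ≤ K * ∑ l, P.unused x i l + n * b * (P.Γ ^ 2 * P.formBound) / K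
        * P.pairing 1 (fun l => (P.nextQueue x i.1 i.2.1 l : ℝ))
          fun l => (P.nextQueue x i.1 i.2.1 l : ℝ) := by
  set q : Fin n → ℝ := fun l => (P.nextQueue x i.1 i.2.1 l : ℝ) with hq
  set u := ∑ l, P.unused x i l with hu
  have hb : 0 ≤ b := (Nat.cast_nonneg _).trans (hs ⟨0, hn⟩)
  have hF := P.formBound_nonneg
  have hB := P.pairing_one_self_nonneg hn q
  have hu0 : 0 ≤ u := Finset.sum_nonneg fun l _ => P.unused_nonneg x i l
  have hub : u ≤ n * b := by
    calc u ≤ ∑ _l : Fin n, b := Finset.sum_le_sum fun l _ => (P.unused_le x i l).trans (hs l)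
      _ = _ := by simp
  by_cases h : ∀ l, P.unused x i l = 0
  · have hu' : u = 0 := Finset.sum_eq_zero fun l _ => h l
    rw [hu', mul_zero, mul_zero, zero_add]
    positivity
  · push Not at h
    obtain ⟨l, hl⟩ := h
    have h0 : q l = 0 := by
      simp only [hq, P.nextQueue_eq_zero_of_unused_ne_zero hl, Nat.cast_zero]
    have h1 := P.sum_sq_le_of_eq_zero hn h0
    set y := ∑ l, q l
    have h2 : y ≤ K + y ^ 2 / K := by
      rw [← sub_nonneg]
      have : K + y ^ 2 / K - y = ((K - y / 2) ^ 2 + 3 / 4 * y ^ 2) / K := by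
        field_simp
        ring
      rw [this]
      positivity
    calc y * u ≤ (K + y ^ 2 / K) * u := by gcongr
      _ = K * u + u * y ^ 2 / K := by ring
      _ ≤ K * u + n * b * (P.Γ ^ 2 * P.formBound * P.pairing 1 q q) / K := by gcongr
      _ = _ := by ring

/-- The second moment drift of the total queue length. -/
theorem Regime.two_mul_meanTotalQueue_le (H : Regime svc arr b ε) (hn : 0 < n) (hε : 0 < ε)
    {ρ : Measure P.State} (hρ : P.IsSteadyState svc arr ρ) (hfin : P.meanTotalQueue ρ < ∞)
    {C : ℝ} (hC0 : 0 ≤ C)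
    (hC : ∫⁻ x, ENNReal.ofReal (P.pairing 1 (fun l => (x.1 l : ℝ)) fun l => (x.1 l : ℝ)) ∂ρ
      ≤ ENNReal.ofReal C) :
    ENNReal.ofReal (2 * ε) * P.meanTotalQueue ρ
      ≤ ENNReal.ofReal (∫ i, netInput i ^ 2 ∂inputLaw svc arr
        + (2 + 2 * (n * b * (P.Γ ^ 2 * P.formBound)) * C) * √ε) := by
  have := hρ.1
  have hb := H.b_nonneg
  have hF := P.formBound_nonneg
  set Z := ∫ i, netInput i ^ 2 ∂inputLaw svc arr with hZ
  have hZ0 : 0 ≤ Z := integral_nonneg fun i => sq_nonneg _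
  set A := n * b * (P.Γ ^ 2 * P.formBound) with hA
  have hA0 : 0 ≤ A := by positivity
  have hsq : 0 < √ε := Real.sqrt_pos.2 hε
  -- Mean unused service is `ε`, so the two errors are of order `K ε` and `1 / K`; this choice makes
  -- both of order `√ε`.
  set K := (√ε)⁻¹ with hK
  have hK0 : 0 < K := by positivity
  set S : P.State → ℝ := fun x => ∑ l, (x.1 l : ℝ) with hS
  have hS0 : ∀ x : P.State, 0 ≤ S x :=
    fun x => Finset.sum_nonneg fun l _ => Nat.cast_nonneg _
  set G : P.State → ℝ := fun x => P.pairing 1 (fun l => (x.1 l : ℝ)) fun l => (x.1 l : ℝ) with hG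
  have hG0 : ∀ x, 0 ≤ G x := fun x => P.pairing_one_self_nonneg hn _
  have hpt : ∀ x, markovOp (P.kernel svc arr) (fun y => ENNReal.ofReal (S y ^ 2)) x
      + ENNReal.ofReal (2 * ε) * ENNReal.ofReal (S x)
      ≤ ENNReal.ofReal (S x ^ 2) + (ENNReal.ofReal Z
        + (ENNReal.ofReal (2 * K) * ENNReal.ofReal (P.meanUnused svc arr x)
        + ENNReal.ofReal (2 * (A / K))
          * markovOp (P.kernel svc arr) (fun y => ENNReal.ofReal (G y)) x)) := by
    intro x
    have hIG := H.integrable_step P G x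
    have hIu := H.integrable_sum_unused P x
    have hIq := H.integrable_quadratic_netInput (S x ^ 2) (2 * S x) 1
    have hm0 := P.meanUnused_nonneg (svc := svc) (arr := arr) x
    have hEG : 0 ≤ ∫ i, G (P.step (serviceRate svc) x i) ∂inputLaw svc arr :=
      integral_nonneg fun i => hG0 _
    have hA1 : Integrable (fun i => (S x ^ 2 + 2 * S x * netInput i + 1 * netInput i ^ 2)
        + 2 * K * ∑ l, P.unused x i l) (inputLaw svc arr) := hIq.add (hIu.const_mul _)
    have hle : ∫ i, S (P.step (serviceRate svc) x i) ^ 2 ∂inputLaw svc arr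
        ≤ S x ^ 2 - 2 * S x * ε + 1 * Z + 2 * K * P.meanUnused svc arr x
          + 2 * (A / K) * ∫ i, G (P.step (serviceRate svc) x i) ∂inputLaw svc arr := by
      calc _ ≤ ∫ i, ((S x ^ 2 + 2 * S x * netInput i + 1 * netInput i ^ 2)
            + 2 * K * ∑ l, P.unused x i l
            + 2 * (A / K) * G (P.step (serviceRate svc) x i)) ∂inputLaw svc arr := by
            refine integral_mono_ae (H.integrable_step P (fun y => S y ^ 2) x)
              (hA1.add (hIG.const_mul _)) ?_
            filter_upwards [H.ae_svc_le] with i hs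
            have h1 := sum_nextQueue_mul_unused_le P hn hK0 x hs
            have h2 := P.sum_nextQueue_eq x i
            simp only [hS, hG, step_fst]
            rw [← hA] at h1
            set y' := ∑ l, (P.nextQueue x i.1 i.2.1 l : ℝ)
            set u := ∑ l, P.unused x i l
            have h3 : y' - u = ∑ l, (x.1 l : ℝ) + netInput i := by rw [h2]; ring
            have h4 : (y' - u) ^ 2 = (∑ l, (x.1 l : ℝ) + netInput i) ^ 2 := by rw [h3]
            -- `y'² = (y' - u)² + 2 y' u - u²`, with the last term dropped.
            nlinarith [sq_nonneg u]
        _ = _ := by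
            rw [integral_add hA1 (hIG.const_mul _), integral_add hIq (hIu.const_mul _),
              integral_const_mul, integral_const_mul, H.integral_quadratic_netInput]
            rfl
    rw [markovOp_kernel, markovOp_kernel,
      ← ofReal_integral_eq_lintegral_ofReal (H.integrable_step P (fun y => S y ^ 2) x)
        (ae_of_all _ fun i => sq_nonneg _),
      ← ofReal_integral_eq_lintegral_ofReal hIG (ae_of_all _ fun i => hG0 _),
      ← ENNReal.ofReal_mul (by positivity), ← ENNReal.ofReal_mul (by positivity),
      ← ENNReal.ofReal_mul (by positivity),
      ← ENNReal.ofReal_add (integral_nonneg fun i => sq_nonneg _)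
        (mul_nonneg (by positivity) (hS0 x)),
      ← ENNReal.ofReal_add (by positivity) (by positivity),
      ← ENNReal.ofReal_add hZ0 (by positivity), ← ENNReal.ofReal_add (by positivity) (by positivity)]
    refine ENNReal.ofReal_le_ofReal ?_
    linarith
  have h1 := lintegral_le_of_drift hρ.2 (fun _ => ENNReal.ofReal_ne_top) hpt
  rw [lintegral_const_mul _ (measurable_of_countable _), ← P.meanTotalQueue_eq,
    lintegral_add_left measurable_const, lintegral_add_left (measurable_of_countable _),
    lintegral_const_mul _ (measurable_of_countable _),
    lintegral_const_mul _ (measurable_of_countable _), lintegral_markovOp hρ.2,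
    H.lintegral_meanUnused P hε.le hρ hfin] at h1
  simp only [lintegral_const, measure_univ, mul_one] at h1
  refine h1.trans ?_
  have h2 : Z + (2 + 2 * A * C) * √ε = Z + (2 * K * ε + 2 * (A / K) * C) := by
    have h3 : ε = √ε * √ε := (Real.mul_self_sqrt hε.le).symm
    have h4 : K * ε = √ε := by
      rw [hK]
      nth_rewrite 2 [h3]
      rw [← mul_assoc, inv_mul_cancel₀ hsq.ne', one_mul]
    have h5 : A / K = A * √ε := by rw [hK, div_inv_eq_mul]
    rw [h5, mul_assoc 2 K ε, h4]
    ring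
  rw [h2, ENNReal.ofReal_add hZ0 (by positivity), ENNReal.ofReal_add (by positivity) (by positivity),
    ENNReal.ofReal_mul (show 0 ≤ 2 * K by positivity),
    ENNReal.ofReal_mul (show 0 ≤ 2 * (A / K) by positivity)]
  gcongr

theorem half_le_of_le_two_mul {x ε : ℝ} {m : ℝ≥0∞} (h : ENNReal.ofReal x
    ≤ ENNReal.ofReal (2 * ε) * m) : ENNReal.ofReal (x / 2) ≤ ENNReal.ofReal ε * m := by
  rw [ENNReal.ofReal_mul zero_le_two, ENNReal.ofReal_ofNat, mul_assoc] at h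
  rw [ENNReal.ofReal_div_of_pos two_pos, ENNReal.ofReal_ofNat]
  exact ENNReal.div_le_of_le_mul' h

theorem le_half_of_two_mul_le {x ε : ℝ} {m : ℝ≥0∞} (h : ENNReal.ofReal (2 * ε) * m
    ≤ ENNReal.ofReal x) : ENNReal.ofReal ε * m ≤ ENNReal.ofReal (x / 2) := by
  rw [ENNReal.ofReal_mul zero_le_two, ENNReal.ofReal_ofNat, mul_assoc] at h
  rw [ENNReal.ofReal_div_of_pos two_pos, ENNReal.ofReal_ofNat,
    ENNReal.le_div_iff_mul_le (Or.inl two_ne_zero) (Or.inl ENNReal.ofNat_ne_top), mul_comm]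
  exact h

theorem Regime.le_pooledMeanQueue (H : Regime svc arr b ε) (hε : 0 < ε) {ν : Measure ℕ}
    (hν : IsPooledSteadyState svc arr ν) :
    ENNReal.ofReal ((∫ i, netInput i ^ 2 ∂inputLaw svc arr - (n + 1) * b * ε) / 2)
      ≤ ENNReal.ofReal ε * pooledMeanQueue ν := by
  have hb := H.b_nonneg
  refine half_le_of_le_two_mul ?_
  rw [ENNReal.ofReal_sub _ (by positivity)]
  exact tsub_le_iff_right.2 (le_two_mul_pooledMeanQueue H hε hν)

theorem Regime.lintegral_arr (H : Regime svc arr b ε) :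
    ∫⁻ a : ℕ, (a : ℝ≥0∞) ∂arr = ENNReal.ofReal ((∑ l, serviceRate svc l) - ε) := by
  rw [← H.mean, ofReal_integral_eq_lintegral_ofReal H.integrable_arr
    (ae_of_all _ fun a => Nat.cast_nonneg _)]
  simp

end HeavyTraffic

/-! ### Two-sided bounds with a common limit. -/

section Limits

variable {n : ℕ} (P : Policy n) {svc : Measure (Fin n → ℕ)} [IsProbabilityMeasure svc]
  {arr : ℝ → Measure ℕ} [∀ ε, IsProbabilityMeasure (arr ε)] {b : ℝ}

/-- Stability for small `ε`, with two-sided bounds on the scaled mean queue lengths of the policy and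
of the pooled queue that have a common limit. -/
theorem exists_heavyTraffic_bounds (hn : 0 < n) (hb : 0 ≤ b)
    (H : ∀ᶠ ε in 𝓝[>] (0 : ℝ), Regime svc (arr ε) b ε) (hμ : 0 < ∑ l, serviceRate svc l) {σ : ℝ}
    (hvar : Tendsto (fun ε => variance (fun a : ℕ => (a : ℝ)) (arr ε)) (𝓝[>] 0) (𝓝 σ))
    (hP : P.StrictMajorization (serviceRate svc)) :
    ∃ lo hi : ℝ → ℝ,
      Tendsto lo (𝓝[>] 0)
        (𝓝 ((σ + variance (fun s : Fin n → ℕ => ∑ l, (s l : ℝ)) svc) / 2)) ∧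
      Tendsto hi (𝓝[>] 0)
        (𝓝 ((σ + variance (fun s : Fin n → ℕ => ∑ l, (s l : ℝ)) svc) / 2)) ∧
      ∀ᶠ ε in 𝓝[>] (0 : ℝ), (∃ ρ, P.IsSteadyState svc (arr ε) ρ) ∧
        (∀ ρ, P.IsSteadyState svc (arr ε) ρ → P.meanTotalQueue ρ < ∞ ∧
          ENNReal.ofReal ε * P.meanTotalQueue ρ ≤ ENNReal.ofReal (hi ε)) ∧
        ∀ ν, IsPooledSteadyState svc (arr ε) ν →
          ENNReal.ofReal (lo ε) ≤ ENNReal.ofReal ε * pooledMeanQueue ν := by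
  obtain ⟨δ, hδ0, hδ⟩ := hP.exists_gap hμ
  obtain ⟨C, hC0, hC⟩ := exists_collapse_bound P hn hb hδ0 hδ
  have hF := P.formBound_nonneg
  set Z : ℝ → ℝ := fun ε => variance (fun a : ℕ => (a : ℝ)) (arr ε)
    + variance (fun s : Fin n → ℕ => ∑ l, (s l : ℝ)) svc + ε ^ 2 with hZ
  set A : ℝ := 2 + 2 * (n * b * (P.Γ ^ 2 * P.formBound)) * C with hA
  have hA0 : 0 ≤ A := by positivity
  have hid : Tendsto (fun ε : ℝ => ε) (𝓝[>] 0) (𝓝 0) := tendsto_id.mono_left nhdsWithin_le_nhds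
  have hsqrt : Tendsto (fun ε : ℝ => √ε) (𝓝[>] 0) (𝓝 0) := by
    simpa using (Real.continuous_sqrt.tendsto 0).mono_left nhdsWithin_le_nhds
  have hZlim : Tendsto Z (𝓝[>] 0)
      (𝓝 (σ + variance (fun s : Fin n → ℕ => ∑ l, (s l : ℝ)) svc)) := by
    simpa using (hvar.add_const _).add (hid.pow 2)
  refine ⟨fun ε => (Z ε - (n + 1) * b * ε) / 2, fun ε => (Z ε + A * √ε) / 2, ?_, ?_, ?_⟩
  · simpa using (hZlim.sub (hid.const_mul ((n + 1) * b))).div_const 2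
  · simpa using (hZlim.add (hsqrt.const_mul A)).div_const 2
  · filter_upwards [H, Ioo_mem_nhdsGT (half_pos hδ0)] with ε Hε hε
    have hεδ : ε ≤ δ := by linarith [hε.2]
    have hε0 : 0 < ε := hε.1
    refine ⟨Hε.exists_steadyState P hn hε0 hεδ hδ, fun ρ hρ => ?_, fun ν hν => ?_⟩
    · have hfin := Hε.meanTotalQueue_lt_top P hn hε0 hεδ hδ hρ
      refine ⟨hfin, le_half_of_two_mul_le ?_⟩
      have h := Hε.two_mul_meanTotalQueue_le P hn hε0 hρ hfin hC0
        (hC (arr ε) ε Hε hε0.le hε.2.le ρ hρ)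
      rwa [Hε.integral_netInput_sq] at h
    · have h := Hε.le_pooledMeanQueue hε0 hν
      rwa [Hε.integral_netInput_sq] at h

theorem variance_sum_of_covariance_eq_zero {Smax : ℝ}
    (hsvc : ∀ᵐ s ∂svc, ∀ l, (s l : ℝ) ≤ Smax)
    (h : ∀ l m, l ≠ m →
      covariance (fun s : Fin n → ℕ => (s l : ℝ)) (fun s => (s m : ℝ)) svc = 0) :
    variance (fun s : Fin n → ℕ => ∑ l, (s l : ℝ)) svc
      = ∑ l, variance (fun s : Fin n → ℕ => (s l : ℝ)) svc := by
  have hL : ∀ l, MemLp (fun s : Fin n → ℕ => (s l : ℝ)) 2 svc := fun l =>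
    MemLp.of_bound (measurable_of_countable _).aestronglyMeasurable Smax <| by
      filter_upwards [hsvc] with s hs
      simpa using hs l
  have h1 : (fun s : Fin n → ℕ => ∑ l, (s l : ℝ)) = ∑ l, fun s : Fin n → ℕ => (s l : ℝ) := by
    ext s
    simp
  rw [h1, variance_sum' fun l _ => hL l]
  refine Finset.sum_congr rfl fun l _ => ?_
  rw [Finset.sum_eq_single l (fun m _ hm => h l m hm.symm) (by simp),
    covariance_self (hL l).aemeasurable]

end Limits

end LoadBalancing

/-! ### The main theorem. -/

theorem mainTheorem6 {n : ℕ} (P : LoadBalancing.Policy n)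
    (svc : Measure (Fin n → ℕ)) [IsProbabilityMeasure svc]
    (arr : ℝ → Measure ℕ) [∀ ε, IsProbabilityMeasure (arr ε)]
    (Smax Amax σsq ε₀ : ℝ) (hε₀ : 0 < ε₀)
    (hsvc : ∀ᵐ s ∂svc, ∀ l, (s l : ℝ) ≤ Smax)
    (hμ : ∀ l, 0 < LoadBalancing.serviceRate svc l)
    (harr : ∀ ε ∈ Set.Ioo 0 ε₀, ∀ᵐ a : ℕ ∂(arr ε), (a : ℝ) ≤ n * Amax)
    (hmean : ∀ ε ∈ Set.Ioo 0 ε₀,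
      ∫ a : ℕ, (a : ℝ) ∂(arr ε) = (∑ l, LoadBalancing.serviceRate svc l) - ε)
    (hvar : Tendsto (fun ε => variance (fun a : ℕ => (a : ℝ)) (arr ε)) (𝓝[>] 0) (𝓝 (n * σsq)))
    (hP : P.StrictMajorization (LoadBalancing.serviceRate svc)) :
    -- the policy is asymptotically delay-optimal in heavy traffic
    P.IsHeavyTrafficDelayOptimal svc arr ∧
    -- the pooled single-server queue is stable and bounds every policy of the framework from below
    (∀ ε ∈ Set.Ioo 0 ε₀, (∃ ν, LoadBalancing.IsPooledSteadyState svc (arr ε) ν) ∧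
      ∀ ν, LoadBalancing.IsPooledSteadyState svc (arr ε) ν →
        ∀ (P' : LoadBalancing.Policy n) (ρ' : Measure P'.State),
          P'.IsSteadyState svc (arr ε) ρ' →
            LoadBalancing.pooledMeanQueue ν ≤ P'.meanTotalQueue ρ') ∧
    -- the scaled expected queue lengths of the policy and of the pooled queue have the same limit
    (∀ ρ : ℝ → Measure P.State, (∀ᶠ ε in 𝓝[>] 0, P.IsSteadyState svc (arr ε) (ρ ε)) →
      Tendsto (fun ε => ENNReal.ofReal ε * P.meanTotalQueue (ρ ε)) (𝓝[>] 0)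
        (𝓝 (ENNReal.ofReal
          ((n * σsq + variance (fun s : Fin n → ℕ => ∑ l, (s l : ℝ)) svc) / 2)))) ∧
    (∀ ν : ℝ → Measure ℕ,
      (∀ᶠ ε in 𝓝[>] 0, LoadBalancing.IsPooledSteadyState svc (arr ε) (ν ε)) →
      Tendsto (fun ε => ENNReal.ofReal ε * LoadBalancing.pooledMeanQueue (ν ε)) (𝓝[>] 0)
        (𝓝 (ENNReal.ofReal
          ((n * σsq + variance (fun s : Fin n → ℕ => ∑ l, (s l : ℝ)) svc) / 2)))) ∧
    -- for services that are uncorrelated across servers the variances add up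
    ((∀ l m, l ≠ m → covariance (fun s : Fin n → ℕ => (s l : ℝ)) (fun s => (s m : ℝ)) svc = 0) →
      variance (fun s : Fin n → ℕ => ∑ l, (s l : ℝ)) svc
        = ∑ l, variance (fun s : Fin n → ℕ => (s l : ℝ)) svc) := by
  -- With no servers the mean number of arrivals would be `-ε < 0`.
  have hn : 0 < n := by
    rcases Nat.eq_zero_or_pos n with rfl | h
    · have h1 := hmean (ε₀ / 2) ⟨half_pos hε₀, half_lt_self hε₀⟩
      have h2 : 0 ≤ ∫ a : ℕ, (a : ℝ) ∂(arr (ε₀ / 2)) := integral_nonneg fun a => Nat.cast_nonneg a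
      rw [h1, Finset.univ_eq_empty, Finset.sum_empty] at h2
      linarith
    · exact h
  have hμ0 : 0 < ∑ l, LoadBalancing.serviceRate svc l :=
    Finset.sum_pos (fun l _ => hμ l) ⟨⟨0, hn⟩, Finset.mem_univ _⟩
  set b := max (max (n * Amax) Smax) 0
  have H : ∀ ε ∈ Set.Ioo 0 ε₀, LoadBalancing.Regime svc (arr ε) b ε := by
    intro ε hε
    refine ⟨?_, ?_, hmean ε hε⟩
    · filter_upwards [harr ε hε] with a ha
      exact ha.trans ((le_max_left _ _).trans (le_max_left _ _))
    · filter_upwards [hsvc] with s hs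
      exact fun l => (hs l).trans ((le_max_right _ _).trans (le_max_left _ _))
  have hε₀' := Ioo_mem_nhdsGT hε₀
  obtain ⟨lo, hi, hlo, hhi, hev⟩ := LoadBalancing.exists_heavyTraffic_bounds P hn
    (le_max_right _ _) (by filter_upwards [hε₀'] with ε hε using H ε hε) hμ0 hvar hP
  -- The threshold for `ε` is uniform over competing policies because the pooled queue does not
  -- depend on the policy.
  have hev' : ∀ᶠ ε in 𝓝[>] (0 : ℝ), ∀ (P' : LoadBalancing.Policy n) (ρ' : Measure P'.State),
      P'.IsSteadyState svc (arr ε) ρ' →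
        ENNReal.ofReal (lo ε) ≤ ENNReal.ofReal ε * P'.meanTotalQueue ρ' := by
    filter_upwards [hev, hε₀'] with ε h hε P' ρ' hρ'
    obtain ⟨ν, hν⟩ := LoadBalancing.exists_pooledSteadyState (H ε hε) hε.1
    refine (h.2.2 ν hν).trans ?_
    gcongr
    exact LoadBalancing.pooledMeanQueue_le_meanTotalQueue (H ε hε) hε.1 hν P' hρ'
  have hlam : ∀ᶠ ε in 𝓝[>] (0 : ℝ), 0 < (∑ l, LoadBalancing.serviceRate svc l) - ε := by
    filter_upwards [Ioo_mem_nhdsGT hμ0] with ε hε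
    linarith [hε.2]
  refine ⟨⟨?_, ?_, fun δ hδ => ?_⟩, fun ε hε => ⟨?_, fun ν hν P' ρ' hρ' => ?_⟩, fun ρ hρ => ?_,
    fun ν hν => ?_, LoadBalancing.variance_sum_of_covariance_eq_zero hsvc⟩
  · filter_upwards [hev] with ε h using h.1
  · filter_upwards [hev, hε₀', hlam] with ε h hε hl ρ hρ
    rw [LoadBalancing.meanDelay_eq P svc (arr ε) hμ hρ, (H ε hε).lintegral_arr]
    exact ENNReal.div_lt_top (h.2.1 ρ hρ).1.ne (ENNReal.ofReal_pos.2 hl).ne'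
  · have hgap : Tendsto (fun ε => ENNReal.ofReal
        ((hi ε - lo ε) / ((∑ l, LoadBalancing.serviceRate svc l) - ε))) (𝓝[>] 0) (𝓝 0) := by
      have hid : Tendsto (fun ε : ℝ => ε) (𝓝[>] 0) (𝓝 0) :=
        tendsto_id.mono_left nhdsWithin_le_nhds
      have := ENNReal.tendsto_ofReal ((hhi.sub hlo).div (hid.const_sub _) (by simpa using hμ0.ne'))
      simpa using this
    filter_upwards [hev, hev', hε₀', hlam, hgap.eventually_le_const hδ] with ε h h' hε hl hg
      ρ hρ P' ρ' hρ'
    rw [LoadBalancing.meanDelay_eq P svc (arr ε) hμ hρ,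
      LoadBalancing.meanDelay_eq P' svc (arr ε) hμ hρ', (H ε hε).lintegral_arr,
      ← mul_div_assoc, ← mul_div_assoc]
    refine le_trans ?_ (add_le_add_right hg _)
    rw [ENNReal.ofReal_div_of_pos hl, ← ENNReal.add_div]
    refine ENNReal.div_le_div_right ?_ _
    calc ENNReal.ofReal ε * P.meanTotalQueue ρ ≤ ENNReal.ofReal (hi ε) := (h.2.1 ρ hρ).2
      _ = ENNReal.ofReal (lo ε + (hi ε - lo ε)) := by rw [add_sub_cancel]
      _ ≤ ENNReal.ofReal (lo ε) + ENNReal.ofReal (hi ε - lo ε) := ENNReal.ofReal_add_le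
      _ ≤ _ := by
        gcongr
        exact h' P' ρ' hρ'
  · exact LoadBalancing.exists_pooledSteadyState (H ε hε) hε.1
  · exact LoadBalancing.pooledMeanQueue_le_meanTotalQueue (H ε hε) hε.1 hν P' hρ'
  · refine tendsto_of_tendsto_of_tendsto_of_le_of_le' (ENNReal.tendsto_ofReal hlo)
      (ENNReal.tendsto_ofReal hhi) ?_ ?_
    · filter_upwards [hev', hρ] with ε h hρε using h P _ hρε
    · filter_upwards [hev, hρ] with ε h hρε using (h.2.1 _ hρε).2
  · refine tendsto_of_tendsto_of_tendsto_of_le_of_le' (ENNReal.tendsto_ofReal hlo)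
      (ENNReal.tendsto_ofReal hhi) ?_ ?_
    · filter_upwards [hev, hν] with ε h hνε using h.2.2 _ hνε
    · filter_upwards [hev, hε₀', hν] with ε h hε hνε
      -- The stable policy itself bounds the pooled queue from above.
      obtain ⟨ρ, hρ⟩ := h.1
      refine le_trans ?_ (h.2.1 ρ hρ).2
      gcongr
      exact LoadBalancing.pooledMeanQueue_le_meanTotalQueue (H ε hε) hε.1 hνε P hρ
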